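/- Let $(M,g)$ be a smooth $n$-dimensional Lorentzian manifold of signature $(-,+,\dots,+)$, $n$ arbitrary, with Levi-Civita connection $\nabla$, Riemann tensor $R_{\alpha\beta\lambda\mu}$ and Ricci tensor $R_{\alpha\lambda}=R^{\rho}{}_{\alpha\rho\lambda}$. Let $\phi$ be a smooth function on $M$ such that the Einstein–Klein–Gordon equations of a minimally coupled massless scalar field hold (in units in which the coupling constant is $1$): $$R_{\alpha\beta}-\tfrac12 R\,g_{\alpha\beta}=\nabla_\alpha\phi\nabla_\beta\phi-\tfrac12(\nabla_\rho\phi\nabla^\rho\phi)g_{\alpha\beta},\qquad \nabla^\alpha\nabla_\alpha\phi=0 .$$ Let $B$ be the Bel tensor $$B_{\alpha\beta\lambda\mu}=R_{\alpha\rho\lambda\sigma}R_{\beta}{}^{\rho}{}_{\mu}{}^{\sigma}+R_{\alpha\rho\mu\sigma}R_{\beta}{}^{\rho}{}_{\lambda}{}^{\sigma}-\tfrac12 g_{\alpha\beta}R_{\rho\tau\lambda\sigma}R^{\rho\tau}{}_{\mu}{}^{\sigma}-\tfrac12 g_{\lambda\mu}R_{\alpha\rho\sigma\tau}R_{\beta}{}^{\rho\sigma\tau}+\tfrac18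 g_{\alpha\beta}g_{\lambda\mu}R_{\rho\tau\sigma\nu}R^{\rho\tau\sigma\nu}$$ and $S$ the super-energy tensor of the massless scalar field $$S_{\alpha\beta\lambda\mu}=\nabla_\alpha\nabla_\lambda\phi\nabla_\mu\nabla_\beta\phi+\nabla_\alpha\nabla_\mu\phi\nabla_\lambda\nabla_\beta\phi-g_{\alpha\beta}\nabla_\lambda\nabla^\rho\phi\nabla_\mu\nabla_\rho\phi-g_{\lambda\mu}\nabla_\alpha\nabla^\rho\phi\nabla_\beta\nabla_\rho\phi+\tfrac12 g_{\alpha\beta}g_{\lambda\mu}\nabla_\sigma\nabla_\rho\phi\nabla^\sigma\nabla^\rho\phi .$$ Let $\xi$ be a smooth Killing vector field of $g$. (1) At every point of $M$ at which $\xi^\mu\nabla_\mu\phi=0$ one has $$\nabla_\alpha J^\alpha=0,\qquad J^\alpha=(B^{\alpha\beta\lambda\mu}+S^{\alpha\beta\lambda\mu})\,\xi_\beta\xi_\lambda\xi_\mu .$$ In particular, $J$ is divergence-free on $M$ if $\xi$ leaves the scalar field invariant ($\xi^\mu\nabla_\mu\phi=0$ everywhere). (2) Neither piece is in general conserved separately: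 for every $n\ge 4$ there are such a metric $g$ and a function $\phi$ on $\mathbb{R}^n$ solving the Einstein–Klein–Gordon equations above, and a Killing vector field $\xi$ of $g$ with $\xi^\mu\nabla_\mu\phi=0$ everywhere, for which $\nabla_\alpha(B^{\alpha\beta\lambda\mu}\xi_\beta\xi_\lambda\xi_\mu)$ and $\nabla_\alpha(S^{\alpha\beta\lambda\mu}\xi_\beta\xi_\lambda\xi_\mu)$ are both nonzero at some point. -/

import Mathlib

open scoped Manifold ContDiff

-- On the model space, use the identity chart.
attribute [-instance] TopCat.of.chartedSpace

noncomputable section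

namespace SuperEnergy

/-- The model space of an `n`-dimensional manifold, also used as the space of coordinates. -/
abbrev Coord (n : ℕ) : Type := EuclideanSpace ℝ (Fin n)

/-! ### Tensor calculus in local coordinates

A metric in local coordinates is a matrix-valued function `g`; `(g y)⁻¹ a b` is `g^{ab}`.
All indices of the tensors below are written as subscripts unless said otherwise. -/

/-- Partial derivative `∂_i f`. -/
def pd {n : ℕ} (i : Fin n) (f : Coord n → ℝ) (y : Coord n) : ℝ :=
  fderiv ℝ f y (EuclideanSpace.single i 1)

/-- Christoffel symbols `Γ^a_{bc}` of the Levi-Civita connection. -/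
def christoffel {n : ℕ} (g : Coord n → Matrix (Fin n) (Fin n) ℝ) (y : Coord n)
    (a b c : Fin n) : ℝ :=
  (1 / 2) * ∑ d, (g y)⁻¹ a d *
    (pd b (fun z => g z d c) y + pd c (fun z => g z d b) y - pd d (fun z => g z b c) y)

/-- `R^a_{bcd} = ∂_c Γ^a_{db} - ∂_d Γ^a_{cb} + Γ^a_{ce} Γ^e_{db} - Γ^a_{de} Γ^e_{cb}`. -/
def riemannUp {n : ℕ} (g : Coord n → Matrix (Fin n) (Fin n) ℝ) (y : Coord n)
    (a b c d : Fin n) : ℝ :=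
  pd c (fun z => christoffel g z a d b) y - pd d (fun z => christoffel g z a c b) y
    + ∑ e, (christoffel g y a c e * christoffel g y e d b
        - christoffel g y a d e * christoffel g y e c b)

/-- `R_{abcd} = g_{ae} R^e_{bcd}`. -/
def riemann {n : ℕ} (g : Coord n → Matrix (Fin n) (Fin n) ℝ) (y : Coord n)
    (a b c d : Fin n) : ℝ :=
  ∑ e, g y a e * riemannUp g y e b c d

/-- Ricci tensor `R_{bd} = R^a_{bad}`. -/
def ricci {n : ℕ} (g : Coord n → Matrix (Fin n) (Fin n) ℝ) (y : Coord n) (b d : Fin n) : ℝ :=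
  ∑ a, riemannUp g y a b a d

/-- Scalar curvature `g^{ab} R_{ab}`. -/
def scalarCurvature {n : ℕ} (g : Coord n → Matrix (Fin n) (Fin n) ℝ) (y : Coord n) : ℝ :=
  ∑ a, ∑ b, (g y)⁻¹ a b * ricci g y a b

/-- Second covariant derivative `∇_a ∇_b φ` of a function. -/
def hess {n : ℕ} (g : Coord n → Matrix (Fin n) (Fin n) ℝ) (φ : Coord n → ℝ) (y : Coord n)
    (a b : Fin n) : ℝ :=
  pd a (fun z => pd b φ z) y - ∑ c, christoffel g y c a b * pd c φ y

/-- Energy-momentum tensor of a massless scalar field,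
`T_{ab} = ∇_a φ ∇_b φ - (1/2) (∇_c φ ∇^c φ) g_{ab}`. -/
def energyMomentum {n : ℕ} (g : Coord n → Matrix (Fin n) (Fin n) ℝ) (φ : Coord n → ℝ)
    (y : Coord n) (a b : Fin n) : ℝ :=
  pd a φ y * pd b φ y
    - (1 / 2) * (∑ c, ∑ d, (g y)⁻¹ c d * (pd c φ y * pd d φ y)) * g y a b

/-- The massless Einstein–Klein–Gordon equations at the point with coordinates `y`:
`R_{ab} - (1/2) R g_{ab} = T_{ab}` and `g^{ab} ∇_a ∇_b φ = 0`. -/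
def EinsteinKleinGordonAt {n : ℕ} (g : Coord n → Matrix (Fin n) (Fin n) ℝ)
    (φ : Coord n → ℝ) (y : Coord n) : Prop :=
  (∀ a b, ricci g y a b - (1 / 2) * scalarCurvature g y * g y a b = energyMomentum g φ y a b) ∧
    ∑ a, ∑ b, (g y)⁻¹ a b * hess g φ y a b = 0

/-- `∇_a ω_b` for a covector field `u`. -/
def covDeriv {n : ℕ} (g : Coord n → Matrix (Fin n) (Fin n) ℝ) (u : Coord n → Fin n → ℝ)
    (y : Coord n) (a b : Fin n) : ℝ :=
  pd a (fun z => u z b) y - ∑ c, christoffel g y c a b * u y c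

/-- Killing's equation `∇_a ξ_b + ∇_b ξ_a = 0` for the vector field with components `ξ^a`. -/
def KillingAt {n : ℕ} (g : Coord n → Matrix (Fin n) (Fin n) ℝ) (ξ : Coord n → Fin n → ℝ)
    (y : Coord n) : Prop :=
  ∀ a b, covDeriv g (fun z c => ∑ d, g z c d * ξ z d) y a b
    + covDeriv g (fun z c => ∑ d, g z c d * ξ z d) y b a = 0

/-- The Bel tensor
`B_{ablm} = R_{arls} R_b^r_m^s + R_{arms} R_b^r_l^s - (1/2) g_{ab} R_{rtls} R^{rt}_m^s
  - (1/2) g_{lm} R_{arst} R_b^{rst} + (1/8) g_{ab} g_{lm} R_{rtsv} R^{rtsv}`. -/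
def bel {n : ℕ} (g : Coord n → Matrix (Fin n) (Fin n) ℝ) (y : Coord n)
    (a b l m : Fin n) : ℝ :=
  (∑ r, ∑ r', ∑ s, ∑ s', (g y)⁻¹ r r' * (g y)⁻¹ s s' *
      (riemann g y a r l s * riemann g y b r' m s'))
  + (∑ r, ∑ r', ∑ s, ∑ s', (g y)⁻¹ r r' * (g y)⁻¹ s s' *
      (riemann g y a r m s * riemann g y b r' l s'))
  - (1 / 2) * g y a b *
    (∑ r, ∑ r', ∑ t, ∑ t', ∑ s, ∑ s', (g y)⁻¹ r r' * (g y)⁻¹ t t' * (g y)⁻¹ s s' *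
      (riemann g y r t l s * riemann g y r' t' m s'))
  - (1 / 2) * g y l m *
    (∑ r, ∑ r', ∑ s, ∑ s', ∑ t, ∑ t', (g y)⁻¹ r r' * (g y)⁻¹ s s' * (g y)⁻¹ t t' *
      (riemann g y a r s t * riemann g y b r' s' t'))
  + (1 / 8) * g y a b * g y l m *
    (∑ r, ∑ r', ∑ t, ∑ t', ∑ s, ∑ s', ∑ v, ∑ v',
      (g y)⁻¹ r r' * (g y)⁻¹ t t' * (g y)⁻¹ s s' * (g y)⁻¹ v v' *
      (riemann g y r t s v * riemann g y r' t' s' v'))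

/-- The super-energy tensor of a massless scalar field, with `φ_{ab} = ∇_a ∇_b φ`:
`S_{ablm} = φ_{al} φ_{mb} + φ_{am} φ_{lb} - g_{ab} φ_l^r φ_{mr} - g_{lm} φ_a^r φ_{br}
  + (1/2) g_{ab} g_{lm} φ_{sr} φ^{sr}`. -/
def scalarSuperEnergy {n : ℕ} (g : Coord n → Matrix (Fin n) (Fin n) ℝ) (φ : Coord n → ℝ)
    (y : Coord n) (a b l m : Fin n) : ℝ :=
  hess g φ y a l * hess g φ y m b + hess g φ y a m * hess g φ y l b
  - g y a b * (∑ r, ∑ r', (g y)⁻¹ r r' * (hess g φ y l r * hess g φ y m r'))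
  - g y l m * (∑ r, ∑ r', (g y)⁻¹ r r' * (hess g φ y a r * hess g φ y b r'))
  + (1 / 2) * g y a b * g y l m *
    (∑ s, ∑ s', ∑ r, ∑ r', (g y)⁻¹ s s' * (g y)⁻¹ r r' *
      (hess g φ y s r * hess g φ y s' r'))

/-- The current `J^a = T^{ablm} ξ_b ξ_l ξ_m = g^{ac} T_{cblm} ξ^b ξ^l ξ^m`
of a tensor field `T_{ablm}` and a vector field `ξ^a`. -/
def current {n : ℕ} (g : Coord n → Matrix (Fin n) (Fin n) ℝ)
    (T : Coord n → Fin n → Fin n → Fin n → Fin n → ℝ) (ξ : Coord n → Fin n → ℝ)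
    (y : Coord n) (a : Fin n) : ℝ :=
  ∑ c, ∑ b, ∑ l, ∑ m, (g y)⁻¹ a c * T y c b l m * ξ y b * ξ y l * ξ y m

/-- Divergence `∇_a J^a = ∂_a J^a + Γ^a_{ab} J^b`. -/
def divergence {n : ℕ} (g : Coord n → Matrix (Fin n) (Fin n) ℝ) (J : Coord n → Fin n → ℝ)
    (y : Coord n) : ℝ :=
  ∑ a, pd a (fun z => J z a) y + ∑ a, ∑ b, christoffel g y a a b * J y b

/-! ### Lorentzian manifolds -/

/-- A smooth Lorentzian metric, of signature `(-,+,…,+)`: every tangent space has a timelike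
vector on whose orthogonal complement the metric is positive definite. -/
structure LorentzMetric (n : ℕ) (M : Type*) [TopologicalSpace M] [ChartedSpace (Coord n) M]
    [IsManifold (𝓡 n) ∞ M] where
  val (p : M) : TangentSpace (𝓡 n) p →L[ℝ] TangentSpace (𝓡 n) p →L[ℝ] ℝ
  symm (p : M) (v w : TangentSpace (𝓡 n) p) : val p v w = val p w v
  lorentzian (p : M) : ∃ u : TangentSpace (𝓡 n) p, val p u u < 0 ∧
    ∀ w : TangentSpace (𝓡 n) p, val p u w = 0 → w ≠ 0 → 0 < val p w w
  contMDiff : ContMDiff (𝓡 n) ((𝓡 n).prod 𝓘(ℝ, Coord n →L[ℝ] Coord n →L[ℝ] ℝ)) ∞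
    (fun p : M => Bundle.TotalSpace.mk' (Coord n →L[ℝ] Coord n →L[ℝ] ℝ)
      (E := fun p : M => TangentSpace (𝓡 n) p →L[ℝ] TangentSpace (𝓡 n) p →L[ℝ] ℝ) p (val p))

/-- Smoothness of a vector field, as a section of the tangent bundle. -/
def SmoothVectorField {n : ℕ} {M : Type*} [TopologicalSpace M] [ChartedSpace (Coord n) M]
    [IsManifold (𝓡 n) ∞ M] (ξ : ∀ p : M, TangentSpace (𝓡 n) p) : Prop :=
  ContMDiff (𝓡 n) (𝓡 n).tangent ∞ (fun p => (⟨p, ξ p⟩ : TangentBundle (𝓡 n) M))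

/-- The coordinate vector `∂_i` of the chart `e` at the point with coordinates `y`. -/
def coordVector {n : ℕ} {M : Type*} [TopologicalSpace M] [ChartedSpace (Coord n) M]
    (e : OpenPartialHomeomorph M (Coord n)) (y : Coord n) (i : Fin n) :
    TangentSpace (𝓡 n) (e.symm y) :=
  mfderiv (𝓡 n) (𝓡 n) e.symm y (EuclideanSpace.single i (1 : ℝ) : Coord n)

/-- The components `g_{ij}` of the metric in the chart `e`. -/
def LorentzMetric.inChart {n : ℕ} {M : Type*} [TopologicalSpace M] [ChartedSpace (Coord n) M]
    [IsManifold (𝓡 n) ∞ M] (g : LorentzMetric n M) (e : OpenPartialHomeomorph M (Coord n))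
    (y : Coord n) : Matrix (Fin n) (Fin n) ℝ :=
  Matrix.of fun i j => g.val (e.symm y) (coordVector e y i) (coordVector e y j)

/-- A function in the chart `e`. -/
def funInChart {n : ℕ} {M : Type*} [TopologicalSpace M] (φ : M → ℝ)
    (e : OpenPartialHomeomorph M (Coord n)) (y : Coord n) : ℝ :=
  φ (e.symm y)

/-- The components `ξ^i` of a vector field in the chart `e`. -/
def vecInChart {n : ℕ} {M : Type*} [TopologicalSpace M] [ChartedSpace (Coord n) M]
    (ξ : ∀ p : M, TangentSpace (𝓡 n) p) (e : OpenPartialHomeomorph M (Coord n))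
    (y : Coord n) (i : Fin n) : ℝ :=
  let v : Coord n := mfderiv (𝓡 n) (𝓡 n) e (e.symm y) (ξ (e.symm y))
  v i

/-- `(g, φ)` solves the Einstein–Klein–Gordon equations of a minimally coupled massless scalar
field (the tensor equations hold in every chart of the atlas). -/
def EinsteinKleinGordon {n : ℕ} {M : Type*} [TopologicalSpace M] [ChartedSpace (Coord n) M]
    [IsManifold (𝓡 n) ∞ M] (g : LorentzMetric n M) (φ : M → ℝ) : Prop :=
  ∀ e ∈ atlas (Coord n) M, ∀ y ∈ e.target,
    EinsteinKleinGordonAt (g.inChart e) (funInChart φ e) y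

/-- `ξ` is a Killing vector field of `g`. -/
def IsKilling {n : ℕ} {M : Type*} [TopologicalSpace M] [ChartedSpace (Coord n) M]
    [IsManifold (𝓡 n) ∞ M] (g : LorentzMetric n M) (ξ : ∀ p : M, TangentSpace (𝓡 n) p) : Prop :=
  ∀ e ∈ atlas (Coord n) M, ∀ y ∈ e.target, KillingAt (g.inChart e) (vecInChart ξ e) y

/-- The divergence at `p` of `B^{ablm} ξ_b ξ_l ξ_m`, computed in the chart `e` around `p`. -/
def divBelCurrent {n : ℕ} {M : Type*} [TopologicalSpace M] [ChartedSpace (Coord n) M]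
    [IsManifold (𝓡 n) ∞ M] (g : LorentzMetric n M) (ξ : ∀ p : M, TangentSpace (𝓡 n) p)
    (e : OpenPartialHomeomorph M (Coord n)) (p : M) : ℝ :=
  divergence (g.inChart e)
    (current (g.inChart e) (bel (g.inChart e)) (vecInChart ξ e)) (e p)

/-- The divergence at `p` of `S^{ablm} ξ_b ξ_l ξ_m`, computed in the chart `e` around `p`. -/
def divScalarCurrent {n : ℕ} {M : Type*} [TopologicalSpace M] [ChartedSpace (Coord n) M]
    [IsManifold (𝓡 n) ∞ M] (g : LorentzMetric n M) (φ : M → ℝ)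
    (ξ : ∀ p : M, TangentSpace (𝓡 n) p)
    (e : OpenPartialHomeomorph M (Coord n)) (p : M) : ℝ :=
  divergence (g.inChart e)
    (current (g.inChart e) (scalarSuperEnergy (g.inChart e) (funInChart φ e))
      (vecInChart ξ e)) (e p)

/-- The divergence at `p` of `(B^{ablm} + S^{ablm}) ξ_b ξ_l ξ_m`, computed in the chart `e`
around `p`. -/
def divMixedCurrent {n : ℕ} {M : Type*} [TopologicalSpace M] [ChartedSpace (Coord n) M]
    [IsManifold (𝓡 n) ∞ M] (g : LorentzMetric n M) (φ : M → ℝ)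
    (ξ : ∀ p : M, TangentSpace (𝓡 n) p)
    (e : OpenPartialHomeomorph M (Coord n)) (p : M) : ℝ :=
  divergence (g.inChart e)
    (current (g.inChart e)
      (fun y a b l m => bel (g.inChart e) y a b l m
        + scalarSuperEnergy (g.inChart e) (funInChart φ e) y a b l m)
      (vecInChart ξ e)) (e p)

end SuperEnergy

end

/-! At a point take a frame in which the metric is diagonal, with entries η_i and inverses ε_i.
Write x for the covector of ξ, h for the Hessian of φ, φ_i for its gradient. The divergence of
T_{ijkl} x_j x_k x_l splits into (∇^i T_{ijkl}) x_j x_k x_l and terms containing ∇_i x_j. Both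
superenergy tensors are symmetric in each index pair and under exchange of the pairs, so the
antisymmetry of ∇_i x_j removes the second kind (`wsum_killing_terms`).

For the Bel tensor the second Bianchi identity leaves only terms containing ∇^i R_{irst}
(`frameBel_divergence`). By the contracted identity this is ∇_s R_{tr} − ∇_t R_{sr}, and the
Einstein equations in the form R_{ab} = φ_a φ_b + f g_{ab} turn it into φ_t h_{sr} − φ_s h_{tr} plus
derivatives of f. For the scalar tensor the surviving terms contain ∇^i h_{ik} or a commutator of
covariant derivatives on the gradient (`frameScalar_divergence`); the Ricci identity converts the
commutators into φ^l R_{l...}. With X_{rs} = x^j x^l R_{jrls} and Y_{rst} = x^j R_{jrst}, both sides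
reduce to the two expressions x^l h_{lr} φ_s X_{rs} and |x|² h_{ir} φ_l Y_{irl}, with opposite
coefficients. This is `frame_divergence_mixed`.

The reduction needs x·φ = 0, x·∇f = 0 and x^l h_{lr} φ^r = 0, that is ξ(f) = 0 and ξ(|∇φ|²) = 0, at
a point where only ξ(φ) = 0 is known. Taking the trace gives f = 0 when n ≠ 2, hence |∇φ|² is the
scalar curvature R, and a Killing field always annihilates R (`sum_killing_pd_scalarCurvature`).
That fact comes from computing ∇_a(R^{ab} ξ_b) in two ways: contracted Bianchi gives ξ(R)/2, while
R^a{}_b ξ^b is itself the divergence of an antisymmetric tensor and so has zero divergence. For n =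
2 the Ricci tensor is a multiple of g, which forces ∇φ = 0.

Coordinate tensors are linked to frame components by one-variable calculus. Along a straight line, a
frame that is parallel to first order has constant Gram matrix to first order, and ordinary
derivatives of frame components are components of covariant derivatives (`jet_bilinear`,
`jet_riemann`). Identities of frame components valid along the line can therefore be differentiated
by the product rule.

For separate non-conservation take e^{2w} dw² + e^w (2 du dv + H du²) + dy² + dz² with H = w(y − u)
and φ = w/√2. The factor e^{2w} makes w harmonic, and the Ricci tensor is dw²/2 as soon as H_{ww} +
e^{2w} H_{yy} = 0. Dependence of H on u and y through y − u makes ∂_u + ∂_y a Killing field. The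
scalar current has divergence −1/4 at the origin; conservation of the sum then gives 1/4 for the Bel
current without computing the Bel tensor. -/

open scoped Topology

namespace SuperEnergy

/-! ### Sums weighted by the inverse squared lengths of an orthogonal frame -/

/-- The weighted sum `∑ i, ε i * f i`. -/
noncomputable def wsum {n : ℕ} (ε f : Fin n → ℝ) : ℝ := ∑ i, ε i * f i

section WSum

variable {n : ℕ} {ε : Fin n → ℝ}

theorem wsum_congr {f f' : Fin n → ℝ} (h : ∀ i, f i = f' i) : wsum ε f = wsum ε f' := by
  rw [funext h]

theorem wsum_add (f f' : Fin n → ℝ) :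
    wsum ε (fun i => f i + f' i) = wsum ε f + wsum ε f' := by
  simp only [wsum, mul_add, Finset.sum_add_distrib]

theorem wsum_sub (f f' : Fin n → ℝ) :
    wsum ε (fun i => f i - f' i) = wsum ε f - wsum ε f' := by
  simp only [wsum, mul_sub, Finset.sum_sub_distrib]

theorem wsum_neg (f : Fin n → ℝ) : wsum ε (fun i => - f i) = - wsum ε f := by
  simp only [wsum, mul_neg, Finset.sum_neg_distrib]

theorem mul_wsum (c : ℝ) (f : Fin n → ℝ) : c * wsum ε f = wsum ε (fun i => c * f i) := by
  simp only [wsum, Finset.mul_sum]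
  exact Finset.sum_congr rfl fun i _ => by ring

theorem wsum_mul (c : ℝ) (f : Fin n → ℝ) : wsum ε f * c = wsum ε (fun i => f i * c) := by
  simp only [wsum, Finset.sum_mul, mul_assoc]

theorem wsum_zero : wsum ε (fun _ => 0) = 0 := by simp [wsum]

theorem wsum_comm (f : Fin n → Fin n → ℝ) :
    wsum ε (fun i => wsum ε fun j => f i j) = wsum ε (fun j => wsum ε fun i => f i j) := by
  simp only [wsum, Finset.mul_sum]
  rw [Finset.sum_comm]
  exact Finset.sum_congr rfl fun j _ => Finset.sum_congr rfl fun i _ => by ring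

theorem wsum_comm₂ (f : Fin n → Fin n → Fin n → ℝ) :
    wsum ε (fun i => wsum ε fun j => wsum ε fun r => f i j r)
      = wsum ε (fun r => wsum ε fun i => wsum ε fun j => f i j r) := by
  rw [wsum_congr fun i => wsum_comm _, wsum_comm]

theorem wsum_comm₃ (f : Fin n → Fin n → Fin n → Fin n → ℝ) :
    wsum ε (fun i => wsum ε fun j => wsum ε fun k => wsum ε fun r => f i j k r)
      = wsum ε (fun r => wsum ε fun i => wsum ε fun j => wsum ε fun k => f i j k r) := by
  rw [wsum_congr fun i => wsum_comm₂ _, wsum_comm]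

theorem wsum_eq_zero_of_antisymm {f : Fin n → Fin n → ℝ} (h : ∀ i j, f i j = - f j i) :
    wsum ε (fun i => wsum ε fun j => f i j) = 0 := by
  have h₁ : wsum ε (fun i => wsum ε fun j => f i j)
      = - wsum ε (fun i => wsum ε fun j => f i j) := by
    conv_lhs => rw [wsum_congr fun i => wsum_congr fun j => h i j]
    simp only [wsum_neg]
    rw [wsum_comm]
  linarith

/-- Contraction with the diagonal metric: the weight ε_i cancels the entry η_i. -/
theorem wsum_delta {η : Fin n → ℝ} (hη : ∀ i, ε i * η i = 1) (i : Fin n) (f : Fin n → ℝ) :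
    wsum ε (fun j => (if i = j then η i else 0) * f j) = f i := by
  simp only [wsum, ite_mul, zero_mul, mul_ite, mul_zero, Finset.sum_ite_eq, Finset.mem_univ,
    if_true]
  rw [← mul_assoc, hη, one_mul]

/-- The contraction of the polarized Bel-type terms with a covector in three slots. -/
theorem wsum_contract_product (x : Fin n → ℝ) (A : Fin n → ℝ) (B : Fin n → Fin n → ℝ) :
    wsum ε (fun j => wsum ε fun k => wsum ε fun l => A k * B j l * x j * x k * x l)
      = wsum ε (fun k => x k * A k) * wsum ε (fun j => x j * wsum ε fun l => x l * B j l) := by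
  rw [wsum_comm, wsum_mul]
  refine wsum_congr fun k => ?_
  simp only [mul_wsum]
  exact wsum_congr fun j => wsum_congr fun l => by ring

theorem wsum_contract_rank_two (x : Fin n → ℝ) (U : Fin n → Fin n → Fin n → ℝ)
    (V : Fin n → Fin n → Fin n → Fin n → ℝ) :
    wsum ε (fun j => wsum ε fun k => wsum ε fun l =>
        wsum ε (fun r => wsum ε fun s => U r k s * V j r l s) * x j * x k * x l)
      = wsum ε fun r => wsum ε fun s => wsum ε (fun k => x k * U r k s)
          * wsum ε (fun j => x j * wsum ε fun l => x l * V j r l s) := by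
  conv_lhs => simp only [wsum_mul]
  rw [wsum_comm₃]
  refine wsum_congr fun r => ?_
  rw [wsum_comm₃]
  refine wsum_congr fun s => ?_
  exact wsum_contract_product x (fun k => U r k s) (fun j l => V j r l s)

theorem wsum_contract_product_two (x : Fin n → ℝ) (A B : Fin n → ℝ) :
    wsum ε (fun k => wsum ε fun l => A k * B l * x k * x l)
      = wsum ε (fun k => x k * A k) * wsum ε (fun l => x l * B l) := by
  rw [wsum_mul]
  refine wsum_congr fun k => ?_
  simp only [mul_wsum]
  exact wsum_congr fun l => by ring

theorem wsum_contract_metric {η : Fin n → ℝ} (hη : ∀ i, ε i * η i = 1) (x : Fin n → ℝ)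
    (i : Fin n) (Q : Fin n → Fin n → ℝ) :
    wsum ε (fun j => wsum ε fun k => wsum ε fun l =>
        (if i = j then η i else 0) * Q k l * x j * x k * x l)
      = x i * wsum ε fun k => wsum ε fun l => Q k l * x k * x l := by
  have : ∀ j, wsum ε (fun k => wsum ε fun l =>
        (if i = j then η i else 0) * Q k l * x j * x k * x l)
      = (if i = j then η i else 0) * (x j * wsum ε fun k => wsum ε fun l => Q k l * x k * x l) := by
    intro j
    simp only [mul_wsum]
    exact wsum_congr fun k => wsum_congr fun l => by ring
  rw [wsum_congr this, wsum_delta hη]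

theorem wsum_contract_metric' {η : Fin n → ℝ} (hη : ∀ i, ε i * η i = 1) (x : Fin n → ℝ)
    (Q : Fin n → ℝ) :
    wsum ε (fun j => wsum ε fun k => wsum ε fun l =>
        (if k = l then η k else 0) * Q j * x j * x k * x l)
      = wsum ε (fun k => x k * x k) * wsum ε fun j => x j * Q j := by
  have : ∀ j k, wsum ε (fun l => (if k = l then η k else 0) * Q j * x j * x k * x l)
      = Q j * x j * x k * x k := by
    intro j k
    rw [← wsum_delta hη k (fun l => Q j * x j * x k * x l)]
    exact wsum_congr fun l => by ring
  rw [wsum_congr fun j => wsum_congr fun k => this j k]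
  rw [wsum_comm, wsum_mul]
  refine wsum_congr fun k => ?_
  simp only [mul_wsum]
  exact wsum_congr fun j => by ring

end WSum

/-! ### The superenergy tensors in an orthogonal frame -/

section Frame

variable {n : ℕ} (ε η : Fin n → ℝ)

/-- The polarized Bel tensor in an orthogonal frame. -/
noncomputable def frameBel (R S : Fin n → Fin n → Fin n → Fin n → ℝ) (a b l m : Fin n) : ℝ :=
  wsum ε (fun r => wsum ε fun s => R a r l s * S b r m s)
  + wsum ε (fun r => wsum ε fun s => R a r m s * S b r l s)
  - (1 / 2) * (if a = b then η a else 0) *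
    wsum ε (fun r => wsum ε fun t => wsum ε fun s => R r t l s * S r t m s)
  - (1 / 2) * (if l = m then η l else 0) *
    wsum ε (fun r => wsum ε fun s => wsum ε fun t => R a r s t * S b r s t)
  + (1 / 8) * (if a = b then η a else 0) * (if l = m then η l else 0) *
    wsum ε (fun r => wsum ε fun t => wsum ε fun s => wsum ε fun v => R r t s v * S r t s v)

/-- The polarized scalar superenergy tensor in an orthogonal frame. -/
noncomputable def frameScalar (h k : Fin n → Fin n → ℝ) (a b l m : Fin n) : ℝ :=
  h a l * k m b + h a m * k l b
  - (if a = b then η a else 0) * wsum ε (fun r => h l r * k m r)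
  - (if l = m then η l else 0) * wsum ε (fun r => h a r * k b r)
  + (1 / 2) * (if a = b then η a else 0) * (if l = m then η l else 0) *
    wsum ε (fun s => wsum ε fun r => h s r * k s r)

variable {ε η}

/-- The first two terms of the Bel tensor agree once all slots but one meet the same covector,
whence the factor 2; a metric factor yields x_i or |x|². The two curvature arguments are kept apart
so that the formula serves both halves of the product rule, and no symmetry of either is used. -/
theorem wsum_frameBel (hη : ∀ i, ε i * η i = 1) (x : Fin n → ℝ)
    (R S : Fin n → Fin n → Fin n → Fin n → ℝ) (i : Fin n) :
    wsum ε (fun j => wsum ε fun k => wsum ε fun l =>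
        frameBel ε η R S i j k l * x j * x k * x l)
      = 2 * (wsum ε fun r => wsum ε fun s => wsum ε (fun k => x k * R i r k s)
          * wsum ε (fun j => x j * wsum ε fun l => x l * S j r l s))
        - (1 / 2) * x i * (wsum ε fun r => wsum ε fun t => wsum ε fun s =>
          wsum ε (fun k => x k * R r t k s) * wsum ε (fun l => x l * S r t l s))
        - (1 / 2) * wsum ε (fun k => x k * x k) * (wsum ε fun r => wsum ε fun s => wsum ε fun t =>
          R i r s t * wsum ε (fun j => x j * S j r s t))
        + (1 / 8) * x i * wsum ε (fun k => x k * x k) *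
          wsum ε (fun r => wsum ε fun t => wsum ε fun s => wsum ε fun v =>
            R r t s v * S r t s v) := by
  have h₁ := wsum_contract_rank_two (ε := ε) x (R i) S
  have h₂ : wsum ε (fun j => wsum ε fun k => wsum ε fun l =>
        wsum ε (fun r => wsum ε fun s => R i r l s * S j r k s) * x j * x k * x l)
      = wsum ε fun r => wsum ε fun s => wsum ε (fun k => x k * R i r k s)
          * wsum ε (fun j => x j * wsum ε fun l => x l * S j r l s) := by
    rw [← h₁]
    refine wsum_congr fun j => ?_
    rw [wsum_comm]
    exact wsum_congr fun k => wsum_congr fun l => by ring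
  have h₃ := wsum_contract_metric hη x i
    (fun k l => wsum ε (fun r => wsum ε fun t => wsum ε fun s => R r t k s * S r t l s))
  have h₃' : wsum ε (fun k => wsum ε fun l => wsum ε (fun r => wsum ε fun t => wsum ε fun s =>
        R r t k s * S r t l s) * x k * x l)
      = wsum ε fun r => wsum ε fun t => wsum ε fun s =>
          wsum ε (fun k => x k * R r t k s) * wsum ε (fun l => x l * S r t l s) := by
    conv_lhs => simp only [wsum_mul]
    rw [wsum_comm₂]
    refine wsum_congr fun r => ?_
    rw [wsum_comm₂]
    refine wsum_congr fun t => ?_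
    rw [wsum_comm₂]
    exact wsum_congr fun s => wsum_contract_product_two x _ _
  have h₄ := wsum_contract_metric' hη x
    (fun j => wsum ε (fun r => wsum ε fun s => wsum ε fun t => R i r s t * S j r s t))
  have h₄' : wsum ε (fun j => x j *
        wsum ε (fun r => wsum ε fun s => wsum ε fun t => R i r s t * S j r s t))
      = wsum ε fun r => wsum ε fun s => wsum ε fun t =>
          R i r s t * wsum ε (fun j => x j * S j r s t) := by
    simp only [mul_wsum]
    rw [wsum_comm]
    refine wsum_congr fun r => ?_
    rw [wsum_comm]
    refine wsum_congr fun s => ?_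
    rw [wsum_comm]
    exact wsum_congr fun t => wsum_congr fun j => by ring
  have h₅ := wsum_contract_metric hη x i (fun k l => if k = l then η k else 0)
  have h₅' : wsum ε (fun k => wsum ε fun l => (if k = l then η k else 0) * x k * x l)
      = wsum ε (fun k => x k * x k) := by
    refine wsum_congr fun k => ?_
    rw [← wsum_delta hη k (fun l => x k * x l)]
    exact wsum_congr fun l => by ring
  rw [h₃'] at h₃
  rw [h₄'] at h₄
  rw [h₅'] at h₅
  have h₀ : ∀ j k l, frameBel ε η R S i j k l * x j * x k * x l
      = wsum ε (fun r => wsum ε fun s => R i r k s * S j r l s) * x j * x k * x l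
        + wsum ε (fun r => wsum ε fun s => R i r l s * S j r k s) * x j * x k * x l
        - (1 / 2) * ((if i = j then η i else 0) * wsum ε (fun r => wsum ε fun t => wsum ε fun s =>
          R r t k s * S r t l s) * x j * x k * x l)
        - (1 / 2) * ((if k = l then η k else 0) * wsum ε (fun r => wsum ε fun s => wsum ε fun t =>
          R i r s t * S j r s t) * x j * x k * x l)
        + (1 / 8) * wsum ε (fun r => wsum ε fun t => wsum ε fun s => wsum ε fun v =>
            R r t s v * S r t s v) *
          ((if i = j then η i else 0) * (if k = l then η k else 0) * x j * x k * x l) := by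
    intro j k l
    rw [frameBel]
    ring
  rw [wsum_congr fun j => wsum_congr fun k => wsum_congr fun l => h₀ j k l]
  simp only [wsum_add, wsum_sub, ← mul_wsum]
  rw [h₁, h₂, h₃, h₄, h₅]
  ring

/-- Scalar counterpart of `wsum_frameBel`, again polarized so that one argument can be a derivative
of the other. -/
theorem wsum_frameScalar (hη : ∀ i, ε i * η i = 1) (x : Fin n → ℝ)
    (h k : Fin n → Fin n → ℝ) (i : Fin n) :
    wsum ε (fun j => wsum ε fun l => wsum ε fun m =>
        frameScalar ε η h k i j l m * x j * x l * x m)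
      = 2 * wsum ε (fun l => x l * h i l) * wsum ε (fun l => x l * wsum ε fun j => x j * k l j)
        - x i * wsum ε (fun r => wsum ε (fun l => x l * h l r) * wsum ε (fun l => x l * k l r))
        - wsum ε (fun l => x l * x l) * wsum ε (fun r => h i r * wsum ε (fun l => x l * k l r))
        + (1 / 2) * x i * wsum ε (fun l => x l * x l) *
          wsum ε (fun s => wsum ε fun r => h s r * k s r) := by
  have h₁ : wsum ε (fun j => wsum ε fun l => wsum ε fun m => h i l * k m j * x j * x l * x m)
      = wsum ε (fun l => x l * h i l) * wsum ε (fun l => x l * wsum ε fun j => x j * k l j) := by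
    rw [wsum_contract_product x (fun l => h i l) (fun j m => k m j)]
    congr 1
    simp only [mul_wsum]
    rw [wsum_comm]
    exact wsum_congr fun l => wsum_congr fun j => by ring
  have h₂ : wsum ε (fun j => wsum ε fun l => wsum ε fun m => h i m * k l j * x j * x l * x m)
      = wsum ε (fun l => x l * h i l) * wsum ε (fun l => x l * wsum ε fun j => x j * k l j) := by
    rw [← h₁]
    refine wsum_congr fun j => ?_
    rw [wsum_comm]
    exact wsum_congr fun k => wsum_congr fun l => by ring
  have h₃ := wsum_contract_metric hη x i (fun l m => wsum ε (fun r => h l r * k m r))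
  have h₃' : wsum ε (fun l => wsum ε fun m => wsum ε (fun r => h l r * k m r) * x l * x m)
      = wsum ε fun r => wsum ε (fun l => x l * h l r) * wsum ε (fun l => x l * k l r) := by
    conv_lhs => simp only [wsum_mul]
    rw [wsum_comm₂]
    exact wsum_congr fun r => wsum_contract_product_two x _ _
  have h₄ := wsum_contract_metric' hη x (fun j => wsum ε (fun r => h i r * k j r))
  have h₄' : wsum ε (fun j => x j * wsum ε (fun r => h i r * k j r))
      = wsum ε fun r => h i r * wsum ε (fun j => x j * k j r) := by
    simp only [mul_wsum]
    rw [wsum_comm]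
    exact wsum_congr fun t => wsum_congr fun j => by ring
  have h₅ := wsum_contract_metric hη x i (fun k l => if k = l then η k else 0)
  have h₅' : wsum ε (fun k => wsum ε fun l => (if k = l then η k else 0) * x k * x l)
      = wsum ε (fun k => x k * x k) := by
    refine wsum_congr fun k => ?_
    rw [← wsum_delta hη k (fun l => x k * x l)]
    exact wsum_congr fun l => by ring
  rw [h₃'] at h₃
  rw [h₄'] at h₄
  rw [h₅'] at h₅
  have h₀ : ∀ j l m, frameScalar ε η h k i j l m * x j * x l * x m
      = h i l * k m j * x j * x l * x m + h i m * k l j * x j * x l * x m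
        - ((if i = j then η i else 0) * wsum ε (fun r => h l r * k m r) * x j * x l * x m)
        - ((if l = m then η l else 0) * wsum ε (fun r => h i r * k j r) * x j * x l * x m)
        + (1 / 2) * wsum ε (fun s => wsum ε fun r => h s r * k s r) *
          ((if i = j then η i else 0) * (if l = m then η l else 0) * x j * x l * x m) := by
    intro j k l
    rw [frameScalar]
    ring
  rw [wsum_congr fun j => wsum_congr fun k => wsum_congr fun l => h₀ j k l]
  simp only [wsum_add, wsum_sub, ← mul_wsum]
  rw [h₁, h₂, h₃, h₄, h₅]
  ring

end Frame

end SuperEnergy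

/-! ### Divergences of the superenergy tensors in an orthogonal frame -/

namespace SuperEnergy

/-- The algebraic symmetries of a curvature tensor used below. -/
structure CurvatureSymm {n : ℕ} (R : Fin n → Fin n → Fin n → Fin n → ℝ) : Prop where
  antisymm_left (a b c d) : R a b c d = - R b a c d
  pair (a b c d) : R a b c d = R c d a b

theorem CurvatureSymm.antisymm_right {n : ℕ} {R : Fin n → Fin n → Fin n → Fin n → ℝ}
    (hR : CurvatureSymm R) (a b c d) : R a b c d = - R a b d c := by
  rw [hR.pair, hR.antisymm_left, hR.pair]

section Divergence

variable {n : ℕ} {ε η : Fin n → ℝ}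

/-- Each term pairs an antisymmetric F with an array symmetric in the same two indices. For F i j
this is the symmetry of the first pair; for F i k the exchange of pairs becomes a symmetry after
renaming j and l, which both meet x; the F i l term reduces to that one by the symmetry of the
second pair. -/
theorem wsum_killing_terms {T : Fin n → Fin n → Fin n → Fin n → ℝ}
    (h₁ : ∀ i j k l, T i j k l = T j i k l) (h₂ : ∀ i j k l, T i j k l = T i j l k)
    (h₃ : ∀ i j k l, T i j k l = T k l i j) {F : Fin n → Fin n → ℝ}
    (hF : ∀ i j, F i j = - F j i) (x : Fin n → ℝ) :
    wsum ε (fun i => wsum ε fun j => wsum ε fun k => wsum ε fun l =>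
      T i j k l * (F i j * x k * x l + x j * F i k * x l + x j * x k * F i l)) = 0 := by
  have e₁ : wsum ε (fun i => wsum ε fun j => wsum ε fun k => wsum ε fun l =>
      T i j k l * (F i j * x k * x l)) = 0 := by
    refine wsum_eq_zero_of_antisymm fun i j => ?_
    simp only [← wsum_neg]
    refine wsum_congr fun k => wsum_congr fun l => ?_
    rw [h₁ i j, hF i j]
    ring
  have e₂ : wsum ε (fun i => wsum ε fun j => wsum ε fun k => wsum ε fun l =>
      T i j k l * (x j * F i k * x l)) = 0 := by
    have : ∀ i, wsum ε (fun j => wsum ε fun k => wsum ε fun l =>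
        T i j k l * (x j * F i k * x l)) = wsum ε fun k => wsum ε fun j => wsum ε fun l =>
        T i j k l * (x j * F i k * x l) := fun i => wsum_comm _
    rw [wsum_congr this]
    refine wsum_eq_zero_of_antisymm fun i k => ?_
    rw [wsum_comm]
    simp only [← wsum_neg]
    refine wsum_congr fun k => wsum_congr fun l => ?_
    rw [h₃, hF]
    ring
  have e₃ : wsum ε (fun i => wsum ε fun j => wsum ε fun k => wsum ε fun l =>
      T i j k l * (x j * x k * F i l)) = 0 := by
    rw [← e₂]
    refine wsum_congr fun i => wsum_congr fun j => ?_
    rw [wsum_comm]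
    refine wsum_congr fun k => wsum_congr fun l => ?_
    rw [h₂]
    ring
  simp only [mul_add, wsum_add, e₁, e₂, e₃, add_zero]

theorem frameBel_swap_left (R : Fin n → Fin n → Fin n → Fin n → ℝ) (i j k l) :
    frameBel ε η R R i j k l = frameBel ε η R R j i k l := by
  have hg : (if i = j then η i else 0) = (if j = i then η j else 0) := by
    by_cases h : i = j
    · simp [h]
    · simp [h, Ne.symm h]
  simp only [frameBel]
  rw [hg, add_comm (wsum ε fun r => wsum ε fun s => R i r k s * R j r l s)]
  simp only [mul_comm (R i _ _ _)]

theorem frameBel_swap_right (R : Fin n → Fin n → Fin n → Fin n → ℝ) (i j k l) :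
    frameBel ε η R R i j k l = frameBel ε η R R i j l k := by
  have hg : (if k = l then η k else 0) = (if l = k then η l else 0) := by
    by_cases h : k = l
    · simp [h]
    · simp [h, Ne.symm h]
  simp only [frameBel]
  rw [hg, add_comm (wsum ε fun r => wsum ε fun s => R i r k s * R j r l s)]
  simp only [mul_comm (R _ _ k _)]

/-- Pair symmetry of the curvature fixes each of the two quadratic terms, up to renaming the
contracted indices, and interchanges the two terms that carry a single metric factor. -/
theorem frameBel_pair {R : Fin n → Fin n → Fin n → Fin n → ℝ} (hR : CurvatureSymm R) (i j k l) :
    frameBel ε η R R i j k l = frameBel ε η R R k l i j := by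
  have h₁ : wsum ε (fun r => wsum ε fun s => R k r i s * R l r j s)
      = wsum ε (fun r => wsum ε fun s => R i r k s * R j r l s) := by
    rw [wsum_comm]
    refine wsum_congr fun r => wsum_congr fun s => ?_
    rw [hR.pair k, hR.pair l]
  have h₂ : wsum ε (fun r => wsum ε fun s => R k r j s * R l r i s)
      = wsum ε (fun r => wsum ε fun s => R i r l s * R j r k s) := by
    rw [wsum_comm]
    refine wsum_congr fun r => wsum_congr fun s => ?_
    rw [hR.pair k, hR.pair l, mul_comm]
  have h₃ : ∀ a b, wsum ε (fun r => wsum ε fun t => wsum ε fun s => R r t a s * R r t b s)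
      = wsum ε (fun r => wsum ε fun s => wsum ε fun t => R a r s t * R b r s t) := by
    intro a b
    rw [wsum_comm₂]
    refine wsum_congr fun r => wsum_congr fun s => wsum_congr fun t => ?_
    rw [hR.pair s, hR.pair s]
  simp only [frameBel]
  rw [h₁, h₂, h₃, h₃]
  ring

theorem frameScalar_swap_left (h : Fin n → Fin n → ℝ) (hh : ∀ i j, h i j = h j i) (i j k l) :
    frameScalar ε η h h i j k l = frameScalar ε η h h j i k l := by
  have hg : (if i = j then η i else 0) = (if j = i then η j else 0) := by
    by_cases h : i = j
    · simp [h]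
    · simp [h, Ne.symm h]
  simp only [frameScalar]
  rw [hg, hh l j, hh k j, hh l i, hh k i]
  simp only [mul_comm (h i _)]
  ring

theorem frameScalar_swap_right (h : Fin n → Fin n → ℝ) (i j k l) :
    frameScalar ε η h h i j k l = frameScalar ε η h h i j l k := by
  have hg : (if k = l then η k else 0) = (if l = k then η l else 0) := by
    by_cases h : k = l
    · simp [h]
    · simp [h, Ne.symm h]
  simp only [frameScalar]
  rw [hg]
  simp only [mul_comm (h k _)]
  ring

theorem frameScalar_pair (h : Fin n → Fin n → ℝ) (hh : ∀ i j, h i j = h j i) (i j k l) :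
    frameScalar ε η h h i j k l = frameScalar ε η h h k l i j := by
  simp only [frameScalar]
  rw [hh k i, hh j l, hh k j, hh i l]
  ring

/-- Contraction of the derivative of the Bel tensor with three copies of a covector. -/
theorem frameBel_divergence (hη : ∀ i, ε i * η i = 1)
    {R : Fin n → Fin n → Fin n → Fin n → ℝ} {R' : Fin n → Fin n → Fin n → Fin n → Fin n → ℝ}
    (hR : CurvatureSymm R) (hR' : ∀ m, CurvatureSymm (R' m))
    (bianchi : ∀ m a b c d, R' m a b c d + R' a b m c d + R' b m a c d = 0) (x : Fin n → ℝ) :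
    wsum ε (fun i => wsum ε fun j => wsum ε fun k => wsum ε fun l =>
        (frameBel ε η (R' i) R i j k l + frameBel ε η R (R' i) i j k l) * x j * x k * x l)
      = 2 * (wsum ε fun r => wsum ε fun s =>
          wsum ε (fun k => x k * wsum ε fun i => R' i i r k s)
          * wsum ε (fun j => x j * wsum ε fun l => x l * R j r l s))
        - (1 / 2) * wsum ε (fun k => x k * x k) * (wsum ε fun r => wsum ε fun s => wsum ε fun t =>
          wsum ε (fun i => R' i i r s t) * wsum ε (fun j => x j * R j r s t)) := by
  simp only [add_mul, wsum_add, wsum_frameBel hη]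
  simp only [wsum_sub]
  have hx' : ∀ (f : Fin n → ℝ) (c : ℝ), wsum ε (fun i => c * f i) = c * wsum ε f :=
    fun f c => (mul_wsum c f).symm
  -- the two terms with a free curvature factor
  have e₁ : wsum ε (fun i => 2 * (wsum ε fun r => wsum ε fun s =>
        wsum ε (fun k => x k * R' i i r k s)
          * wsum ε (fun j => x j * wsum ε fun l => x l * R j r l s)))
      = 2 * (wsum ε fun r => wsum ε fun s =>
          wsum ε (fun k => x k * wsum ε fun i => R' i i r k s)
          * wsum ε (fun j => x j * wsum ε fun l => x l * R j r l s)) := by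
    rw [hx', wsum_comm]
    congr 1
    refine wsum_congr fun r => ?_
    rw [wsum_comm]
    refine wsum_congr fun s => ?_
    rw [← wsum_mul, wsum_comm]
    simp only [mul_wsum]
  have e₂ : wsum ε (fun i => (1 / 2) * wsum ε (fun k => x k * x k) *
        (wsum ε fun r => wsum ε fun s => wsum ε fun t =>
          R' i i r s t * wsum ε (fun j => x j * R j r s t)))
      = (1 / 2) * wsum ε (fun k => x k * x k) * (wsum ε fun r => wsum ε fun s => wsum ε fun t =>
          wsum ε (fun i => R' i i r s t) * wsum ε (fun j => x j * R j r s t)) := by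
    rw [hx', wsum_comm]
    congr 1
    refine wsum_congr fun r => ?_
    rw [wsum_comm]
    refine wsum_congr fun s => ?_
    rw [wsum_comm]
    refine wsum_congr fun t => ?_
    rw [← wsum_mul]
  -- the consequences of the Bianchi identity
  have b₁ : ∀ r t k s, wsum ε (fun i => x i * R' i r t k s)
      = wsum ε (fun i => x i * R' r i t k s) - wsum ε (fun i => x i * R' t i r k s) := by
    intro r t k s
    rw [← wsum_sub]
    refine wsum_congr fun i => ?_
    have h₁ := bianchi i r t k s
    have h₂ := (hR' r).antisymm_left t i k s
    linear_combination x i * h₁ - x i * h₂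
  -- The Bianchi identity moves the derivative onto r or t. Antisymmetry of R in that pair makes
  -- both contributions equal, which absorbs the factor 1/2. The result cancels the quadratic term
  -- in which the derivative falls on the second factor.
  have e₃ : wsum ε (fun i => (1 / 2) * x i * (wsum ε fun r => wsum ε fun t => wsum ε fun s =>
          wsum ε (fun k => x k * R r t k s) * wsum ε (fun l => x l * R' i r t l s)))
      = wsum ε fun i => wsum ε fun r => wsum ε fun s => wsum ε (fun k => x k * R i r k s)
          * wsum ε (fun j => x j * wsum ε fun l => x l * R' i j r l s) := by
    have s₁ : ∀ r t s, wsum ε (fun i => x i * wsum ε (fun l => x l * R' i r t l s))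
        = wsum ε (fun i => x i * wsum ε (fun l => x l * R' r i t l s))
          - wsum ε (fun i => x i * wsum ε (fun l => x l * R' t i r l s)) := by
      intro r t s
      have : ∀ q : Fin n → Fin n → ℝ, wsum ε (fun i => x i * wsum ε (fun l => x l * q i l))
          = wsum ε (fun l => x l * wsum ε (fun i => x i * q i l)) := by
        intro q
        simp only [mul_wsum]
        rw [wsum_comm]
        exact wsum_congr fun l => wsum_congr fun i => by ring
      rw [this fun i l => R' i r t l s, this fun i l => R' r i t l s,
        this fun i l => R' t i r l s, ← wsum_sub]
      refine wsum_congr fun l => ?_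
      rw [b₁]
      ring
    have s₂ : wsum ε (fun i => (1 / 2) * x i * (wsum ε fun r => wsum ε fun t => wsum ε fun s =>
          wsum ε (fun k => x k * R r t k s) * wsum ε (fun l => x l * R' i r t l s)))
        = (1 / 2) * (wsum ε fun r => wsum ε fun t => wsum ε fun s =>
          wsum ε (fun k => x k * R r t k s) *
            wsum ε (fun i => x i * wsum ε (fun l => x l * R' i r t l s))) := by
      simp only [mul_assoc]
      rw [hx']
      congr 1
      conv_lhs => simp only [mul_wsum (x _)]
      rw [wsum_comm]
      refine wsum_congr fun r => ?_
      rw [wsum_comm]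
      refine wsum_congr fun t => ?_
      rw [wsum_comm]
      refine wsum_congr fun s => ?_
      rw [mul_wsum]
      exact wsum_congr fun i => by ring
    rw [s₂]
    simp only [s₁, mul_sub, wsum_sub]
    have s₃ : (wsum ε fun r => wsum ε fun t => wsum ε fun s =>
          wsum ε (fun k => x k * R r t k s) *
            wsum ε (fun i => x i * wsum ε (fun l => x l * R' t i r l s)))
        = - wsum ε fun r => wsum ε fun t => wsum ε fun s =>
          wsum ε (fun k => x k * R r t k s) *
            wsum ε (fun i => x i * wsum ε (fun l => x l * R' r i t l s)) := by
      rw [wsum_comm]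
      simp only [← wsum_neg, ← neg_mul]
      refine wsum_congr fun r => wsum_congr fun t => wsum_congr fun s => ?_
      congr 1
      refine wsum_congr fun k => ?_
      rw [hR.antisymm_left]
      ring
    rw [s₃]
    ring
  have e₃' : wsum ε (fun i => (1 / 2) * x i * (wsum ε fun r => wsum ε fun t => wsum ε fun s =>
          wsum ε (fun k => x k * R' i r t k s) * wsum ε (fun l => x l * R r t l s)))
      = wsum ε (fun i => (1 / 2) * x i * (wsum ε fun r => wsum ε fun t => wsum ε fun s =>
          wsum ε (fun k => x k * R r t k s) * wsum ε (fun l => x l * R' i r t l s))) := by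
    refine wsum_congr fun i => ?_
    congr 1
    exact wsum_congr fun r => wsum_congr fun t => wsum_congr fun s => mul_comm _ _
  have e₄' : wsum ε (fun i => (1 / 8) * x i * wsum ε (fun k => x k * x k) *
          wsum ε (fun r => wsum ε fun t => wsum ε fun s => wsum ε fun v =>
            R' i r t s v * R r t s v))
      = wsum ε (fun i => (1 / 8) * x i * wsum ε (fun k => x k * x k) *
          wsum ε (fun r => wsum ε fun t => wsum ε fun s => wsum ε fun v =>
            R r t s v * R' i r t s v)) := by
    refine wsum_congr fun i => ?_
    congr 1
    exact wsum_congr fun r => wsum_congr fun t => wsum_congr fun s => wsum_congr fun v =>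
      mul_comm _ _
  -- The same use of Bianchi and antisymmetry on the full square of the curvature; it cancels the
  -- |x|² term whose derivative is not a divergence.
  have e₄ : wsum ε (fun i => x i * wsum ε (fun r => wsum ε fun t => wsum ε fun s => wsum ε fun v =>
            R r t s v * R' i r t s v))
      = 2 * wsum ε (fun i => wsum ε fun r => wsum ε fun s => wsum ε fun t =>
          R i r s t * wsum ε (fun j => x j * R' i j r s t)) := by
    have s₂ : wsum ε (fun i => x i * wsum ε (fun r => wsum ε fun t => wsum ε fun s =>
          wsum ε fun v => R r t s v * R' i r t s v))
        = wsum ε (fun r => wsum ε fun t => wsum ε fun s => wsum ε fun v =>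
            R r t s v * wsum ε fun i => x i * R' i r t s v) := by
      conv_lhs => simp only [mul_wsum (x _)]
      rw [wsum_comm]
      refine wsum_congr fun r => ?_
      rw [wsum_comm]
      refine wsum_congr fun t => ?_
      rw [wsum_comm]
      refine wsum_congr fun s => ?_
      rw [wsum_comm]
      refine wsum_congr fun v => ?_
      rw [mul_wsum]
      exact wsum_congr fun i => by ring
    rw [s₂]
    simp only [b₁, mul_sub, wsum_sub]
    have s₃ : wsum ε (fun r => wsum ε fun t => wsum ε fun s => wsum ε fun v =>
            R r t s v * wsum ε fun i => x i * R' t i r s v)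
        = - wsum ε (fun r => wsum ε fun t => wsum ε fun s => wsum ε fun v =>
            R r t s v * wsum ε fun i => x i * R' r i t s v) := by
      rw [wsum_comm]
      simp only [← wsum_neg, ← neg_mul]
      refine wsum_congr fun r => wsum_congr fun t => wsum_congr fun s => wsum_congr fun v => ?_
      rw [hR.antisymm_left]
    rw [s₃]
    ring
  have e₅ : wsum ε (fun i => (1 / 8) * x i * wsum ε (fun k => x k * x k) *
          wsum ε (fun r => wsum ε fun t => wsum ε fun s => wsum ε fun v =>
            R r t s v * R' i r t s v))
      = (1 / 8) * wsum ε (fun k => x k * x k) *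
        wsum ε (fun i => x i * wsum ε (fun r => wsum ε fun t => wsum ε fun s => wsum ε fun v =>
            R r t s v * R' i r t s v)) := by
    rw [← hx']
    exact wsum_congr fun i => by ring
  rw [e₁, e₂, e₃', e₃, e₄', e₅, e₄, hx', hx']
  ring

/-- Contraction of the derivative of the scalar superenergy tensor with three copies of a
covector. -/
theorem frameScalar_divergence (hη : ∀ i, ε i * η i = 1) {h : Fin n → Fin n → ℝ}
    {h' : Fin n → Fin n → Fin n → ℝ} (hs : ∀ i j, h i j = h j i)
    (hs' : ∀ m i j, h' m i j = h' m j i) (x : Fin n → ℝ) :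
    wsum ε (fun i => wsum ε fun j => wsum ε fun k => wsum ε fun l =>
        (frameScalar ε η (h' i) h i j k l + frameScalar ε η h (h' i) i j k l) * x j * x k * x l)
      = 2 * wsum ε (fun k => x k * wsum ε fun i => h' i i k) *
          wsum ε (fun l => x l * wsum ε fun j => x j * h l j)
        - wsum ε (fun l => x l * x l) * wsum ε (fun r => (wsum ε fun i => h' i i r) *
          wsum ε (fun l => x l * h l r))
        + 2 * wsum ε (fun i => wsum ε (fun l => x l * h i l) *
          (wsum ε (fun j => x j * wsum ε fun k => x k * (h' i j k - h' j i k))))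
        + wsum ε (fun l => x l * x l) * wsum ε (fun i => wsum ε fun r => h i r *
          wsum ε fun j => x j * (h' j i r - h' i j r)) := by
  have hx' : ∀ (f : Fin n → ℝ) (c : ℝ), wsum ε (fun i => c * f i) = c * wsum ε f :=
    fun f c => (mul_wsum c f).symm
  simp only [add_mul, wsum_add, wsum_frameScalar hη]
  simp only [wsum_sub, mul_sub]
  have e₁ : wsum ε (fun i => 2 * wsum ε (fun l => x l * h' i i l) *
        wsum ε (fun l => x l * wsum ε fun j => x j * h l j))
      = 2 * wsum ε (fun k => x k * wsum ε fun i => h' i i k) *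
          wsum ε (fun l => x l * wsum ε fun j => x j * h l j) := by
    rw [← wsum_mul, hx', wsum_comm]
    simp only [mul_wsum (x _)]
  have e₂ : wsum ε (fun i => 2 * wsum ε (fun l => x l * h i l) *
        wsum ε (fun l => x l * wsum ε fun j => x j * h' i l j))
      = 2 * wsum ε (fun i => wsum ε (fun l => x l * h i l) *
        wsum ε (fun l => x l * wsum ε fun j => x j * h' i l j)) := by
    rw [← hx']
    exact wsum_congr fun i => by ring
  -- Renaming the contracted index r as i brings this sum to the shape of `e₂` with the first two
  -- slots of h' exchanged, so that their difference is a commutator of covariant derivatives.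
  have e₃ : wsum ε (fun i => x i * wsum ε (fun r => wsum ε (fun l => x l * h' i l r) *
        wsum ε (fun l => x l * h l r)))
      = wsum ε (fun i => wsum ε (fun l => x l * h i l) *
          (wsum ε (fun j => x j * wsum ε fun k => x k * h' j i k))) := by
    conv_lhs => simp only [mul_wsum (x _)]
    rw [wsum_comm]
    refine wsum_congr fun r => ?_
    rw [mul_wsum]
    refine wsum_congr fun i => ?_
    have a₁ : wsum ε (fun l => x l * h' i l r) = wsum ε (fun l => x l * h' i r l) :=
      wsum_congr fun l => by rw [hs' i l r]
    have a₂ : wsum ε (fun l => x l * h l r) = wsum ε (fun l => x l * h r l) :=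
      wsum_congr fun l => by rw [hs l r]
    rw [a₁, a₂]
    ring
  have e₃' : wsum ε (fun i => x i * wsum ε (fun r => wsum ε (fun l => x l * h l r) *
        wsum ε (fun l => x l * h' i l r)))
      = wsum ε (fun i => x i * wsum ε (fun r => wsum ε (fun l => x l * h' i l r) *
        wsum ε (fun l => x l * h l r))) :=
    wsum_congr fun i => by rw [wsum_congr fun r => mul_comm _ _]
  have e₄ : wsum ε (fun i => wsum ε (fun l => x l * x l) *
        wsum ε (fun r => h' i i r * wsum ε (fun l => x l * h l r)))
      = wsum ε (fun l => x l * x l) * wsum ε (fun r => (wsum ε fun i => h' i i r) *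
          wsum ε (fun l => x l * h l r)) := by
    rw [hx', wsum_comm]
    congr 1
    exact wsum_congr fun r => by rw [wsum_mul]
  have e₅ : wsum ε (fun i => wsum ε (fun l => x l * x l) *
        wsum ε (fun r => h i r * wsum ε (fun l => x l * h' i l r)))
      = wsum ε (fun l => x l * x l) * wsum ε (fun i => wsum ε fun r => h i r *
          wsum ε fun j => x j * h' i j r) := by
    rw [hx']
  have e₆ : wsum ε (fun i => (1 / 2) * x i * wsum ε (fun l => x l * x l) *
          wsum ε (fun s => wsum ε fun r => h s r * h' i s r))
      = (1 / 2) * (wsum ε (fun l => x l * x l) * wsum ε (fun i => wsum ε fun r => h i r *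
          wsum ε fun j => x j * h' j i r)) := by
    have : ∀ i, (1 / 2) * x i * wsum ε (fun l => x l * x l) *
          wsum ε (fun s => wsum ε fun r => h s r * h' i s r)
        = (1 / 2) * wsum ε (fun l => x l * x l) * (x i *
          wsum ε (fun s => wsum ε fun r => h s r * h' i s r)) := fun i => by ring
    rw [wsum_congr this, hx', mul_assoc]
    congr 2
    simp only [mul_wsum (x _)]
    rw [wsum_comm]
    refine wsum_congr fun r => ?_
    rw [wsum_comm]
    refine wsum_congr fun s => ?_
    rw [mul_wsum]
    exact wsum_congr fun i => by ring
  have e₆' : wsum ε (fun i => (1 / 2) * x i * wsum ε (fun l => x l * x l) *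
          wsum ε (fun s => wsum ε fun r => h' i s r * h s r))
      = wsum ε (fun i => (1 / 2) * x i * wsum ε (fun l => x l * x l) *
          wsum ε (fun s => wsum ε fun r => h s r * h' i s r)) :=
    wsum_congr fun i => by
      rw [wsum_congr fun s => wsum_congr fun r => mul_comm (h' i s r) (h s r)]
  rw [e₁, e₂, e₃', e₃, e₄, e₅, e₆', e₆]
  ring

end Divergence

end SuperEnergy

/-! ### Cancellation of the two divergences -/

namespace SuperEnergy

section FrameTheorems

variable {n : ℕ} {ε η : Fin n → ℝ}

/-- The divergence of the mixed superenergy current, written in an orthogonal frame, vanishes. -/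
theorem frame_divergence_mixed (hη : ∀ i, ε i * η i = 1)
    {R : Fin n → Fin n → Fin n → Fin n → ℝ} {R' : Fin n → Fin n → Fin n → Fin n → Fin n → ℝ}
    (hR : CurvatureSymm R) (hR' : ∀ m, CurvatureSymm (R' m))
    (bianchi : ∀ m a b c d, R' m a b c d + R' a b m c d + R' b m a c d = 0)
    {h : Fin n → Fin n → ℝ} {h' : Fin n → Fin n → Fin n → ℝ} (hs : ∀ i j, h i j = h j i)
    (hs' : ∀ m i j, h' m i j = h' m j i) {φ : Fin n → ℝ}
    (hcomm : ∀ k i j, h' k i j - h' i k j = - wsum ε fun l => φ l * R l j k i)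
    (htr : ∀ m, wsum ε (fun i => h' m i i) = 0) {f : ℝ} {f' : Fin n → ℝ}
    (hric : ∀ b d, wsum ε (fun a => R a b a d) = φ b * φ d + f * if b = d then η b else 0)
    (hric' : ∀ m b d, wsum ε (fun a => R' m a b a d)
      = h m b * φ d + φ b * h m d + f' m * if b = d then η b else 0)
    {x : Fin n → ℝ} (hxφ : wsum ε (fun i => x i * φ i) = 0)
    (hxf : wsum ε (fun i => x i * f' i) = 0)
    (hxh : wsum ε (fun r => φ r * wsum ε fun l => x l * h l r) = 0)
    {F : Fin n → Fin n → ℝ} (hF : ∀ i j, F i j = - F j i) :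
    wsum ε (fun i => wsum ε fun j => wsum ε fun k => wsum ε fun l =>
      (frameBel ε η (R' i) R i j k l + frameBel ε η R (R' i) i j k l
        + (frameScalar ε η (h' i) h i j k l + frameScalar ε η h (h' i) i j k l)) * x j * x k * x l
      + (frameBel ε η R R i j k l + frameScalar ε η h h i j k l) *
        (F i j * x k * x l + x j * F i k * x l + x j * x k * F i l)) = 0 := by
  have hx' : ∀ (f : Fin n → ℝ) (c : ℝ), wsum ε (fun i => c * f i) = c * wsum ε f :=
    fun f c => (mul_wsum c f).symm
  have hB := frameBel_divergence hη hR hR' bianchi x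
  have hS := frameScalar_divergence hη hs hs' x
  have hBF := wsum_killing_terms (ε := ε) (frameBel_swap_left (ε := ε) (η := η) R)
    (frameBel_swap_right R) (frameBel_pair hR) hF x
  have hSF := wsum_killing_terms (ε := ε) (frameScalar_swap_left (ε := ε) (η := η) h hs)
    (frameScalar_swap_right h) (frameScalar_pair h hs) hF x
  have split : ∀ i j k l, (frameBel ε η (R' i) R i j k l + frameBel ε η R (R' i) i j k l
        + (frameScalar ε η (h' i) h i j k l + frameScalar ε η h (h' i) i j k l)) * x j * x k * x l
      + (frameBel ε η R R i j k l + frameScalar ε η h h i j k l) *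
        (F i j * x k * x l + x j * F i k * x l + x j * x k * F i l)
      = (frameBel ε η (R' i) R i j k l + frameBel ε η R (R' i) i j k l) * x j * x k * x l
        + (frameScalar ε η (h' i) h i j k l + frameScalar ε η h (h' i) i j k l)
          * x j * x k * x l
        + frameBel ε η R R i j k l *
          (F i j * x k * x l + x j * F i k * x l + x j * x k * F i l)
        + frameScalar ε η h h i j k l *
          (F i j * x k * x l + x j * F i k * x l + x j * x k * F i l) := by
    intro i j k l
    ring
  simp only [split, wsum_add]
  simp only [← wsum_add]
  simp only [wsum_add] at hB hS ⊢
  rw [hB, hS, hBF, hSF]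
  clear hB hS hBF hSF split
  -- the contracted Bianchi identity
  have hC : ∀ r s t, wsum ε (fun i => R' i i r s t)
      = φ t * h s r - φ s * h t r + f' s * (if t = r then η t else 0)
        - f' t * (if s = r then η s else 0) := by
    intro r s t
    have h₁ : ∀ i, R' i i r s t = R' s i t i r - R' t i s i r := by
      intro i
      have b := bianchi i s t i r
      have a₁ := (hR' s).antisymm_left t i i r
      have a₂ := (hR' i).pair i r s t
      linear_combination b + a₂ - a₁
    rw [wsum_congr h₁, wsum_sub, hric', hric', hs s t]
    ring
  -- X and Y are the curvature contracted with two and with one copy of the covector; everything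
  -- below is expressed through them.
  set X : Fin n → Fin n → ℝ :=
    fun r s => wsum ε (fun j => x j * wsum ε fun l => x l * R j r l s) with hX
  set Y : Fin n → Fin n → Fin n → ℝ :=
    fun r s t => wsum ε (fun j => x j * R j r s t) with hY
  have hXs : ∀ r s, X r s = X s r := by
    intro r s
    simp only [hX, mul_wsum]
    rw [wsum_comm]
    refine wsum_congr fun j => wsum_congr fun l => ?_
    rw [hR.pair]
    ring
  have hXx : ∀ s, wsum ε (fun r => x r * X r s) = 0 := by
    intro s
    simp only [hX, mul_wsum]
    refine wsum_eq_zero_of_antisymm fun i j => ?_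
    rw [← wsum_neg]
    refine wsum_congr fun l => ?_
    rw [hR.antisymm_left]
    ring
  have hYa : ∀ r s t, Y r s t = - Y r t s := by
    intro r s t
    simp only [hY, ← wsum_neg]
    refine wsum_congr fun j => ?_
    rw [hR.antisymm_right]
    ring
  -- This trace of Y is the Ricci tensor applied to x; its φφ part dies because x·φ = 0.
  have hYr : ∀ s, wsum ε (fun r => Y r s r) = f * x s := by
    intro s
    have : wsum ε (fun r => Y r s r) = wsum ε (fun j => x j * wsum ε fun r => R r j r s) := by
      simp only [hY, mul_wsum]
      rw [wsum_comm]
      refine wsum_congr fun j => wsum_congr fun r => ?_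
      rw [hR.antisymm_left, hR.antisymm_right]
      ring
    rw [this]
    have h₂ : ∀ j, x j * wsum ε (fun r => R r j r s)
        = φ s * (x j * φ j) + (if s = j then η s else 0) * (f * x j) := by
      intro j
      rw [hric]
      by_cases hjs : j = s
      · subst hjs
        simp
        ring
      · simp [hjs, Ne.symm hjs]
        ring
    rw [wsum_congr h₂, wsum_add, hx', hxφ, wsum_delta hη s (fun j => f * x j)]
    ring
  -- the divergence of the Hessian
  have hdiv : ∀ k, wsum ε (fun i => h' i i k)
      = (wsum ε fun l => φ l * φ l) * φ k + f * φ k := by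
    intro k
    have h₁ : ∀ i, h' i i k = h' k i i + wsum ε fun l => φ l * R i l i k := by
      intro i
      have c := hcomm i k i
      have : wsum ε (fun l => φ l * R l i i k) = - wsum ε fun l => φ l * R i l i k := by
        rw [← wsum_neg]
        refine wsum_congr fun l => ?_
        rw [hR.antisymm_left]
        ring
      rw [this] at c
      rw [hs' i i k]
      linarith
    rw [wsum_congr h₁, wsum_add, htr, wsum_comm]
    have h₂ : ∀ l, wsum ε (fun i => φ l * R i l i k)
        = φ k * (φ l * φ l) + (if k = l then η k else 0) * (f * φ l) := by
      intro l
      rw [hx', hric]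
      by_cases hjs : l = k
      · subst hjs
        simp
        ring
      · simp [hjs, Ne.symm hjs]
        ring
    rw [wsum_congr h₂, wsum_add, hx', wsum_delta hη k (fun j => f * φ j)]
    ring
  simp only [hC, hdiv]
  -- the contractions that contain the covector
  have e₁ : ∀ r s, wsum ε (fun k => x k * (φ s * h k r - φ k * h s r
        + f' k * (if s = r then η s else 0) - f' s * (if k = r then η k else 0)))
      = φ s * wsum ε (fun l => x l * h l r) - f' s * x r := by
    intro r s
    have : ∀ k, x k * (φ s * h k r - φ k * h s r
        + f' k * (if s = r then η s else 0) - f' s * (if k = r then η k else 0))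
        = φ s * (x k * h k r) - h s r * (x k * φ k) + (if s = r then η s else 0) * (x k * f' k)
          - (if r = k then η r else 0) * (f' s * x k) := by
      intro k
      have hg : (if k = r then η k else 0) = (if r = k then η r else 0) := by
        by_cases hk : k = r
        · rw [hk]
        · rw [if_neg hk, if_neg (Ne.symm hk)]
      rw [hg]
      ring
    rw [wsum_congr this, wsum_sub, wsum_add, wsum_sub, hx', hx', hx', hxφ, hxf,
      wsum_delta hη r (fun k => f' s * x k)]
    ring
  have e₂ : wsum ε (fun k => x k * ((wsum ε fun l => φ l * φ l) * φ k + f * φ k)) = 0 := by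
    have : ∀ k, x k * ((wsum ε fun l => φ l * φ l) * φ k + f * φ k)
        = ((wsum ε fun l => φ l * φ l) + f) * (x k * φ k) := fun k => by ring
    rw [wsum_congr this, hx', hxφ, mul_zero]
  have e₃ : wsum ε (fun k => ((wsum ε fun l => φ l * φ l) * φ k + f * φ k) *
      wsum ε fun l => x l * h l k) = 0 := by
    have : ∀ k, ((wsum ε fun l => φ l * φ l) * φ k + f * φ k) * wsum ε (fun l => x l * h l k)
        = ((wsum ε fun l => φ l * φ l) + f) * (φ k * wsum ε fun l => x l * h l k) :=
      fun k => by ring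
    rw [wsum_congr this, hx', hxh, mul_zero]
  have e₄ : ∀ i, wsum ε (fun j => x j * wsum ε fun k => x k * (h' i j k - h' j i k))
      = - wsum ε fun l => φ l * X l i := by
    intro i
    simp only [hcomm, hX]
    have h₁ : ∀ j k, x k * -wsum ε (fun l => φ l * R l k i j)
        = wsum ε fun l => -(x k * (φ l * R l k i j)) := by
      intro j k
      rw [mul_neg, mul_wsum, wsum_neg]
    simp only [h₁, mul_wsum]
    rw [wsum_comm₂, ← wsum_neg]
    refine wsum_congr fun l => ?_
    rw [wsum_comm, ← wsum_neg]
    refine wsum_congr fun k => ?_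
    rw [← wsum_neg]
    refine wsum_congr fun j => ?_
    rw [hR.antisymm_left l k, hR.antisymm_right k l]
    ring
  have e₅ : ∀ i r, wsum ε (fun j => x j * (h' j i r - h' i j r))
      = wsum ε fun l => φ l * Y i r l := by
    intro i r
    simp only [hcomm, hY]
    have h₁ : ∀ j, x j * -wsum ε (fun l => φ l * R l r j i)
        = wsum ε fun l => -(x j * (φ l * R l r j i)) := by
      intro j
      rw [mul_neg, mul_wsum, wsum_neg]
    simp only [h₁, mul_wsum]
    rw [wsum_comm]
    refine wsum_congr fun l => wsum_congr fun j => ?_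
    rw [hR.pair, hR.antisymm_right]
    ring
  simp only [e₁, e₂, e₃, e₄, e₅]
  -- the remaining terms cancel
  have t₁ : wsum ε (fun r => wsum ε fun s =>
        (φ s * wsum ε (fun l => x l * h l r) - f' s * x r) * X r s)
      = wsum ε (fun i => wsum ε (fun l => x l * h i l) * wsum ε fun l => φ l * X l i) := by
    have h₁ : ∀ r s, (φ s * wsum ε (fun l => x l * h l r) - f' s * x r) * X r s
        = wsum ε (fun l => x l * h r l) * (φ s * X s r) - f' s * (x r * X r s) := by
      intro r s
      rw [wsum_congr fun l => by rw [hs l r], hXs s r]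
      ring
    rw [wsum_congr fun r => wsum_congr fun s => h₁ r s]
    simp only [wsum_sub, hx']
    rw [wsum_comm fun r s => f' s * (x r * X r s)]
    simp only [hx', hXx, mul_zero, wsum_zero, sub_zero]
  -- Antisymmetry of Y in its last two slots folds the four terms into two equal halves. The metric
  -- terms leave the trace of Y against f', which is f times x·f' and hence zero.
  have t₂ : wsum ε (fun r => wsum ε fun s => wsum ε fun t =>
        (φ t * h s r - φ s * h t r + f' s * (if t = r then η t else 0)
          - f' t * (if s = r then η s else 0)) * Y r s t)
      = 2 * wsum ε (fun i => wsum ε fun r => h i r * wsum ε fun l => φ l * Y i r l) := by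
    have h₁ : ∀ r s t, (φ t * h s r - φ s * h t r + f' s * (if t = r then η t else 0)
          - f' t * (if s = r then η s else 0)) * Y r s t
        = (h r s * (φ t * Y r s t) + (if r = t then η r else 0) * (f' s * Y r s t))
          + (h r t * (φ s * Y r t s) + (if r = s then η r else 0) * (f' t * Y r t s)) := by
      intro r s t
      rw [hYa r t s, hs s r, hs t r]
      by_cases h₁ : t = r <;> by_cases h₂ : s = r
      · simp [h₁, h₂]; ring
      · simp [h₁, h₂, Ne.symm h₂]; ring
      · simp [h₁, h₂, Ne.symm h₁]; ring
      · simp [h₁, h₂, Ne.symm h₁, Ne.symm h₂]; ring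
    have h₂ : ∀ r, wsum ε (fun s => wsum ε fun t =>
          h r s * (φ t * Y r s t) + (if r = t then η r else 0) * (f' s * Y r s t))
        = wsum ε (fun s => h r s * wsum ε fun l => φ l * Y r s l)
          + wsum ε (fun s => f' s * Y r s r) := by
      intro r
      rw [← wsum_add]
      refine wsum_congr fun s => ?_
      rw [wsum_add, hx', wsum_delta hη r (fun t => f' s * Y r s t)]
    have h₃ : ∀ r, wsum ε (fun s => wsum ε fun t =>
        (φ t * h s r - φ s * h t r + f' s * (if t = r then η t else 0)
          - f' t * (if s = r then η s else 0)) * Y r s t)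
        = 2 * (wsum ε (fun s => h r s * wsum ε fun l => φ l * Y r s l)
          + wsum ε (fun s => f' s * Y r s r)) := by
      intro r
      rw [wsum_congr fun s => wsum_congr fun t => h₁ r s t]
      simp only [wsum_add _ (fun t => h r t * (φ _ * Y r t _) +
        (if r = _ then η r else 0) * (f' t * Y r t _))]
      rw [wsum_add, wsum_comm (fun s t => h r t * (φ s * Y r t s) +
        (if r = s then η r else 0) * (f' t * Y r t s)), h₂]
      ring
    rw [wsum_congr h₃, hx', wsum_add, wsum_comm (fun r s => f' s * Y r s r)]
    simp only [hx', hYr]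
    have : ∀ s, f' s * (f * x s) = f * (x s * f' s) := fun s => by ring
    rw [wsum_congr this, hx', hxf, mul_zero, add_zero]
  have t₃ : wsum ε (fun i => wsum ε (fun l => x l * h i l) * -wsum ε fun l => φ l * X l i)
      = - wsum ε (fun i => wsum ε (fun l => x l * h i l) * wsum ε fun l => φ l * X l i) := by
    rw [← wsum_neg]
    exact wsum_congr fun i => by ring
  rw [t₁, t₂, t₃]
  ring

/-- The twice contracted Bianchi identity in an orthogonal frame. -/
theorem frame_contracted_bianchi {R' : Fin n → Fin n → Fin n → Fin n → Fin n → ℝ}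
    (hR' : ∀ m, CurvatureSymm (R' m))
    (bianchi : ∀ m a b c d, R' m a b c d + R' a b m c d + R' b m a c d = 0) (l : Fin n) :
    2 * wsum ε (fun a => wsum ε fun b => R' a b a b l)
      = wsum ε (fun b => wsum ε fun a => R' l a b a b) := by
  have h₁ : ∀ a b, R' l a b a b = R' a b a b l + R' b a b a l := by
    intro a b
    have b₁ := bianchi l a b a b
    have a₁ := (hR' a).pair b l a b
    have a₂ := (hR' a).antisymm_left a b b l
    have a₃ := (hR' b).pair l a a b
    have a₄ := (hR' b).antisymm_right a b l a
    linear_combination b₁ - a₁ - a₂ - a₃ - a₄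
  rw [wsum_congr fun b => wsum_congr fun a => h₁ a b]
  simp only [wsum_add]
  rw [wsum_comm fun b a => R' a b a b l]
  ring

/-- In dimension two the Einstein equations of a scalar field force its gradient to vanish. -/
theorem frame_gradient_eq_zero_of_two {ε η : Fin 2 → ℝ} (hη : ∀ i, ε i * η i = 1)
    {R : Fin 2 → Fin 2 → Fin 2 → Fin 2 → ℝ} (hR : CurvatureSymm R) {φ : Fin 2 → ℝ} {f : ℝ}
    (hric : ∀ b d, wsum ε (fun a => R a b a d) = φ b * φ d + f * if b = d then η b else 0) :
    φ = 0 := by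
  have h₀₀ := hric 0 0
  have h₀₁ := hric 0 1
  have h₁₁ := hric 1 1
  have z₀ : R 0 0 0 0 = 0 := by have := hR.antisymm_left 0 0 0 0; linarith
  have z₁ : R 1 1 1 1 = 0 := by have := hR.antisymm_left 1 1 1 1; linarith
  have z₂ : R 0 0 0 1 = 0 := by have := hR.antisymm_left 0 0 0 1; linarith
  have z₃ : R 1 0 1 1 = 0 := by have := hR.antisymm_right 1 0 1 1; linarith
  have z₄ : R 1 0 1 0 = R 0 1 0 1 := by
    have h₁ := hR.antisymm_left 1 0 1 0
    have h₂ := hR.antisymm_right 0 1 1 0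
    linarith
  simp only [wsum, Fin.sum_univ_two, z₀, z₁, z₂, z₃, z₄] at h₀₀ h₀₁ h₁₁
  norm_num at h₀₀ h₀₁ h₁₁
  have e₀ := hη 0
  have e₁ := hη 1
  -- In dimension two both diagonal Ricci components come from the single curvature component
  -- R_{0101}; eliminating it also eliminates f. Together with φ_0 φ_1 = 0 this kills the gradient
  -- in every signature.
  have hsq : η 1 * φ 0 ^ 2 = η 0 * φ 1 ^ 2 := by
    have k₀ : η 1 * (ε 1 * R 0 1 0 1) = R 0 1 0 1 := by linear_combination R 0 1 0 1 * e₁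
    have k₁ : η 0 * (ε 0 * R 0 1 0 1) = R 0 1 0 1 := by linear_combination R 0 1 0 1 * e₀
    rw [h₀₀] at k₀
    rw [h₁₁] at k₁
    linear_combination k₀ - k₁
  have n₀ : η 0 ≠ 0 := right_ne_zero_of_mul_eq_one e₀
  have n₁ : η 1 ≠ 0 := right_ne_zero_of_mul_eq_one e₁
  funext i
  rcases h₀₁ with h | h
  · have : φ 1 = 0 := by
      rw [h] at hsq
      have : φ 1 ^ 2 = 0 := by
        have := hsq.symm
        simpa [n₀] using this
      exact pow_eq_zero_iff two_ne_zero |>.1 this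
    fin_cases i
    · exact h
    · exact this
  · have : φ 0 = 0 := by
      rw [h] at hsq
      have : φ 0 ^ 2 = 0 := by simpa [n₁] using hsq
      exact pow_eq_zero_iff two_ne_zero |>.1 this
    fin_cases i
    · exact this
    · exact h

end FrameTheorems

end SuperEnergy

namespace SuperEnergy

/-! ### Partial derivatives -/

section PartialDerivatives

variable {n : ℕ} {f f' : Coord n → ℝ} {y : Coord n}

theorem pd_add (i : Fin n) (hf : DifferentiableAt ℝ f y) (hf' : DifferentiableAt ℝ f' y) :
    pd i (fun z => f z + f' z) y = pd i f y + pd i f' y := by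
  simp only [pd]
  rw [fderiv_fun_add hf hf']
  rfl

theorem pd_sub (i : Fin n) (hf : DifferentiableAt ℝ f y) (hf' : DifferentiableAt ℝ f' y) :
    pd i (fun z => f z - f' z) y = pd i f y - pd i f' y := by
  simp only [pd]
  rw [fderiv_fun_sub hf hf']
  rfl

theorem pd_mul (i : Fin n) (hf : DifferentiableAt ℝ f y) (hf' : DifferentiableAt ℝ f' y) :
    pd i (fun z => f z * f' z) y = pd i f y * f' y + f y * pd i f' y := by
  simp only [pd]
  rw [fderiv_fun_mul hf hf']
  simp [mul_comm, add_comm]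

theorem pd_const (i : Fin n) (c : ℝ) : pd i (fun _ => c) y = 0 := by
  simp [pd]

theorem pd_sum {ι : Type*} (i : Fin n) (s : Finset ι) {F : ι → Coord n → ℝ}
    (hF : ∀ k ∈ s, DifferentiableAt ℝ (F k) y) :
    pd i (fun z => ∑ k ∈ s, F k z) y = ∑ k ∈ s, pd i (F k) y := by
  simp only [pd]
  rw [fderiv_fun_sum hF]
  simp

theorem pd_congr (i : Fin n) (h : f =ᶠ[𝓝 y] f') : pd i f y = pd i f' y := by
  simp only [pd, h.fderiv_eq]

theorem contDiffAt_pd (i : Fin n) (hf : ContDiffAt ℝ ∞ f y) : ContDiffAt ℝ ∞ (pd i f) y :=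
  (hf.fderiv_right (m := ∞) (by simp)).clm_apply contDiffAt_const

theorem pd_comm (i j : Fin n) (hf : ContDiffAt ℝ ∞ f y) :
    pd i (pd j f) y = pd j (pd i f) y := by
  have hd : DifferentiableAt ℝ (fderiv ℝ f) y :=
    (hf.fderiv_right (m := ∞) (by simp)).differentiableAt (by simp)
  have key : ∀ a b : Fin n, pd a (pd b f) y
      = fderiv ℝ (fderiv ℝ f) y (EuclideanSpace.single a 1) (EuclideanSpace.single b 1) := by
    intro a b
    change fderiv ℝ (fun z => fderiv ℝ f z (EuclideanSpace.single b 1)) y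
      (EuclideanSpace.single a 1) = _
    rw [fderiv_clm_apply hd (differentiableAt_const _)]
    simp
  have hs : IsSymmSndFDerivAt ℝ f y := hf.isSymmSndFDerivAt (by
    simpa using (WithTop.coe_le_coe.2 le_top : ((2 : ℕ∞) : WithTop ℕ∞) ≤ ((⊤ : ℕ∞) : WithTop ℕ∞)))
  rw [key, key, hs]

theorem hasDerivAt_line (hf : DifferentiableAt ℝ f y) (v : Fin n → ℝ) :
    HasDerivAt (fun t : ℝ => f (y + t • (WithLp.toLp 2 v : Coord n))) (∑ a, v a * pd a f y) 0 := by
  have hv : (WithLp.toLp 2 v : Coord n) = ∑ a, v a • EuclideanSpace.single a (1 : ℝ) := by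
    ext b
    simp [Finset.sum_apply, Pi.single_apply]
  have hl : HasDerivAt (fun t : ℝ => y + t • (WithLp.toLp 2 v : Coord n))
      (WithLp.toLp 2 v : Coord n) 0 := by
    simpa using ((hasDerivAt_id (0 : ℝ)).smul_const (WithLp.toLp 2 v : Coord n)).const_add y
  have hf₀ : HasFDerivAt f (fderiv ℝ f y) (y + (0 : ℝ) • (WithLp.toLp 2 v : Coord n)) := by
    simpa using hf.hasFDerivAt
  have h := hf₀.comp_hasDerivAt (0 : ℝ) hl
  have e : fderiv ℝ f y (WithLp.toLp 2 v : Coord n) = ∑ a, v a * pd a f y := by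
    rw [hv, map_sum]
    exact Finset.sum_congr rfl fun a _ => by rw [map_smul]; rfl
  rw [← e]
  exact h

end PartialDerivatives

/-! ### Matrix-valued functions -/

section MatrixCalculus

variable {n : ℕ} {y : Coord n}

/-- The entrywise partial derivative of a matrix-valued function. -/
noncomputable def mpd (c : Fin n) (M : Coord n → Matrix (Fin n) (Fin n) ℝ) (y : Coord n) :
    Matrix (Fin n) (Fin n) ℝ :=
  Matrix.of fun a b => pd c (fun z => M z a b) y

/-- All entries of the matrix-valued function are smooth at the point. -/
def SmoothEntries {E : Type*} [NormedAddCommGroup E] [NormedSpace ℝ E]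
    (M : E → Matrix (Fin n) (Fin n) ℝ) (y : E) : Prop :=
  ∀ a b, ContDiffAt ℝ ∞ (fun z => M z a b) y

section SmoothEntries

variable {E : Type*} [NormedAddCommGroup E] [NormedSpace ℝ E] {M N : E → Matrix (Fin n) (Fin n) ℝ}
  {y : E}

theorem SmoothEntries.differentiableAt (h : SmoothEntries M y) (a b : Fin n) :
    DifferentiableAt ℝ (fun z => M z a b) y :=
  (h a b).differentiableAt (by simp)

theorem SmoothEntries.mul (hM : SmoothEntries M y) (hN : SmoothEntries N y) :
    SmoothEntries (fun z => M z * N z) y := fun a b => by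
  simp only [Matrix.mul_apply]
  exact ContDiffAt.sum fun e _ => (hM a e).mul (hN e b)

theorem SmoothEntries.add (hM : SmoothEntries M y) (hN : SmoothEntries N y) :
    SmoothEntries (fun z => M z + N z) y := fun a b => (hM a b).add (hN a b)

theorem SmoothEntries.sub (hM : SmoothEntries M y) (hN : SmoothEntries N y) :
    SmoothEntries (fun z => M z - N z) y := fun a b => (hM a b).sub (hN a b)

theorem SmoothEntries.transpose (hM : SmoothEntries M y) :
    SmoothEntries (fun z => (M z).transpose) y := fun a b => hM b a

theorem SmoothEntries.det (hM : SmoothEntries M y) : ContDiffAt ℝ ∞ (fun z => (M z).det) y := by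
  simp only [Matrix.det_apply]
  exact ContDiffAt.sum fun σ _ => (contDiffAt_prod fun i _ => hM _ _).const_smul _

/-- Cramer's rule: the adjugate entries are determinants of the matrix with one row replaced by a
basis vector, so smoothness of determinants suffices. -/
theorem SmoothEntries.inv (hM : SmoothEntries M y) (hdet : (M y).det ≠ 0) :
    SmoothEntries (fun z => (M z)⁻¹) y := fun a b => by
  have h₁ : (fun z => (M z)⁻¹ a b) = fun z => ((M z).det)⁻¹ * (M z).adjugate a b := by
    funext z
    rw [Matrix.inv_def, Ring.inverse_eq_inv']
    rfl
  rw [h₁]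
  refine (hM.det.inv hdet).mul ?_
  have h₂ : SmoothEntries (fun z => (M z).updateRow b (Pi.single a 1)) y := fun i j => by
    by_cases hi : i = b
    · subst hi
      simp only [Matrix.updateRow_self]
      exact contDiffAt_const
    · simp only [Matrix.updateRow_ne hi]
      exact hM i j
  simpa only [Matrix.adjugate_apply] using h₂.det

end SmoothEntries

variable {M N : Coord n → Matrix (Fin n) (Fin n) ℝ}

theorem SmoothEntries.mpd (c : Fin n) (hM : SmoothEntries M y) :
    SmoothEntries (fun z => mpd c M z) y := fun a b => contDiffAt_pd c (hM a b)

theorem mpd_mul (c : Fin n) (hM : SmoothEntries M y) (hN : SmoothEntries N y) :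
    mpd c (fun z => M z * N z) y = mpd c M y * N y + M y * mpd c N y := by
  ext a b
  simp only [mpd, Matrix.of_apply, Matrix.add_apply, Matrix.mul_apply]
  rw [pd_sum c Finset.univ (F := fun e z => M z a e * N z e b)
    (fun e _ => (hM.differentiableAt a e).mul (hN.differentiableAt e b)),
    ← Finset.sum_add_distrib]
  exact Finset.sum_congr rfl fun e _ =>
    pd_mul c (hM.differentiableAt a e) (hN.differentiableAt e b)

theorem mpd_add (c : Fin n) (hM : SmoothEntries M y) (hN : SmoothEntries N y) :
    mpd c (fun z => M z + N z) y = mpd c M y + mpd c N y := by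
  ext a b
  exact pd_add c (hM.differentiableAt a b) (hN.differentiableAt a b)

theorem mpd_sub (c : Fin n) (hM : SmoothEntries M y) (hN : SmoothEntries N y) :
    mpd c (fun z => M z - N z) y = mpd c M y - mpd c N y := by
  ext a b
  exact pd_sub c (hM.differentiableAt a b) (hN.differentiableAt a b)

theorem mpd_transpose (c : Fin n) : mpd c (fun z => (M z).transpose) y = (mpd c M y).transpose :=
  rfl

theorem mpd_comm (c d : Fin n) (hM : SmoothEntries M y) :
    mpd c (fun z => mpd d M z) y = mpd d (fun z => mpd c M z) y := by
  ext a b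
  exact pd_comm c d (hM a b)

theorem mpd_congr (c : Fin n) (h : ∀ᶠ z in 𝓝 y, M z = N z) : mpd c M y = mpd c N y := by
  ext a b
  exact pd_congr c (h.mono fun z hz => by simp only [hz])

end MatrixCalculus

/-! ### The Levi-Civita connection -/

/-- `g` is a smooth symmetric nondegenerate matrix-valued function on the open set `U`. -/
structure IsMetricOn {n : ℕ} (g : Coord n → Matrix (Fin n) (Fin n) ℝ) (U : Set (Coord n)) :
    Prop where
  isOpen : IsOpen U
  smooth (y) (hy : y ∈ U) : SmoothEntries g y
  symm (y) (hy : y ∈ U) : (g y).transpose = g y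
  det_ne (y) (hy : y ∈ U) : (g y).det ≠ 0

/-- The matrix `(Γ_c)^a_b` of the Levi-Civita connection. -/
noncomputable def conn {n : ℕ} (g : Coord n → Matrix (Fin n) (Fin n) ℝ) (c : Fin n) (y : Coord n) :
    Matrix (Fin n) (Fin n) ℝ :=
  Matrix.of fun a b => christoffel g y a c b

/-- The matrix `R^a_{bcd}` of the curvature. -/
noncomputable def curv {n : ℕ} (g : Coord n → Matrix (Fin n) (Fin n) ℝ) (c d : Fin n)
    (y : Coord n) : Matrix (Fin n) (Fin n) ℝ :=
  mpd c (conn g d) y - mpd d (conn g c) y + conn g c y * conn g d y - conn g d y * conn g c y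

section LeviCivita

variable {n : ℕ} {g : Coord n → Matrix (Fin n) (Fin n) ℝ} {U : Set (Coord n)} {y : Coord n}

theorem riemannUp_eq_curv (a b c d : Fin n) : riemannUp g y a b c d = curv g c d y a b := by
  simp only [riemannUp, curv, mpd, conn, Matrix.sub_apply, Matrix.add_apply, Matrix.mul_apply,
    Matrix.of_apply, Finset.sum_sub_distrib]
  ring

theorem riemann_eq_mul_curv (a b c d : Fin n) :
    riemann g y a b c d = (g y * curv g c d y) a b := by
  simp only [riemann, Matrix.mul_apply, riemannUp_eq_curv]

theorem curv_swap (c d : Fin n) : curv g c d y = - curv g d c y := by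
  simp only [curv]
  abel

namespace IsMetricOn

variable (hg : IsMetricOn g U) (hy : y ∈ U)
include hg hy

theorem eventually_mem : ∀ᶠ z in 𝓝 y, z ∈ U := hg.isOpen.mem_nhds hy

theorem inv_mul : (g y)⁻¹ * g y = 1 :=
  Matrix.nonsing_inv_mul _ (isUnit_iff_ne_zero.2 (hg.det_ne y hy))

theorem mul_inv : g y * (g y)⁻¹ = 1 :=
  Matrix.mul_nonsing_inv _ (isUnit_iff_ne_zero.2 (hg.det_ne y hy))

theorem symm_apply (a b : Fin n) : g y a b = g y b a :=
  congrFun (congrFun (hg.symm y hy) b) a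

theorem inv_symm : ((g y)⁻¹).transpose = (g y)⁻¹ := by
  rw [Matrix.transpose_nonsing_inv, hg.symm y hy]

theorem inv_symm_apply (a b : Fin n) : (g y)⁻¹ a b = (g y)⁻¹ b a :=
  congrFun (congrFun (hg.inv_symm hy) b) a

theorem smooth_inv : SmoothEntries (fun z => (g z)⁻¹) y :=
  (hg.smooth y hy).inv (hg.det_ne y hy)

theorem pd_symm (i a b : Fin n) : pd i (fun z => g z a b) y = pd i (fun z => g z b a) y :=
  pd_congr i ((hg.eventually_mem hy).mono fun _ hz => hg.symm_apply hz a b)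

theorem christoffel_symm (a b c : Fin n) : christoffel g y a b c = christoffel g y a c b := by
  simp only [christoffel]
  congr 1
  refine Finset.sum_congr rfl fun d _ => ?_
  rw [hg.pd_symm hy d b c]
  ring

theorem smooth_christoffel (a b c : Fin n) : ContDiffAt ℝ ∞ (fun z => christoffel g z a b c) y := by
  simp only [christoffel]
  refine contDiffAt_const.mul (ContDiffAt.sum fun d _ => (hg.smooth_inv hy a d).mul ?_)
  exact ((contDiffAt_pd b (hg.smooth y hy d c)).add (contDiffAt_pd c (hg.smooth y hy d b))).sub
    (contDiffAt_pd d (hg.smooth y hy b c))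

theorem smooth_conn (c : Fin n) : SmoothEntries (conn g c) y :=
  fun a b => hg.smooth_christoffel hy a c b

theorem smooth_curv (c d : Fin n) : SmoothEntries (curv g c d) y :=
  ((((hg.smooth_conn hy d).mpd c).sub ((hg.smooth_conn hy c).mpd d)).add
    ((hg.smooth_conn hy c).mul (hg.smooth_conn hy d))).sub
    ((hg.smooth_conn hy d).mul (hg.smooth_conn hy c))

theorem smooth_riemann (a b c d : Fin n) : ContDiffAt ℝ ∞ (fun z => riemann g z a b c d) y := by
  simp only [riemann_eq_mul_curv]
  exact ((hg.smooth y hy).mul (hg.smooth_curv hy c d)) a b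

/-- Lowering the upper index removes the inverse metric and leaves the Christoffel symbols of the
first kind. -/
theorem mul_conn_apply (a b c : Fin n) : (g y * conn g c y) a b
    = (1 / 2) * (pd c (fun z => g z a b) y + pd b (fun z => g z a c) y
      - pd a (fun z => g z c b) y) := by
  simp only [Matrix.mul_apply, conn, Matrix.of_apply, christoffel]
  set w : Fin n → ℝ := fun d =>
    pd c (fun z => g z d b) y + pd b (fun z => g z d c) y - pd d (fun z => g z c b) y with hw
  have : ∑ e, g y a e * ((1 / 2) * ∑ d, (g y)⁻¹ e d * w d)
      = (1 / 2) * ((g y * (g y)⁻¹).mulVec w) a := by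
    rw [← Matrix.mulVec_mulVec]
    simp only [Matrix.mulVec, dotProduct, Finset.mul_sum]
    exact Finset.sum_congr rfl fun e _ => Finset.sum_congr rfl fun d _ => by ring
  rw [this, hg.mul_inv hy, Matrix.one_mulVec]

/-- Metric compatibility ∇g = 0, in matrix form. -/
theorem mpd_metric (c : Fin n) :
    mpd c g y = g y * conn g c y + (conn g c y).transpose * g y := by
  have h : (conn g c y).transpose * g y = (g y * conn g c y).transpose := by
    rw [Matrix.transpose_mul, hg.symm y hy]
  rw [h]
  ext a b
  rw [Matrix.add_apply, Matrix.transpose_apply, hg.mul_conn_apply hy, hg.mul_conn_apply hy]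
  simp only [mpd, Matrix.of_apply]
  rw [hg.pd_symm hy c b a, hg.pd_symm hy a b c, hg.pd_symm hy b a c]
  ring

/-- Obtained by differentiating g⁻¹ g = 1; it says ∇(g⁻¹) = 0. -/
theorem mpd_inv (c : Fin n) : mpd c (fun z => (g z)⁻¹) y
    = - (conn g c y * (g y)⁻¹) - (g y)⁻¹ * (conn g c y).transpose := by
  have h₁ : mpd c (fun z => (g z)⁻¹ * g z) y = 0 := by
    rw [mpd_congr c (N := fun _ => 1) ((hg.eventually_mem hy).mono fun z hz => hg.inv_mul hz)]
    ext a b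
    exact pd_const c _
  rw [mpd_mul c (hg.smooth_inv hy) (hg.smooth y hy), hg.mpd_metric hy] at h₁
  have h₂ := congrArg (fun M => M * (g y)⁻¹) h₁
  simp only [Matrix.add_mul, Matrix.mul_add, Matrix.mul_assoc, hg.mul_inv hy, Matrix.mul_one,
    Matrix.zero_mul] at h₂
  rw [← Matrix.mul_assoc (g y)⁻¹ (g y), hg.inv_mul hy, Matrix.one_mul] at h₂
  rw [eq_sub_iff_add_eq, eq_neg_iff_add_eq_zero]
  rw [← h₂]
  abel

/-- The curvature endomorphisms are skew-adjoint. -/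
theorem mul_curv_transpose (c d : Fin n) :
    (g y * curv g c d y).transpose = - (g y * curv g c d y) := by
  have key : ∀ c d : Fin n, mpd d (fun z => mpd c g z) y
      = (g y * conn g d y + (conn g d y).transpose * g y) * conn g c y
        + g y * mpd d (conn g c) y + ((mpd d (conn g c) y).transpose * g y
        + (conn g c y).transpose * (g y * conn g d y + (conn g d y).transpose * g y)) := by
    intro c d
    rw [mpd_congr d ((hg.eventually_mem hy).mono fun z hz => hg.mpd_metric hz c),
      mpd_add d ((hg.smooth y hy).mul (hg.smooth_conn hy c))
        ((hg.smooth_conn hy c).transpose.mul (hg.smooth y hy)),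
      mpd_mul d (hg.smooth y hy) (hg.smooth_conn hy c),
      mpd_mul d (hg.smooth_conn hy c).transpose (hg.smooth y hy), mpd_transpose,
      hg.mpd_metric hy]
  -- The compatibility ∇g = 0, differentiated once more and antisymmetrized in c and d, has no
  -- second derivatives of g left; what remains is the skew-adjointness.
  have h := mpd_comm c d (hg.smooth y hy)
  rw [key, key] at h
  have hs := hg.symm y hy
  rw [eq_neg_iff_add_eq_zero, Matrix.transpose_mul, hs]
  simp only [curv, Matrix.transpose_sub, Matrix.transpose_add, Matrix.transpose_mul]
  rw [← sub_eq_zero] at h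
  rw [← h]
  noncomm_ring

/-- The first Bianchi identity. -/
theorem curv_cyclic (a b c d : Fin n) :
    curv g c d y a b + curv g d b y a c + curv g b c y a d = 0 := by
  have hp : ∀ i a b c, pd i (fun z => christoffel g z a b c) y
      = pd i (fun z => christoffel g z a c b) y := fun i a b c =>
    pd_congr i ((hg.eventually_mem hy).mono fun z hz => hg.christoffel_symm hz a b c)
  simp only [← riemannUp_eq_curv, riemannUp]
  rw [hp c a d b, hp d a c b, hp b a d c]
  simp only [hg.christoffel_symm hy _ d b, hg.christoffel_symm hy _ c b,
    hg.christoffel_symm hy _ d c, Finset.sum_sub_distrib]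
  ring

/-- The second Bianchi identity. -/
theorem curv_bianchi (m c d : Fin n) :
    (mpd m (curv g c d) y + conn g m y * curv g c d y - curv g c d y * conn g m y)
    + (mpd c (curv g d m) y + conn g c y * curv g d m y - curv g d m y * conn g c y)
    + (mpd d (curv g m c) y + conn g d y * curv g m c y - curv g m c y * conn g d y) = 0 := by
  have key : ∀ m c d : Fin n, mpd m (curv g c d) y
      = mpd m (fun z => mpd c (conn g d) z) y - mpd m (fun z => mpd d (conn g c) z) y
        + (mpd m (conn g c) y * conn g d y + conn g c y * mpd m (conn g d) y)
        - (mpd m (conn g d) y * conn g c y + conn g d y * mpd m (conn g c) y) := by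
    intro m c d
    have sc := hg.smooth_conn hy c
    have sd := hg.smooth_conn hy d
    rw [show curv g c d = fun z => mpd c (conn g d) z - mpd d (conn g c) z
        + conn g c z * conn g d z - conn g d z * conn g c z from rfl,
      mpd_sub m (((sd.mpd c).sub (sc.mpd d)).add (sc.mul sd)) (sd.mul sc),
      mpd_add m ((sd.mpd c).sub (sc.mpd d)) (sc.mul sd),
      mpd_sub m (sd.mpd c) (sc.mpd d), mpd_mul m sc sd, mpd_mul m sd sc]
  -- Second derivatives of the connection cancel in the cyclic sum by symmetry of mixed partials.
  -- The rest is an identity in the noncommutative ring of matrices, the Jacobi identity included.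
  rw [key, key, key, mpd_comm m c (hg.smooth_conn hy d), mpd_comm m d (hg.smooth_conn hy c),
    mpd_comm d c (hg.smooth_conn hy m)]
  simp only [curv]
  noncomm_ring

end IsMetricOn

end LeviCivita

end SuperEnergy

/-! ### Covariant derivatives of the curvature and of the Hessian -/

namespace SuperEnergy

/-- The covariant derivative `∇_m R_{abcd}` of the curvature tensor. -/
noncomputable def covRiemann {n : ℕ} (g : Coord n → Matrix (Fin n) (Fin n) ℝ) (y : Coord n)
    (m a b c d : Fin n) : ℝ :=
  pd m (fun z => riemann g z a b c d) y - ∑ e, christoffel g y e m a * riemann g y e b c d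
    - ∑ e, christoffel g y e m b * riemann g y a e c d
    - ∑ e, christoffel g y e m c * riemann g y a b e d
    - ∑ e, christoffel g y e m d * riemann g y a b c e

/-- The third covariant derivative `∇_m ∇_i ∇_j φ` of a function. -/
noncomputable def covHess {n : ℕ} (g : Coord n → Matrix (Fin n) (Fin n) ℝ) (φ : Coord n → ℝ)
    (y : Coord n) (m i j : Fin n) : ℝ :=
  pd m (fun z => hess g φ z i j) y - ∑ e, christoffel g y e m i * hess g φ y e j
    - ∑ e, christoffel g y e m j * hess g φ y i e

namespace IsMetricOn

variable {n : ℕ} {g : Coord n → Matrix (Fin n) (Fin n) ℝ} {U : Set (Coord n)} {y : Coord n}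
variable (hg : IsMetricOn g U) (hy : y ∈ U)
include hg hy

theorem riemann_antisymm_left (a b c d : Fin n) : riemann g y a b c d = - riemann g y b a c d := by
  simp only [riemann_eq_mul_curv]
  exact congrFun (congrFun (hg.mul_curv_transpose hy c d) b) a

omit hg hy in
theorem riemann_antisymm_right (a b c d : Fin n) :
    riemann g y a b c d = - riemann g y a b d c := by
  simp only [riemann_eq_mul_curv]
  rw [curv_swap]
  simp

theorem riemann_cyclic (a b c d : Fin n) :
    riemann g y a b c d + riemann g y a c d b + riemann g y a d b c = 0 := by
  simp only [riemann, riemannUp_eq_curv]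
  rw [← Finset.sum_add_distrib, ← Finset.sum_add_distrib]
  refine Finset.sum_eq_zero fun e _ => ?_
  rw [← mul_add, ← mul_add, hg.curv_cyclic hy e b c d, mul_zero]

theorem curvatureSymm_riemann : CurvatureSymm (riemann g y) where
  antisymm_left := hg.riemann_antisymm_left hy
  pair a b c d := by
    have l := hg.riemann_antisymm_left hy
    have r := riemann_antisymm_right (g := g) (y := y)
    -- The octahedron argument: four instances of the first Bianchi identity combine, with
    -- antisymmetry in each pair, to the exchange of pairs.
    have c₁ := hg.riemann_cyclic hy a b c d
    have c₂ := hg.riemann_cyclic hy b c d a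
    have c₃ := hg.riemann_cyclic hy c d a b
    have c₄ := hg.riemann_cyclic hy d a b c
    linarith [l a b c d, l a c d b, l a d b c, l b c d a, l b d a c, l b a c d, l c d a b,
      l c a b d, l c b d a, l d a b c, l d b c a, l d c a b, r a b c d, r a c d b, r a d b c,
      r b c d a, r b d a c, r b a c d, r c d a b, r c a b d, r c b d a, r d a b c, r d b c a,
      r d c a b]

theorem smooth_ricci (b d : Fin n) : ContDiffAt ℝ ∞ (fun z => ricci g z b d) y := by
  simp only [ricci, riemannUp_eq_curv]
  exact ContDiffAt.sum fun a _ => hg.smooth_curv hy a d a b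

theorem smooth_scalarCurvature : ContDiffAt ℝ ∞ (fun z => scalarCurvature g z) y := by
  simp only [scalarCurvature]
  exact ContDiffAt.sum fun a _ => ContDiffAt.sum fun b _ =>
    (hg.smooth_inv hy a b).mul (hg.smooth_ricci hy a b)

theorem ricci_eq_sum_riemann (b d : Fin n) :
    ricci g y b d = ∑ a, ∑ a', (g y)⁻¹ a a' * riemann g y a b a' d := by
  have : ∀ a', riemannUp g y a' b a' d = ∑ a, (g y)⁻¹ a a' * riemann g y a b a' d := by
    intro a'
    have h : ((g y)⁻¹ * (g y * curv g a' d y)) a' b = curv g a' d y a' b := by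
      rw [← Matrix.mul_assoc, hg.inv_mul hy, Matrix.one_mul]
    rw [riemannUp_eq_curv, ← h, Matrix.mul_apply]
    exact Finset.sum_congr rfl fun a _ => by
      rw [riemann_eq_mul_curv, hg.inv_symm_apply hy]
  rw [ricci, Finset.sum_comm]
  exact Finset.sum_congr rfl fun a' _ => this a'

theorem curvatureSymm_covRiemann (m : Fin n) : CurvatureSymm (covRiemann g y m) where
  antisymm_left a b c d := by
    have h := pd_congr m (((hg.eventually_mem hy).mono fun z hz =>
      (hg.curvatureSymm_riemann hz).antisymm_left a b c d))
    have h' : pd m (fun z => - riemann g z b a c d) y = - pd m (fun z => riemann g z b a c d) y := by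
      simp [pd, fderiv_fun_neg]
    simp only [covRiemann]
    rw [h, h']
    have s := (hg.curvatureSymm_riemann hy).antisymm_left
    rw [Finset.sum_congr rfl fun e _ => by rw [s e b c d],
      Finset.sum_congr (f := fun e => christoffel g y e m b * riemann g y a e c d) rfl
        fun e _ => by rw [s a e c d],
      Finset.sum_congr (f := fun e => christoffel g y e m c * riemann g y a b e d) rfl
        fun e _ => by rw [s a b e d],
      Finset.sum_congr (f := fun e => christoffel g y e m d * riemann g y a b c e) rfl
        fun e _ => by rw [s a b c e]]
    simp only [mul_neg, Finset.sum_neg_distrib]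
    ring
  pair a b c d := by
    have h := pd_congr m (((hg.eventually_mem hy).mono fun z hz =>
      (hg.curvatureSymm_riemann hz).pair a b c d))
    simp only [covRiemann]
    rw [h]
    have s := (hg.curvatureSymm_riemann hy).pair
    rw [Finset.sum_congr rfl fun e _ => by rw [s e b c d],
      Finset.sum_congr (f := fun e => christoffel g y e m b * riemann g y a e c d) rfl
        fun e _ => by rw [s a e c d],
      Finset.sum_congr (f := fun e => christoffel g y e m c * riemann g y a b e d) rfl
        fun e _ => by rw [s a b e d],
      Finset.sum_congr (f := fun e => christoffel g y e m d * riemann g y a b c e) rfl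
        fun e _ => by rw [s a b c e]]
    ring

/-- The connection terms for the two endomorphism slots assemble into a commutator with the
connection matrix, metric compatibility absorbing the derivative of the lowering factor. Only the
form slots c and d keep explicit Christoffel terms. -/
theorem covRiemann_eq (m a b c d : Fin n) : covRiemann g y m a b c d
    = (g y * (mpd m (curv g c d) y + conn g m y * curv g c d y - curv g c d y * conn g m y)) a b
      - ∑ e, christoffel g y e m c * riemann g y a b e d
      - ∑ e, christoffel g y e m d * riemann g y a b c e := by
  have h₁ : pd m (fun z => riemann g z a b c d) y
      = mpd m (fun z => g z * curv g c d z) y a b := by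
    simp only [riemann_eq_mul_curv]
    rfl
  have h₂ : ∑ e, christoffel g y e m a * riemann g y e b c d
      = ((conn g m y).transpose * (g y * curv g c d y)) a b := by
    rw [Matrix.mul_apply]
    exact Finset.sum_congr rfl fun e _ => by rw [riemann_eq_mul_curv]; rfl
  have h₃ : ∑ e, christoffel g y e m b * riemann g y a e c d
      = ((g y * curv g c d y) * conn g m y) a b := by
    rw [Matrix.mul_apply]
    exact Finset.sum_congr rfl fun e _ => by rw [riemann_eq_mul_curv, mul_comm]; rfl
  rw [covRiemann, h₁, h₂, h₃, mpd_mul m (hg.smooth y hy) (hg.smooth_curv hy c d),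
    hg.mpd_metric hy]
  simp only [← Matrix.sub_apply]
  congr 4
  noncomm_ring

/-- The second Bianchi identity for the covariant derivative of the curvature tensor. -/
theorem covRiemann_cyclic (m a b c d : Fin n) :
    covRiemann g y m a b c d + covRiemann g y a b m c d + covRiemann g y b m a c d = 0 := by
  -- The cyclic sum runs over m and the first index pair, whereas `curv_bianchi` cycles through the
  -- form indices; exchanging the pairs reconciles them.
  rw [(hg.curvatureSymm_covRiemann hy m).pair, (hg.curvatureSymm_covRiemann hy a).pair,
    (hg.curvatureSymm_covRiemann hy b).pair, hg.covRiemann_eq hy, hg.covRiemann_eq hy,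
    hg.covRiemann_eq hy]
  have h : ∀ A B C : Matrix (Fin n) (Fin n) ℝ, A + B + C = 0 →
      (g y * A) c d + (g y * B) c d + (g y * C) c d = 0 := by
    intro A B C h
    rw [← Matrix.add_apply, ← Matrix.add_apply, ← Matrix.mul_add, ← Matrix.mul_add, h,
      Matrix.mul_zero, Matrix.zero_apply]
  have h := h _ _ _ (hg.curv_bianchi hy m a b)
  -- Symmetry of the Christoffel symbols and antisymmetry in the form slots make the explicit
  -- Christoffel terms cancel pairwise around the cycle.
  have s : ∀ p q r : Fin n, ∑ e, christoffel g y e p q * riemann g y c d e r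
      = - ∑ e, christoffel g y e q p * riemann g y c d r e := by
    intro p q r
    rw [← Finset.sum_neg_distrib]
    refine Finset.sum_congr rfl fun e _ => ?_
    rw [hg.christoffel_symm hy, riemann_antisymm_right]
    ring
  rw [s m a b, s a b m, s b m a]
  linarith

section Function

variable {φ : Coord n → ℝ} (hφ : ∀ z ∈ U, ContDiffAt ℝ ∞ φ z)
include hφ

theorem hess_symm (i j : Fin n) : hess g φ y i j = hess g φ y j i := by
  simp only [hess]
  rw [pd_comm i j (hφ y hy)]
  simp only [hg.christoffel_symm hy _ i j]

theorem smooth_hess (i j : Fin n) : ContDiffAt ℝ ∞ (fun z => hess g φ z i j) y := by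
  simp only [hess]
  exact (contDiffAt_pd i (contDiffAt_pd j (hφ y hy))).sub (ContDiffAt.sum fun c _ =>
    (hg.smooth_christoffel hy c i j).mul (contDiffAt_pd c (hφ y hy)))

theorem covHess_symm (m i j : Fin n) : covHess g φ y m i j = covHess g φ y m j i := by
  have h := pd_congr m (((hg.eventually_mem hy).mono fun z hz =>
      hg.hess_symm hz hφ i j))
  simp only [covHess]
  rw [h]
  have s := hg.hess_symm hy hφ
  rw [Finset.sum_congr rfl fun e _ => by rw [s e j],
    Finset.sum_congr (f := fun e => christoffel g y e m j * hess g φ y i e) rfl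
      fun e _ => by rw [s i e]]
  ring

/-- The Ricci identity for the gradient of a function. -/
theorem covHess_comm (k i j : Fin n) : covHess g φ y k i j - covHess g φ y i k j
    = - ∑ l, riemannUp g y l j k i * pd l φ y := by
  have hd : ∀ i j, ∀ k, pd k (fun z => hess g φ z i j) y
      = pd k (fun z => pd i (fun w => pd j φ w) z) y
        - ∑ c, (pd k (fun z => christoffel g z c i j) y * pd c φ y
          + christoffel g y c i j * pd k (fun z => pd c φ z) y) := by
    intro i j k
    have d₁ : ∀ c, DifferentiableAt ℝ (fun z => christoffel g z c i j) y :=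
      fun c => (hg.smooth_christoffel hy c i j).differentiableAt (by simp)
    have d₂ : ∀ c, DifferentiableAt ℝ (fun z => pd c φ z) y :=
      fun c => (contDiffAt_pd c (hφ y hy)).differentiableAt (by simp)
    simp only [hess]
    rw [pd_sub (f := fun z => pd i (fun w => pd j φ w) z)
      (f' := fun z => ∑ c, christoffel g z c i j * pd c φ z) k
      ((contDiffAt_pd i (contDiffAt_pd j (hφ y hy))).differentiableAt (by simp))
      (DifferentiableAt.fun_sum fun c _ => (d₁ c).mul (d₂ c)),
      pd_sum k Finset.univ (F := fun c z => christoffel g z c i j * pd c φ z)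
        (fun c _ => (d₁ c).mul (d₂ c))]
    congr 1
    exact Finset.sum_congr rfl fun c _ => pd_mul k (d₁ c) (d₂ c)
  -- The third partial derivatives of φ drop out of the commutator.
  have hc := pd_comm k i (contDiffAt_pd j (hφ y hy))
  have e₁ : ∀ k i, ∑ e, christoffel g y e k i * hess g φ y e j
      = ∑ e, christoffel g y e i k * hess g φ y e j := fun k i =>
    Finset.sum_congr rfl fun e _ => by rw [hg.christoffel_symm hy]
  have e₂ : ∀ k i, ∑ e, christoffel g y e k j * hess g φ y i e
      = ∑ e, christoffel g y e k j * pd i (fun z => pd e φ z) y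
        - ∑ l, (∑ e, christoffel g y l i e * christoffel g y e k j) * pd l φ y := by
    intro k i
    simp only [hess, mul_sub, Finset.sum_sub_distrib, Finset.mul_sum, Finset.sum_mul]
    congr 1
    rw [Finset.sum_comm]
    exact Finset.sum_congr rfl fun l _ => Finset.sum_congr rfl fun e _ => by ring
  have e₃ : ∑ l, riemannUp g y l j k i * pd l φ y
      = ∑ l, pd k (fun z => christoffel g z l i j) y * pd l φ y
        - ∑ l, pd i (fun z => christoffel g z l k j) y * pd l φ y
        + (∑ l, (∑ e, christoffel g y l k e * christoffel g y e i j) * pd l φ y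
        - ∑ l, (∑ e, christoffel g y l i e * christoffel g y e k j) * pd l φ y) := by
    simp only [← Finset.sum_sub_distrib, ← Finset.sum_add_distrib]
    refine Finset.sum_congr rfl fun l _ => ?_
    simp only [riemannUp, Finset.sum_sub_distrib]
    ring
  simp only [covHess]
  rw [hd, hd, e₁ k i, e₂ k i, e₂ i k, e₃]
  simp only [Finset.sum_add_distrib]
  have hc' : pd k (fun z => pd i (fun w => pd j φ w) z) y
      = pd i (fun z => pd k (fun w => pd j φ w) z) y := hc
  rw [hc']
  ring

end Function

end IsMetricOn

end SuperEnergy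

namespace SuperEnergy

/-! ### Multilinear extensions of component arrays -/

section Multilinear

variable {n : ℕ}

/-- The linear form with components `θ`. -/
def ev1 (θ : Fin n → ℝ) (u : Fin n → ℝ) : ℝ := ∑ a, u a * θ a

/-- The bilinear form with components `h`. -/
def ev2 (h : Fin n → Fin n → ℝ) (u v : Fin n → ℝ) : ℝ := ∑ a, u a * ev1 (h a) v

/-- The trilinear form with components `T`. -/
def ev3 (T : Fin n → Fin n → Fin n → ℝ) (u v w : Fin n → ℝ) : ℝ := ∑ a, u a * ev2 (T a) v w

/-- The quadrilinear form with components `R`. -/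
def ev4 (R : Fin n → Fin n → Fin n → Fin n → ℝ) (u v w z : Fin n → ℝ) : ℝ :=
  ∑ a, u a * ev3 (R a) v w z

/-- The contraction of a two-index array with the matrix `M`. -/
def contr (M : Matrix (Fin n) (Fin n) ℝ) (Z : Fin n → Fin n → ℝ) : ℝ := ∑ i, ∑ j, M i j * Z i j

/-- The standard basis vectors. -/
def stdVec (a : Fin n) : Fin n → ℝ := Pi.single a 1

/-- The columns of a matrix. -/
def colVec (P : Matrix (Fin n) (Fin n) ℝ) (i : Fin n) : Fin n → ℝ := fun a => P a i

theorem sum_stdVec (a : Fin n) (f : Fin n → ℝ) : ∑ b, stdVec a b * f b = f a := by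
  simp [stdVec, Pi.single_apply]

theorem ev1_stdVec (θ : Fin n → ℝ) (a : Fin n) : ev1 θ (stdVec a) = θ a := sum_stdVec a _

theorem ev2_stdVec (h : Fin n → Fin n → ℝ) (a b : Fin n) : ev2 h (stdVec a) (stdVec b) = h a b := by
  rw [ev2, sum_stdVec, ev1_stdVec]

theorem ev3_stdVec (T : Fin n → Fin n → Fin n → ℝ) (a b c : Fin n) :
    ev3 T (stdVec a) (stdVec b) (stdVec c) = T a b c := by
  rw [ev3, sum_stdVec, ev2_stdVec]

theorem ev4_stdVec (R : Fin n → Fin n → Fin n → Fin n → ℝ) (a b c d : Fin n) :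
    ev4 R (stdVec a) (stdVec b) (stdVec c) (stdVec d) = R a b c d := by
  rw [ev4, sum_stdVec, ev3_stdVec]

theorem contr_congr {M : Matrix (Fin n) (Fin n) ℝ} {Z Z' : Fin n → Fin n → ℝ}
    (h : ∀ i j, Z i j = Z' i j) : contr M Z = contr M Z' := by
  simp only [contr, h]

section Lin

variable {f f' : (Fin n → ℝ) → ℝ}

theorem isLinearMap_add (hf : IsLinearMap ℝ f) (hf' : IsLinearMap ℝ f') :
    IsLinearMap ℝ fun u => f u + f' u :=
  ⟨fun x y => by rw [hf.map_add, hf'.map_add]; ring,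
    fun c x => by rw [hf.map_smul, hf'.map_smul, smul_eq_mul, smul_eq_mul, smul_eq_mul]; ring⟩

theorem isLinearMap_sub (hf : IsLinearMap ℝ f) (hf' : IsLinearMap ℝ f') :
    IsLinearMap ℝ fun u => f u - f' u :=
  ⟨fun x y => by rw [hf.map_add, hf'.map_add]; ring,
    fun c x => by rw [hf.map_smul, hf'.map_smul, smul_eq_mul, smul_eq_mul, smul_eq_mul]; ring⟩

theorem isLinearMap_mul_const (hf : IsLinearMap ℝ f) (c : ℝ) : IsLinearMap ℝ fun u => f u * c :=
  ⟨fun x y => by rw [hf.map_add]; ring,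
    fun c x => by rw [hf.map_smul, smul_eq_mul, smul_eq_mul]; ring⟩

theorem isLinearMap_const_mul (c : ℝ) (hf : IsLinearMap ℝ f) : IsLinearMap ℝ fun u => c * f u :=
  ⟨fun x y => by rw [hf.map_add]; ring,
    fun c x => by rw [hf.map_smul, smul_eq_mul, smul_eq_mul]; ring⟩

theorem isLinearMap_sum {F : Fin n → (Fin n → ℝ) → ℝ} (hF : ∀ i, IsLinearMap ℝ (F i)) :
    IsLinearMap ℝ fun u => ∑ i, F i u :=
  ⟨fun x y => by simp only [(hF _).map_add, Finset.sum_add_distrib],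
    fun c x => by simp only [(hF _).map_smul, Finset.smul_sum]⟩

theorem isLinearMap_contr (M : Matrix (Fin n) (Fin n) ℝ) {F : Fin n → Fin n → (Fin n → ℝ) → ℝ}
    (hF : ∀ i j, IsLinearMap ℝ (F i j)) : IsLinearMap ℝ fun u => contr M fun i j => F i j u :=
  isLinearMap_sum fun i => isLinearMap_sum fun j => isLinearMap_const_mul _ (hF i j)

theorem isLinearMap_sum_coord (f : Fin n → ℝ) : IsLinearMap ℝ fun u : Fin n → ℝ => ∑ a, u a * f a :=
  isLinearMap_sum fun _ => isLinearMap_mul_const ⟨fun _ _ => rfl, fun _ _ => rfl⟩ _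

theorem isLinearMap_ev1 (θ : Fin n → ℝ) : IsLinearMap ℝ fun u => ev1 θ u :=
  isLinearMap_sum_coord _

theorem isLinearMap_ev2_left (h : Fin n → Fin n → ℝ) (v) : IsLinearMap ℝ fun u => ev2 h u v :=
  isLinearMap_sum_coord _

theorem isLinearMap_ev2_right (h : Fin n → Fin n → ℝ) (u) : IsLinearMap ℝ fun v => ev2 h u v :=
  isLinearMap_sum fun _ => isLinearMap_const_mul _ (isLinearMap_ev1 _)

theorem isLinearMap_ev4_first (R : Fin n → Fin n → Fin n → Fin n → ℝ) (v w z) :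
    IsLinearMap ℝ fun u => ev4 R u v w z :=
  isLinearMap_sum_coord _

theorem isLinearMap_ev4_second (R : Fin n → Fin n → Fin n → Fin n → ℝ) (u w z) :
    IsLinearMap ℝ fun v => ev4 R u v w z :=
  isLinearMap_sum fun _ => isLinearMap_const_mul _ (isLinearMap_sum_coord _)

theorem isLinearMap_ev4_third (R : Fin n → Fin n → Fin n → Fin n → ℝ) (u v z) :
    IsLinearMap ℝ fun w => ev4 R u v w z :=
  isLinearMap_sum fun _ => isLinearMap_const_mul _ (isLinearMap_sum fun _ =>
    isLinearMap_const_mul _ (isLinearMap_ev2_left _ _))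

theorem isLinearMap_ev4_fourth (R : Fin n → Fin n → Fin n → Fin n → ℝ) (u v w) :
    IsLinearMap ℝ fun z => ev4 R u v w z :=
  isLinearMap_sum fun _ => isLinearMap_const_mul _ (isLinearMap_sum fun _ =>
    isLinearMap_const_mul _ (isLinearMap_ev2_right _ _))

theorem sum_mul_stdVec (hf : IsLinearMap ℝ f) (u : Fin n → ℝ) :
    ∑ a, u a * f (stdVec a) = f u := by
  have hu : u = ∑ a, u a • (stdVec a : Fin n → ℝ) := by
    ext b
    simp [stdVec, Finset.sum_apply, Pi.single_apply]
  have h := map_sum (IsLinearMap.mk' f hf) (fun a => u a • (stdVec a : Fin n → ℝ)) Finset.univ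
  rw [← hu] at h
  simp only [IsLinearMap.mk'_apply] at h
  rw [h]
  exact Finset.sum_congr rfl fun a _ => by rw [hf.map_smul]; rfl

end Lin

/-- Contractions may be computed in any frame. -/
theorem contr_stdVec {Ginv P M : Matrix (Fin n) (Fin n) ℝ} (h : Ginv = P * M * P.transpose)
    {β : (Fin n → ℝ) → (Fin n → ℝ) → ℝ} (hl : ∀ v, IsLinearMap ℝ fun u => β u v)
    (hr : ∀ u, IsLinearMap ℝ fun v => β u v) :
    contr Ginv (fun r r' => β (stdVec r) (stdVec r'))
      = contr M (fun i j => β (colVec P i) (colVec P j)) := by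
  have h₁ : ∀ i j, β (colVec P i) (colVec P j)
      = ∑ r, ∑ r', P r i * (P r' j * β (stdVec r) (stdVec r')) := by
    intro i j
    rw [← sum_mul_stdVec (hl _)]
    refine Finset.sum_congr rfl fun r _ => ?_
    rw [← sum_mul_stdVec (hr _), Finset.mul_sum]
    rfl
  simp only [contr, h₁, h, Matrix.mul_apply, Matrix.transpose_apply, Finset.mul_sum,
    Finset.sum_mul]
  rw [Finset.sum_congr rfl fun r _ => Finset.sum_comm]
  rw [Finset.sum_comm]
  rw [Finset.sum_congr rfl fun j _ => Finset.sum_congr rfl fun r _ => Finset.sum_comm]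
  rw [Finset.sum_congr rfl fun j _ => Finset.sum_comm]
  rw [Finset.sum_comm]
  refine Finset.sum_congr rfl fun i _ => Finset.sum_congr rfl fun j _ =>
    Finset.sum_congr rfl fun r _ => Finset.sum_congr rfl fun r' _ => by ring

/-! ### The superenergy tensors in an arbitrary frame -/

/-- The Bel tensor, with contractions computed in the frame `b` with inverse Gram matrix `M`. -/
noncomputable def belForm (γ : (Fin n → ℝ) → (Fin n → ℝ) → ℝ) (M : Matrix (Fin n) (Fin n) ℝ)
    (b : Fin n → Fin n → ℝ)
    (R : (Fin n → ℝ) → (Fin n → ℝ) → (Fin n → ℝ) → (Fin n → ℝ) → ℝ) (u v w z : Fin n → ℝ) : ℝ :=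
  contr M (fun r r' => contr M fun s s' => R u (b r) w (b s) * R v (b r') z (b s'))
  + contr M (fun r r' => contr M fun s s' => R u (b r) z (b s) * R v (b r') w (b s'))
  - (1 / 2) * γ u v * contr M (fun r r' => contr M fun t t' => contr M fun s s' =>
      R (b r) (b t) w (b s) * R (b r') (b t') z (b s'))
  - (1 / 2) * γ w z * contr M (fun r r' => contr M fun s s' => contr M fun t t' =>
      R u (b r) (b s) (b t) * R v (b r') (b s') (b t'))
  + (1 / 8) * γ u v * γ w z * contr M (fun r r' => contr M fun t t' => contr M fun s s' =>
      contr M fun q q' => R (b r) (b t) (b s) (b q) * R (b r') (b t') (b s') (b q'))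

/-- The scalar superenergy tensor, with contractions computed in the frame `b` with inverse Gram
matrix `M`. -/
noncomputable def scalarForm (γ : (Fin n → ℝ) → (Fin n → ℝ) → ℝ) (M : Matrix (Fin n) (Fin n) ℝ)
    (b : Fin n → Fin n → ℝ) (h : (Fin n → ℝ) → (Fin n → ℝ) → ℝ) (u v w z : Fin n → ℝ) : ℝ :=
  h u w * h z v + h u z * h w v
  - γ u v * contr M (fun r r' => h w (b r) * h z (b r'))
  - γ w z * contr M (fun r r' => h u (b r) * h v (b r'))
  + (1 / 2) * γ u v * γ w z * contr M (fun s s' => contr M fun r r' =>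
      h (b s) (b r) * h (b s') (b r'))

theorem sum_four_eq_contr (M : Matrix (Fin n) (Fin n) ℝ) (f : Fin n → Fin n → Fin n → Fin n → ℝ) :
    ∑ r, ∑ r', ∑ s, ∑ s', M r r' * M s s' * f r r' s s'
      = contr M fun r r' => contr M fun s s' => f r r' s s' := by
  simp only [contr, Finset.mul_sum, mul_assoc]

theorem sum_six_eq_contr (M : Matrix (Fin n) (Fin n) ℝ)
    (f : Fin n → Fin n → Fin n → Fin n → Fin n → Fin n → ℝ) :
    ∑ r, ∑ r', ∑ s, ∑ s', ∑ t, ∑ t', M r r' * M s s' * M t t' * f r r' s s' t t'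
      = contr M fun r r' => contr M fun s s' => contr M fun t t' => f r r' s s' t t' := by
  simp only [contr, Finset.mul_sum, mul_assoc]

theorem sum_eight_eq_contr (M : Matrix (Fin n) (Fin n) ℝ)
    (f : Fin n → Fin n → Fin n → Fin n → Fin n → Fin n → Fin n → Fin n → ℝ) :
    ∑ r, ∑ r', ∑ s, ∑ s', ∑ t, ∑ t', ∑ q, ∑ q',
        M r r' * M s s' * M t t' * M q q' * f r r' s s' t t' q q'
      = contr M fun r r' => contr M fun s s' => contr M fun t t' => contr M fun q q' =>
        f r r' s s' t t' q q' := by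
  simp only [contr, Finset.mul_sum, mul_assoc]

theorem bel_eq_belForm (g : Coord n → Matrix (Fin n) (Fin n) ℝ) (y : Coord n) (a b l m : Fin n) :
    bel g y a b l m = belForm (ev2 fun i j => g y i j) (g y)⁻¹ stdVec (ev4 (riemann g y))
      (stdVec a) (stdVec b) (stdVec l) (stdVec m) := by
  simp only [bel, belForm, sum_four_eq_contr, sum_six_eq_contr, sum_eight_eq_contr, ev4_stdVec,
    ev2_stdVec]

theorem scalarSuperEnergy_eq_scalarForm (g : Coord n → Matrix (Fin n) (Fin n) ℝ) (φ : Coord n → ℝ)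
    (y : Coord n) (a b l m : Fin n) :
    scalarSuperEnergy g φ y a b l m = scalarForm (ev2 fun i j => g y i j) (g y)⁻¹ stdVec (ev2 (hess g φ y))
      (stdVec a) (stdVec b) (stdVec l) (stdVec m) := by
  simp only [scalarSuperEnergy, scalarForm, sum_four_eq_contr, ev2_stdVec]
  rfl

/-- A function of four vectors that is linear in each of them. -/
structure IsQuadrilinear (R : (Fin n → ℝ) → (Fin n → ℝ) → (Fin n → ℝ) → (Fin n → ℝ) → ℝ) :
    Prop where
  first (v w z) : IsLinearMap ℝ fun u => R u v w z
  second (u w z) : IsLinearMap ℝ fun v => R u v w z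
  third (u v z) : IsLinearMap ℝ fun w => R u v w z
  fourth (u v w) : IsLinearMap ℝ fun z => R u v w z

theorem isQuadrilinear_ev4 (R : Fin n → Fin n → Fin n → Fin n → ℝ) : IsQuadrilinear (ev4 R) :=
  ⟨isLinearMap_ev4_first R, isLinearMap_ev4_second R, isLinearMap_ev4_third R,
    isLinearMap_ev4_fourth R⟩

theorem IsQuadrilinear.add {R S : (Fin n → ℝ) → (Fin n → ℝ) → (Fin n → ℝ) → (Fin n → ℝ) → ℝ}
    (hR : IsQuadrilinear R) (hS : IsQuadrilinear S) :
    IsQuadrilinear fun u v w z => R u v w z + S u v w z :=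
  ⟨fun _ _ _ => isLinearMap_add (hR.first _ _ _) (hS.first _ _ _),
    fun _ _ _ => isLinearMap_add (hR.second _ _ _) (hS.second _ _ _),
    fun _ _ _ => isLinearMap_add (hR.third _ _ _) (hS.third _ _ _),
    fun _ _ _ => isLinearMap_add (hR.fourth _ _ _) (hS.fourth _ _ _)⟩

variable {γ : (Fin n → ℝ) → (Fin n → ℝ) → ℝ} {M Ginv P : Matrix (Fin n) (Fin n) ℝ}
  {b : Fin n → Fin n → ℝ} {R : (Fin n → ℝ) → (Fin n → ℝ) → (Fin n → ℝ) → (Fin n → ℝ) → ℝ}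
  {h : (Fin n → ℝ) → (Fin n → ℝ) → ℝ}

theorem isQuadrilinear_belForm (hγl : ∀ v, IsLinearMap ℝ fun u => γ u v)
    (hγr : ∀ u, IsLinearMap ℝ fun v => γ u v) (hR : IsQuadrilinear R) :
    IsQuadrilinear (belForm γ M b R) := by
  constructor
  · intro v w z
    refine isLinearMap_add (isLinearMap_sub (isLinearMap_sub (isLinearMap_add ?_ ?_) ?_) ?_) ?_
    · exact isLinearMap_contr _ fun _ _ => isLinearMap_contr _ fun _ _ =>
        isLinearMap_mul_const (hR.first _ _ _) _
    · exact isLinearMap_contr _ fun _ _ => isLinearMap_contr _ fun _ _ =>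
        isLinearMap_mul_const (hR.first _ _ _) _
    · exact isLinearMap_mul_const (isLinearMap_const_mul _ (hγl _)) _
    · exact isLinearMap_const_mul _ (isLinearMap_contr _ fun _ _ => isLinearMap_contr _ fun _ _ =>
        isLinearMap_contr _ fun _ _ => isLinearMap_mul_const (hR.first _ _ _) _)
    · exact isLinearMap_mul_const (isLinearMap_mul_const (isLinearMap_const_mul _ (hγl _)) _) _
  · intro u w z
    refine isLinearMap_add (isLinearMap_sub (isLinearMap_sub (isLinearMap_add ?_ ?_) ?_) ?_) ?_
    · exact isLinearMap_contr _ fun _ _ => isLinearMap_contr _ fun _ _ =>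
        isLinearMap_const_mul _ (hR.first _ _ _)
    · exact isLinearMap_contr _ fun _ _ => isLinearMap_contr _ fun _ _ =>
        isLinearMap_const_mul _ (hR.first _ _ _)
    · exact isLinearMap_mul_const (isLinearMap_const_mul _ (hγr _)) _
    · exact isLinearMap_const_mul _ (isLinearMap_contr _ fun _ _ => isLinearMap_contr _ fun _ _ =>
        isLinearMap_contr _ fun _ _ => isLinearMap_const_mul _ (hR.first _ _ _))
    · exact isLinearMap_mul_const (isLinearMap_mul_const (isLinearMap_const_mul _ (hγr _)) _) _
  · intro u v z
    refine isLinearMap_add (isLinearMap_sub (isLinearMap_sub (isLinearMap_add ?_ ?_) ?_) ?_) ?_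
    · exact isLinearMap_contr _ fun _ _ => isLinearMap_contr _ fun _ _ =>
        isLinearMap_mul_const (hR.third _ _ _) _
    · exact isLinearMap_contr _ fun _ _ => isLinearMap_contr _ fun _ _ =>
        isLinearMap_const_mul _ (hR.third _ _ _)
    · exact isLinearMap_const_mul _ (isLinearMap_contr _ fun _ _ => isLinearMap_contr _ fun _ _ =>
        isLinearMap_contr _ fun _ _ => isLinearMap_mul_const (hR.third _ _ _) _)
    · exact isLinearMap_mul_const (isLinearMap_const_mul _ (hγl _)) _
    · exact isLinearMap_mul_const (isLinearMap_const_mul _ (hγl _)) _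
  -- The last argument of the Bel form sits in the third slot of a curvature factor, just as its
  -- third argument does.
  · intro u v w
    refine isLinearMap_add (isLinearMap_sub (isLinearMap_sub (isLinearMap_add ?_ ?_) ?_) ?_) ?_
    · exact isLinearMap_contr _ fun _ _ => isLinearMap_contr _ fun _ _ =>
        isLinearMap_const_mul _ (hR.third _ _ _)
    · exact isLinearMap_contr _ fun _ _ => isLinearMap_contr _ fun _ _ =>
        isLinearMap_mul_const (hR.third _ _ _) _
    · exact isLinearMap_const_mul _ (isLinearMap_contr _ fun _ _ => isLinearMap_contr _ fun _ _ =>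
        isLinearMap_contr _ fun _ _ => isLinearMap_const_mul _ (hR.third _ _ _))
    · exact isLinearMap_mul_const (isLinearMap_const_mul _ (hγr _)) _
    · exact isLinearMap_mul_const (isLinearMap_const_mul _ (hγr _)) _

theorem isQuadrilinear_scalarForm (hγl : ∀ v, IsLinearMap ℝ fun u => γ u v)
    (hγr : ∀ u, IsLinearMap ℝ fun v => γ u v) (hl : ∀ v, IsLinearMap ℝ fun u => h u v)
    (hr : ∀ u, IsLinearMap ℝ fun v => h u v) :
    IsQuadrilinear (scalarForm γ M b h) := by
  constructor
  · intro v w z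
    refine isLinearMap_add (isLinearMap_sub (isLinearMap_sub (isLinearMap_add ?_ ?_) ?_) ?_) ?_
    · exact isLinearMap_mul_const (hl _) _
    · exact isLinearMap_mul_const (hl _) _
    · exact isLinearMap_mul_const (hγl _) _
    · exact isLinearMap_const_mul _ (isLinearMap_contr _ fun _ _ => isLinearMap_mul_const (hl _) _)
    · exact isLinearMap_mul_const (isLinearMap_mul_const (isLinearMap_const_mul _ (hγl _)) _) _
  · intro u w z
    refine isLinearMap_add (isLinearMap_sub (isLinearMap_sub (isLinearMap_add ?_ ?_) ?_) ?_) ?_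
    · exact isLinearMap_const_mul _ (hr _)
    · exact isLinearMap_const_mul _ (hr _)
    · exact isLinearMap_mul_const (hγr _) _
    · exact isLinearMap_const_mul _ (isLinearMap_contr _ fun _ _ => isLinearMap_const_mul _ (hl _))
    · exact isLinearMap_mul_const (isLinearMap_mul_const (isLinearMap_const_mul _ (hγr _)) _) _
  · intro u v z
    refine isLinearMap_add (isLinearMap_sub (isLinearMap_sub (isLinearMap_add ?_ ?_) ?_) ?_) ?_
    · exact isLinearMap_mul_const (hr _) _
    · exact isLinearMap_const_mul _ (hl _)
    · exact isLinearMap_const_mul _ (isLinearMap_contr _ fun _ _ => isLinearMap_mul_const (hl _) _)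
    · exact isLinearMap_mul_const (hγl _) _
    · exact isLinearMap_mul_const (isLinearMap_const_mul _ (hγl _)) _
  · intro u v w
    refine isLinearMap_add (isLinearMap_sub (isLinearMap_sub (isLinearMap_add ?_ ?_) ?_) ?_) ?_
    · exact isLinearMap_const_mul _ (hl _)
    · exact isLinearMap_mul_const (hr _) _
    · exact isLinearMap_const_mul _ (isLinearMap_contr _ fun _ _ => isLinearMap_const_mul _ (hl _))
    · exact isLinearMap_mul_const (hγr _) _
    · exact isLinearMap_mul_const (isLinearMap_const_mul _ (hγr _)) _

/-- The Bel tensor does not depend on the frame. -/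
theorem belForm_stdVec (hM : Ginv = P * M * P.transpose) (hR : IsQuadrilinear R) :
    belForm γ Ginv stdVec R = belForm γ M (colVec P) R := by
  have two : ∀ u v w z, contr Ginv (fun r r' => contr Ginv fun s s' =>
        R u (stdVec r) w (stdVec s) * R v (stdVec r') z (stdVec s'))
      = contr M (fun r r' => contr M fun s s' =>
        R u (colVec P r) w (colVec P s) * R v (colVec P r') z (colVec P s')) := by
    intro u v w z
    rw [contr_stdVec hM (β := fun p q => contr Ginv fun s s' =>
      R u p w (stdVec s) * R v q z (stdVec s'))
      (fun _ => isLinearMap_contr _ fun _ _ => isLinearMap_mul_const (hR.second _ _ _) _)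
      (fun _ => isLinearMap_contr _ fun _ _ => isLinearMap_const_mul _ (hR.second _ _ _))]
    exact contr_congr fun r r' => contr_stdVec hM (β := fun p q =>
      R u (colVec P r) w p * R v (colVec P r') z q)
      (fun _ => isLinearMap_mul_const (hR.fourth _ _ _) _)
      (fun _ => isLinearMap_const_mul _ (hR.fourth _ _ _))
  have three₁ : ∀ w z, contr Ginv (fun r r' => contr Ginv fun t t' => contr Ginv fun s s' =>
        R (stdVec r) (stdVec t) w (stdVec s) * R (stdVec r') (stdVec t') z (stdVec s'))
      = contr M (fun r r' => contr M fun t t' => contr M fun s s' =>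
        R (colVec P r) (colVec P t) w (colVec P s) *
          R (colVec P r') (colVec P t') z (colVec P s')) := by
    intro w z
    rw [contr_stdVec hM (β := fun p q => contr Ginv fun t t' => contr Ginv fun s s' =>
      R p (stdVec t) w (stdVec s) * R q (stdVec t') z (stdVec s'))
      (fun _ => isLinearMap_contr _ fun _ _ => isLinearMap_contr _ fun _ _ =>
        isLinearMap_mul_const (hR.first _ _ _) _)
      (fun _ => isLinearMap_contr _ fun _ _ => isLinearMap_contr _ fun _ _ =>
        isLinearMap_const_mul _ (hR.first _ _ _))]
    exact contr_congr fun r r' => two _ _ _ _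
  have three₂ : ∀ u v, contr Ginv (fun r r' => contr Ginv fun s s' => contr Ginv fun t t' =>
        R u (stdVec r) (stdVec s) (stdVec t) * R v (stdVec r') (stdVec s') (stdVec t'))
      = contr M (fun r r' => contr M fun s s' => contr M fun t t' =>
        R u (colVec P r) (colVec P s) (colVec P t) *
          R v (colVec P r') (colVec P s') (colVec P t')) := by
    intro u v
    rw [contr_stdVec hM (β := fun p q => contr Ginv fun s s' => contr Ginv fun t t' =>
      R u p (stdVec s) (stdVec t) * R v q (stdVec s') (stdVec t'))
      (fun _ => isLinearMap_contr _ fun _ _ => isLinearMap_contr _ fun _ _ =>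
        isLinearMap_mul_const (hR.second _ _ _) _)
      (fun _ => isLinearMap_contr _ fun _ _ => isLinearMap_contr _ fun _ _ =>
        isLinearMap_const_mul _ (hR.second _ _ _))]
    refine contr_congr fun r r' => ?_
    rw [contr_stdVec hM (β := fun p q => contr Ginv fun t t' =>
      R u (colVec P r) p (stdVec t) * R v (colVec P r') q (stdVec t'))
      (fun _ => isLinearMap_contr _ fun _ _ => isLinearMap_mul_const (hR.third _ _ _) _)
      (fun _ => isLinearMap_contr _ fun _ _ => isLinearMap_const_mul _ (hR.third _ _ _))]
    exact contr_congr fun s s' => contr_stdVec hM (β := fun p q =>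
      R u (colVec P r) (colVec P s) p * R v (colVec P r') (colVec P s') q)
      (fun _ => isLinearMap_mul_const (hR.fourth _ _ _) _)
      (fun _ => isLinearMap_const_mul _ (hR.fourth _ _ _))
  have four : contr Ginv (fun r r' => contr Ginv fun t t' => contr Ginv fun s s' =>
        contr Ginv fun q q' => R (stdVec r) (stdVec t) (stdVec s) (stdVec q) *
          R (stdVec r') (stdVec t') (stdVec s') (stdVec q'))
      = contr M (fun r r' => contr M fun t t' => contr M fun s s' =>
        contr M fun q q' => R (colVec P r) (colVec P t) (colVec P s) (colVec P q) *
          R (colVec P r') (colVec P t') (colVec P s') (colVec P q')) := by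
    rw [contr_stdVec hM (β := fun p p' => contr Ginv fun t t' => contr Ginv fun s s' =>
        contr Ginv fun q q' => R p (stdVec t) (stdVec s) (stdVec q) *
          R p' (stdVec t') (stdVec s') (stdVec q'))
      (fun _ => isLinearMap_contr _ fun _ _ => isLinearMap_contr _ fun _ _ =>
        isLinearMap_contr _ fun _ _ => isLinearMap_mul_const (hR.first _ _ _) _)
      (fun _ => isLinearMap_contr _ fun _ _ => isLinearMap_contr _ fun _ _ =>
        isLinearMap_contr _ fun _ _ => isLinearMap_const_mul _ (hR.first _ _ _))]
    exact contr_congr fun r r' => three₂ _ _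
  funext u v w z
  simp only [belForm]
  rw [two, two, three₁, three₂, four]

/-- The scalar superenergy tensor does not depend on the frame. -/
theorem scalarForm_stdVec (hM : Ginv = P * M * P.transpose)
    (hl : ∀ v, IsLinearMap ℝ fun u => h u v) (hr : ∀ u, IsLinearMap ℝ fun v => h u v) :
    scalarForm γ Ginv stdVec h = scalarForm γ M (colVec P) h := by
  have one : ∀ u v, contr Ginv (fun r r' => h u (stdVec r) * h v (stdVec r'))
      = contr M (fun r r' => h u (colVec P r) * h v (colVec P r')) := fun u v =>
    contr_stdVec hM (β := fun p q => h u p * h v q)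
      (fun _ => isLinearMap_mul_const (hr _) _) (fun _ => isLinearMap_const_mul _ (hr _))
  have two : contr Ginv (fun s s' => contr Ginv fun r r' =>
        h (stdVec s) (stdVec r) * h (stdVec s') (stdVec r'))
      = contr M (fun s s' => contr M fun r r' =>
        h (colVec P s) (colVec P r) * h (colVec P s') (colVec P r')) := by
    rw [contr_stdVec hM (β := fun p q => contr Ginv fun r r' => h p (stdVec r) * h q (stdVec r'))
      (fun _ => isLinearMap_contr _ fun _ _ => isLinearMap_mul_const (hl _) _)
      (fun _ => isLinearMap_contr _ fun _ _ => isLinearMap_const_mul _ (hl _))]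
    exact contr_congr fun r r' => one _ _
  funext u v w z
  simp only [scalarForm]
  rw [one, one, two]

/-- The contraction of the last three slots of `T` with the vector dual to the linear form `x`. -/
def cubicContr (M : Matrix (Fin n) (Fin n) ℝ) (b : Fin n → Fin n → ℝ) (x : (Fin n → ℝ) → ℝ)
    (T : (Fin n → ℝ) → (Fin n → ℝ) → (Fin n → ℝ) → (Fin n → ℝ) → ℝ) (u : Fin n → ℝ) : ℝ :=
  contr M fun j j' => x (b j') * contr M fun k k' => x (b k') * contr M fun l l' =>
    x (b l') * T u (b j) (b k) (b l)

theorem cubicContr_stdVec (hM : Ginv = P * M * P.transpose) {x : (Fin n → ℝ) → ℝ}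
    (hx : IsLinearMap ℝ x) (hR : IsQuadrilinear R) :
    cubicContr Ginv stdVec x R = cubicContr M (colVec P) x R := by
  funext u
  simp only [cubicContr]
  rw [contr_stdVec hM (β := fun p q => x q * contr Ginv fun k k' => x (stdVec k') *
    contr Ginv fun l l' => x (stdVec l') * R u p (stdVec k) (stdVec l))
    (fun _ => isLinearMap_const_mul _ (isLinearMap_contr _ fun _ _ => isLinearMap_const_mul _
      (isLinearMap_contr _ fun _ _ => isLinearMap_const_mul _ (hR.second _ _ _))))
    (fun _ => isLinearMap_mul_const hx _)]
  refine contr_congr fun j j' => ?_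
  congr 1
  rw [contr_stdVec hM (β := fun p q => x q *
    contr Ginv fun l l' => x (stdVec l') * R u (colVec P j) p (stdVec l))
    (fun _ => isLinearMap_const_mul _
      (isLinearMap_contr _ fun _ _ => isLinearMap_const_mul _ (hR.third _ _ _)))
    (fun _ => isLinearMap_mul_const hx _)]
  refine contr_congr fun k k' => ?_
  congr 1
  exact contr_stdVec hM (β := fun p q => x q * R u (colVec P j) (colVec P k) p)
    (fun _ => isLinearMap_const_mul _ (hR.fourth _ _ _))
    (fun _ => isLinearMap_mul_const hx _)

end Multilinear

end SuperEnergy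

namespace SuperEnergy

/-! ### First-order jets at zero -/

/-- The function `F` has value `a` and derivative `a'` at zero. -/
structure Jet (F : ℝ → ℝ) (a a' : ℝ) : Prop where
  val : F 0 = a
  deriv : HasDerivAt F a' 0

namespace Jet

variable {F G : ℝ → ℝ} {a a' b b' : ℝ}

theorem add (hF : Jet F a a') (hG : Jet G b b') : Jet (fun t => F t + G t) (a + b) (a' + b') :=
  ⟨by rw [hF.val, hG.val], hF.deriv.add hG.deriv⟩

theorem sub (hF : Jet F a a') (hG : Jet G b b') : Jet (fun t => F t - G t) (a - b) (a' - b') :=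
  ⟨by rw [hF.val, hG.val], hF.deriv.sub hG.deriv⟩

theorem mul (hF : Jet F a a') (hG : Jet G b b') :
    Jet (fun t => F t * G t) (a * b) (a' * b + a * b') :=
  ⟨by rw [hF.val, hG.val], by
    have h := hF.deriv.mul hG.deriv
    rw [hF.val, hG.val] at h
    exact h⟩

theorem const (c : ℝ) : Jet (fun _ => c) c 0 := ⟨rfl, hasDerivAt_const _ _⟩

theorem sum {ι : Type*} {s : Finset ι} {F : ι → ℝ → ℝ} {a a' : ι → ℝ}
    (h : ∀ i ∈ s, Jet (F i) (a i) (a' i)) :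
    Jet (fun t => ∑ i ∈ s, F i t) (∑ i ∈ s, a i) (∑ i ∈ s, a' i) :=
  ⟨Finset.sum_congr rfl fun i hi => (h i hi).val, HasDerivAt.fun_sum fun i hi => (h i hi).deriv⟩

theorem congr_deriv (hF : Jet F a a') {a'' : ℝ} (h : a' = a'') : Jet F a a'' := h ▸ hF

theorem congr_val (hF : Jet F a a') {a'' : ℝ} (h : a = a'') : Jet F a'' a' := h ▸ hF

/-- The transfer principle: two expressions that agree along the line near t = 0 have equal
derivatives, even if one is computed in coordinates and the other in a moving frame. -/
theorem unique (hF : Jet F a a') (hG : Jet G b b') (h : ∀ᶠ t in 𝓝 0, F t = G t) : a' = b' :=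
  hF.deriv.unique (hG.deriv.congr_of_eventuallyEq h)

theorem of_line {n : ℕ} {f : Coord n → ℝ} {y : Coord n} (hf : DifferentiableAt ℝ f y)
    (v : Fin n → ℝ) : Jet (fun t : ℝ => f (y + t • (WithLp.toLp 2 v : Coord n))) (f y)
      (∑ m, v m * pd m f y) :=
  ⟨by simp, hasDerivAt_line hf v⟩

/-- Contraction with a matrix that is diagonal to first order. -/
theorem contr {n : ℕ} {ε : Fin n → ℝ} {Θ : ℝ → Matrix (Fin n) (Fin n) ℝ}
    (hΘ : ∀ i j, Jet (fun t => Θ t i j) (if i = j then ε i else 0) 0)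
    {Z : ℝ → Fin n → Fin n → ℝ} {z z' : Fin n → Fin n → ℝ}
    (hZ : ∀ i j, Jet (fun t => Z t i j) (z i j) (z' i j)) :
    Jet (fun t => SuperEnergy.contr (Θ t) (Z t)) (wsum ε fun i => z i i)
      (wsum ε fun i => z' i i) := by
  have h : Jet (fun t => SuperEnergy.contr (Θ t) (Z t)) _ _ :=
    Jet.sum (s := Finset.univ) fun i _ => Jet.sum (s := Finset.univ) fun j _ =>
      (hΘ i j).mul (hZ i j)
  refine (h.congr_val ?_).congr_deriv ?_
  · simp [wsum]
  · simp [wsum]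

end Jet

/-! ### Frames that are parallel to first order along a line -/

section LineFrame

variable {n : ℕ}

/-- The connection matrix in the direction `v`. -/
noncomputable def lineConn (g : Coord n → Matrix (Fin n) (Fin n) ℝ) (y : Coord n) (v : Fin n → ℝ) :
    Matrix (Fin n) (Fin n) ℝ :=
  Matrix.of fun a b => ∑ m, v m * christoffel g y a m b

/-- The straight line through `y` in the direction `v`. -/
def line (y : Coord n) (v : Fin n → ℝ) (t : ℝ) : Coord n := y + t • (WithLp.toLp 2 v : Coord n)

/-- A frame along the line that starts as `P` and is parallel to first order. -/
noncomputable def lineFrame (g : Coord n → Matrix (Fin n) (Fin n) ℝ) (y : Coord n)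
    (P : Matrix (Fin n) (Fin n) ℝ) (v : Fin n → ℝ) (t : ℝ) : Matrix (Fin n) (Fin n) ℝ :=
  P - t • (lineConn g y v * P)

/-- The derivative is the right-hand side of the parallel transport equation. A frame affine in t
suffices because only first derivatives at t = 0 are ever taken. -/
theorem jet_lineFrame (g : Coord n → Matrix (Fin n) (Fin n) ℝ) (y : Coord n)
    (P : Matrix (Fin n) (Fin n) ℝ) (v : Fin n → ℝ) (i a : Fin n) :
    Jet (fun t => colVec (lineFrame g y P v t) i a) (colVec P i a)
      (- ∑ c, lineConn g y v a c * colVec P i c) := by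
  refine ⟨by simp [colVec, lineFrame], ?_⟩
  have h : HasDerivAt (fun t : ℝ => P a i - t * (lineConn g y v * P) a i)
      (-(1 * (lineConn g y v * P) a i)) 0 := ((hasDerivAt_id (0 : ℝ)).mul_const _).const_sub _
  rw [one_mul, Matrix.mul_apply] at h
  exact h

/-- The covariant derivative `∇_m h_{ab}` of a field of bilinear forms. -/
noncomputable def covDeriv₂ (g : Coord n → Matrix (Fin n) (Fin n) ℝ)
    (h : Coord n → Fin n → Fin n → ℝ) (y : Coord n) (m a b : Fin n) : ℝ :=
  pd m (fun z => h z a b) y - ∑ e, christoffel g y e m a * h y e b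
    - ∑ e, christoffel g y e m b * h y a e

theorem sum_mul_ev1 (c : Fin n → ℝ) (ψ : Fin n → Fin n → ℝ) (u : Fin n → ℝ) :
    ∑ e, c e * ev1 (ψ e) u = ev1 (fun a => ∑ e, c e * ψ e a) u := by
  simp only [ev1, Finset.mul_sum]
  rw [Finset.sum_comm]
  exact Finset.sum_congr rfl fun a _ => Finset.sum_congr rfl fun e _ => by ring

theorem sum_mul_ev2 (c : Fin n → ℝ) (ψ : Fin n → Fin n → Fin n → ℝ) (u v : Fin n → ℝ) :
    ∑ e, c e * ev2 (ψ e) u v = ev2 (fun a b => ∑ e, c e * ψ e a b) u v := by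
  simp only [ev2, ← sum_mul_ev1, Finset.mul_sum]
  rw [Finset.sum_comm]
  exact Finset.sum_congr rfl fun a _ => Finset.sum_congr rfl fun e _ => by ring

theorem sum_mul_ev3 (c : Fin n → ℝ) (ψ : Fin n → Fin n → Fin n → Fin n → ℝ) (u v w : Fin n → ℝ) :
    ∑ e, c e * ev3 (ψ e) u v w = ev3 (fun a b d => ∑ e, c e * ψ e a b d) u v w := by
  simp only [ev3, ← sum_mul_ev2, Finset.mul_sum]
  rw [Finset.sum_comm]
  exact Finset.sum_congr rfl fun a _ => Finset.sum_congr rfl fun e _ => by ring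

theorem sum_mul_ev4 (c : Fin n → ℝ) (ψ : Fin n → Fin n → Fin n → Fin n → Fin n → ℝ)
    (u v w z : Fin n → ℝ) :
    ∑ e, c e * ev4 (ψ e) u v w z = ev4 (fun a b d f => ∑ e, c e * ψ e a b d f) u v w z := by
  simp only [ev4, ← sum_mul_ev3, Finset.mul_sum]
  rw [Finset.sum_comm]
  exact Finset.sum_congr rfl fun a _ => Finset.sum_congr rfl fun e _ => by ring

theorem ev1_sub (θ ψ : Fin n → ℝ) (u : Fin n → ℝ) :
    ev1 θ u - ev1 ψ u = ev1 (fun a => θ a - ψ a) u := by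
  simp only [ev1, mul_sub, Finset.sum_sub_distrib]

theorem ev2_sub (θ ψ : Fin n → Fin n → ℝ) (u v : Fin n → ℝ) :
    ev2 θ u v - ev2 ψ u v = ev2 (fun a b => θ a b - ψ a b) u v := by
  simp only [ev2, ← ev1_sub, mul_sub, Finset.sum_sub_distrib]

theorem ev3_sub (θ ψ : Fin n → Fin n → Fin n → ℝ) (u v w : Fin n → ℝ) :
    ev3 θ u v w - ev3 ψ u v w = ev3 (fun a b c => θ a b c - ψ a b c) u v w := by
  simp only [ev3, ← ev2_sub, mul_sub, Finset.sum_sub_distrib]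

section Evaluation

variable {A : Matrix (Fin n) (Fin n) ℝ} {p q r s : Fin n → ℝ} {u v w z : ℝ → Fin n → ℝ}

/-- By the product rule the motion of the vector contributes −A p, which is transposed onto the
components; this is the connection term of a covariant derivative. The higher-rank versions iterate
this one slot at a time. -/
theorem jet_ev1 {f : ℝ → Fin n → ℝ} {θ θ' : Fin n → ℝ}
    (hu : ∀ a, Jet (fun t => u t a) (p a) (- ∑ c, A a c * p c))
    (hf : ∀ a, Jet (fun t => f t a) (θ a) (θ' a)) :
    Jet (fun t => ev1 (f t) (u t)) (ev1 θ p) (ev1 (fun a => θ' a - ∑ e, A e a * θ e) p) := by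
  have h : Jet (fun t => ev1 (f t) (u t)) _ _ :=
    Jet.sum (s := Finset.univ) fun a _ => (hu a).mul (hf a)
  refine (h.congr_val rfl).congr_deriv ?_
  simp only [ev1, mul_sub, Finset.sum_add_distrib, Finset.sum_sub_distrib, neg_mul,
    Finset.sum_neg_distrib, Finset.sum_mul, Finset.mul_sum]
  rw [Finset.sum_comm, neg_add_eq_sub]
  congr 1
  exact Finset.sum_congr rfl fun a _ => Finset.sum_congr rfl fun e _ => by ring

theorem jet_ev2 {f : ℝ → Fin n → Fin n → ℝ} {θ θ' : Fin n → Fin n → ℝ}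
    (hu : ∀ a, Jet (fun t => u t a) (p a) (- ∑ c, A a c * p c))
    (hv : ∀ a, Jet (fun t => v t a) (q a) (- ∑ c, A a c * q c))
    (hf : ∀ a b, Jet (fun t => f t a b) (θ a b) (θ' a b)) :
    Jet (fun t => ev2 (f t) (u t) (v t)) (ev2 θ p q)
      (ev2 (fun a b => θ' a b - ∑ e, A e b * θ a e - ∑ e, A e a * θ e b) p q) := by
  have h := jet_ev1 (f := fun t a => ev1 (f t a) (v t)) hu fun a => jet_ev1 hv (hf a)
  refine (h.congr_val rfl).congr_deriv ?_
  simp only [sum_mul_ev1, ev1_sub]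
  rfl

theorem jet_ev3 {f : ℝ → Fin n → Fin n → Fin n → ℝ} {θ θ' : Fin n → Fin n → Fin n → ℝ}
    (hu : ∀ a, Jet (fun t => u t a) (p a) (- ∑ c, A a c * p c))
    (hv : ∀ a, Jet (fun t => v t a) (q a) (- ∑ c, A a c * q c))
    (hw : ∀ a, Jet (fun t => w t a) (r a) (- ∑ c, A a c * r c))
    (hf : ∀ a b c, Jet (fun t => f t a b c) (θ a b c) (θ' a b c)) :
    Jet (fun t => ev3 (f t) (u t) (v t) (w t)) (ev3 θ p q r)
      (ev3 (fun a b c => θ' a b c - ∑ e, A e c * θ a b e - ∑ e, A e b * θ a e c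
        - ∑ e, A e a * θ e b c) p q r) := by
  have h := jet_ev1 (f := fun t a => ev2 (f t a) (v t) (w t)) hu fun a => jet_ev2 hv hw (hf a)
  refine (h.congr_val rfl).congr_deriv ?_
  simp only [sum_mul_ev2, ev2_sub]
  rfl

theorem jet_ev4 {f : ℝ → Fin n → Fin n → Fin n → Fin n → ℝ}
    {θ θ' : Fin n → Fin n → Fin n → Fin n → ℝ}
    (hu : ∀ a, Jet (fun t => u t a) (p a) (- ∑ c, A a c * p c))
    (hv : ∀ a, Jet (fun t => v t a) (q a) (- ∑ c, A a c * q c))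
    (hw : ∀ a, Jet (fun t => w t a) (r a) (- ∑ c, A a c * r c))
    (hz : ∀ a, Jet (fun t => z t a) (s a) (- ∑ c, A a c * s c))
    (hf : ∀ a b c d, Jet (fun t => f t a b c d) (θ a b c d) (θ' a b c d)) :
    Jet (fun t => ev4 (f t) (u t) (v t) (w t) (z t)) (ev4 θ p q r s)
      (ev4 (fun a b c d => θ' a b c d - ∑ e, A e d * θ a b c e - ∑ e, A e c * θ a b e d
        - ∑ e, A e b * θ a e c d - ∑ e, A e a * θ e b c d) p q r s) := by
  have h := jet_ev1 (f := fun t a => ev3 (f t a) (v t) (w t) (z t)) hu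
    fun a => jet_ev3 hv hw hz (hf a)
  refine (h.congr_val rfl).congr_deriv ?_
  simp only [sum_mul_ev3, ev3_sub]
  rfl

end Evaluation

variable (g : Coord n → Matrix (Fin n) (Fin n) ℝ) (y : Coord n) (P : Matrix (Fin n) (Fin n) ℝ)
  (v : Fin n → ℝ)

theorem lineConn_sum (f : Fin n → ℝ) (a : Fin n) : ∑ e, lineConn g y v e a * f e
    = ∑ m, v m * ∑ e, christoffel g y e m a * f e := by
  simp only [lineConn, Matrix.of_apply, Finset.sum_mul, Finset.mul_sum]
  rw [Finset.sum_comm]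
  exact Finset.sum_congr rfl fun m _ => Finset.sum_congr rfl fun e _ => by ring

/-- In a frame parallel to first order, the ordinary derivative of a component is the component of
the covariant derivative in the direction of the line. -/
theorem jet_covector {u : Coord n → Fin n → ℝ} (hu : ∀ a, DifferentiableAt ℝ (fun z => u z a) y)
    (i : Fin n) :
    Jet (fun t => ev1 (u (line y v t)) (colVec (lineFrame g y P v t) i)) (ev1 (u y) (colVec P i))
      (ev2 (covDeriv g u y) v (colVec P i)) := by
  have h := jet_ev1 (f := fun t => u (line y v t)) (jet_lineFrame g y P v i)
    fun a => Jet.of_line (hu a) v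
  refine h.congr_deriv ?_
  rw [ev2, sum_mul_ev1]
  congr 1
  funext a
  simp only [lineConn_sum, covDeriv, mul_sub, Finset.sum_sub_distrib]

theorem jet_bilinear {h : Coord n → Fin n → Fin n → ℝ}
    (hh : ∀ a b, DifferentiableAt ℝ (fun z => h z a b) y) (i j : Fin n) :
    Jet (fun t => ev2 (h (line y v t)) (colVec (lineFrame g y P v t) i)
        (colVec (lineFrame g y P v t) j)) (ev2 (h y) (colVec P i) (colVec P j))
      (ev3 (covDeriv₂ g h y) v (colVec P i) (colVec P j)) := by
  have h := jet_ev2 (f := fun t => h (line y v t)) (jet_lineFrame g y P v i)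
    (jet_lineFrame g y P v j) fun a b => Jet.of_line (hh a b) v
  refine h.congr_deriv ?_
  rw [ev3, sum_mul_ev2]
  congr 1
  funext a b
  simp only [lineConn_sum, covDeriv₂, mul_sub, Finset.sum_sub_distrib]
  ring

/-- The quintilinear form with components `T`. -/
def ev5 (T : Fin n → Fin n → Fin n → Fin n → Fin n → ℝ) (x u v w z : Fin n → ℝ) : ℝ :=
  ∑ m, x m * ev4 (T m) u v w z

theorem jet_riemann (hR : ∀ a b c d, DifferentiableAt ℝ (fun z => riemann g z a b c d) y)
    (i j k l : Fin n) :
    Jet (fun t => ev4 (riemann g (line y v t)) (colVec (lineFrame g y P v t) i)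
        (colVec (lineFrame g y P v t) j) (colVec (lineFrame g y P v t) k)
        (colVec (lineFrame g y P v t) l))
      (ev4 (riemann g y) (colVec P i) (colVec P j) (colVec P k) (colVec P l))
      (ev5 (covRiemann g y) v (colVec P i) (colVec P j) (colVec P k) (colVec P l)) := by
  have h := jet_ev4 (f := fun t => riemann g (line y v t)) (jet_lineFrame g y P v i)
    (jet_lineFrame g y P v j) (jet_lineFrame g y P v k) (jet_lineFrame g y P v l)
    fun a b c d => Jet.of_line (hR a b c d) v
  refine h.congr_deriv ?_
  rw [ev5, sum_mul_ev4]
  congr 1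
  funext a b c d
  simp only [lineConn_sum, covRiemann, mul_sub, Finset.sum_sub_distrib]
  ring

end LineFrame

end SuperEnergy

/-! ### Orthogonal frames and divergences of currents -/

namespace SuperEnergy

section OrthogonalFrame

variable {n : ℕ}

/-- Spectral theorem for the symmetric matrix G, the frame consisting of eigenvectors. The entries η
are the eigenvalues, nonzero since the determinant is; they are not normalized to ±1, and the
signature plays no role. -/
theorem exists_orthogonal_frame {G : Matrix (Fin n) (Fin n) ℝ} (hs : G.transpose = G)
    (hd : G.det ≠ 0) : ∃ (P : Matrix (Fin n) (Fin n) ℝ) (η ε : Fin n → ℝ),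
      P.transpose * G * P = Matrix.diagonal η ∧ ∀ i, ε i * η i = 1 := by
  have hH : G.IsHermitian := by
    rw [Matrix.IsHermitian, Matrix.conjTranspose_eq_transpose_of_trivial, hs]
  refine ⟨(hH.eigenvectorUnitary : Matrix (Fin n) (Fin n) ℝ), hH.eigenvalues,
    fun i => (hH.eigenvalues i)⁻¹, ?_, fun i => inv_mul_cancel₀ fun h => hd ?_⟩
  · have h := hH.conjStarAlgAut_star_eigenvectorUnitary
    rw [Unitary.conjStarAlgAut_star_apply, Matrix.star_eq_conjTranspose,
      Matrix.conjTranspose_eq_transpose_of_trivial] at h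
    rw [h]
    rfl
  · rw [hH.det_eq_prod_eigenvalues]
    exact Finset.prod_eq_zero (Finset.mem_univ i) (by simpa using h)

theorem inv_eq_of_gram {G P : Matrix (Fin n) (Fin n) ℝ} (h : (P.transpose * G * P).det ≠ 0) :
    G⁻¹ = P * (P.transpose * G * P)⁻¹ * P.transpose := by
  rw [Matrix.det_mul, Matrix.det_mul, Matrix.det_transpose] at h
  have hP : IsUnit P.det := isUnit_iff_ne_zero.2 fun h' => h (by simp [h'])
  have hPt : IsUnit P.transpose.det := by rwa [Matrix.det_transpose]
  rw [Matrix.mul_inv_rev, Matrix.mul_inv_rev, ← Matrix.mul_assoc, Matrix.mul_nonsing_inv _ hP,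
    Matrix.one_mul, Matrix.mul_assoc, Matrix.nonsing_inv_mul _ hPt, Matrix.mul_one]

theorem ev2_colVec (G P : Matrix (Fin n) (Fin n) ℝ) (i j : Fin n) :
    ev2 (fun a b => G a b) (colVec P i) (colVec P j) = (P.transpose * G * P) i j := by
  rw [Matrix.mul_assoc]
  simp only [ev2, ev1, colVec, Matrix.mul_apply, Matrix.transpose_apply, Finset.mul_sum]
  exact Finset.sum_congr rfl fun a _ => Finset.sum_congr rfl fun b _ => by ring

theorem contr_diagonal (ε : Fin n → ℝ) (Z : Fin n → Fin n → ℝ) :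
    contr (Matrix.diagonal ε) Z = wsum ε fun i => Z i i := by
  simp [contr, wsum, Matrix.diagonal_apply]

theorem diagonal_inv {η ε : Fin n → ℝ} (hη : ∀ i, ε i * η i = 1) :
    (Matrix.diagonal η)⁻¹ = Matrix.diagonal ε := by
  refine Matrix.inv_eq_left_inv ?_
  rw [Matrix.diagonal_mul_diagonal]
  simp only [hη, Matrix.diagonal_one]

theorem det_diagonal_ne_zero {η ε : Fin n → ℝ} (hη : ∀ i, ε i * η i = 1) :
    (Matrix.diagonal η).det ≠ 0 := by
  rw [Matrix.det_diagonal]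
  exact Finset.prod_ne_zero_iff.2 fun i _ => right_ne_zero_of_mul_eq_one (hη i)

/-- The Gram matrix of the frame along the line. -/
noncomputable def lineGram (g : Coord n → Matrix (Fin n) (Fin n) ℝ) (y : Coord n)
    (P : Matrix (Fin n) (Fin n) ℝ) (v : Fin n → ℝ) (t : ℝ) : Matrix (Fin n) (Fin n) ℝ :=
  (lineFrame g y P v t).transpose * g (line y v t) * lineFrame g y P v t

namespace IsMetricOn

variable {g : Coord n → Matrix (Fin n) (Fin n) ℝ} {U : Set (Coord n)} {y : Coord n}
variable (hg : IsMetricOn g U) (hy : y ∈ U)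
include hg hy

theorem covDeriv₂_metric (m a b : Fin n) : covDeriv₂ g (fun z a b => g z a b) y m a b = 0 := by
  have h := congrFun (congrFun (hg.mpd_metric hy m) a) b
  simp only [mpd, Matrix.of_apply, Matrix.add_apply, Matrix.mul_apply, Matrix.transpose_apply,
    conn] at h
  rw [covDeriv₂, h, Finset.sum_congr rfl fun e _ => mul_comm (g y a e) _]
  ring

variable {P : Matrix (Fin n) (Fin n) ℝ} {η ε : Fin n → ℝ}
  (hP : P.transpose * g y * P = Matrix.diagonal η) (hη : ∀ i, ε i * η i = 1) (v : Fin n → ℝ)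

omit hg hy in
include hP hη in
theorem inv_eq_frame : (g y)⁻¹ = P * Matrix.diagonal ε * P.transpose := by
  rw [inv_eq_of_gram (P := P) (by rw [hP]; exact det_diagonal_ne_zero hη), hP, diagonal_inv hη]

-- By metric compatibility the moving frame stays orthogonal, with the same squared lengths, to
-- first order in t.
include hP in
theorem jet_lineGram (i j : Fin n) :
    Jet (fun t => lineGram g y P v t i j) (if i = j then η i else 0) 0 := by
  have h := jet_bilinear g y P v (h := fun z a b => g z a b)
    (fun a b => (hg.smooth y hy).differentiableAt a b) i j
  simp only [ev2_colVec] at h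
  refine (h.congr_val ?_).congr_deriv ?_
  · rw [hP, Matrix.diagonal_apply]
  · simp [ev3, ev2, ev1, hg.covDeriv₂_metric hy]

omit hg hy in
theorem contDiff_line : ContDiff ℝ ∞ (line y v) :=
  contDiff_const.add (contDiff_id.smul contDiff_const)

omit hg hy in
theorem line_zero : line y v 0 = y := by simp [line]

theorem smooth_lineGram : SmoothEntries (lineGram g y P v) 0 := by
  have hE : SmoothEntries (lineFrame g y P v) 0 := fun a b => by
    simp only [lineFrame, Matrix.sub_apply, Matrix.smul_apply]
    exact contDiffAt_const.sub (contDiffAt_id.smul contDiffAt_const)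
  have hG : SmoothEntries (fun t => g (line y v t)) 0 := fun a b => by
    have h := hg.smooth y hy a b
    rw [← line_zero (y := y) v] at h
    exact ContDiffAt.comp (0 : ℝ) h (contDiff_line v).contDiffAt
  exact (hE.transpose.mul hG).mul hE

theorem eventually_line_mem : ∀ᶠ t in 𝓝 (0 : ℝ), line y v t ∈ U := by
  have hc : Filter.Tendsto (line y v) (𝓝 0) (𝓝 y) := by
    have := (contDiff_line (y := y) v).continuous.tendsto 0
    rwa [line_zero] at this
  exact hc.eventually (hg.eventually_mem hy)

omit hg hy in
theorem lineGram_zero : lineGram g y P v 0 = P.transpose * g y * P := by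
  simp [lineGram, lineFrame, line_zero]

include hP hη

theorem eventually_det_lineGram : ∀ᶠ t in 𝓝 (0 : ℝ), (lineGram g y P v t).det ≠ 0 := by
  have hc := (hg.smooth_lineGram hy v (P := P)).det.continuousAt
  refine hc.eventually_ne ?_
  rw [lineGram_zero, hP]
  exact det_diagonal_ne_zero hη

theorem eventually_inv_eq : ∀ᶠ t in 𝓝 (0 : ℝ), (g (line y v t))⁻¹
    = lineFrame g y P v t * (lineGram g y P v t)⁻¹ * (lineFrame g y P v t).transpose :=
  (hg.eventually_det_lineGram hy hP hη v).mono fun _ ht => inv_eq_of_gram ht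

/-- Differentiating (inverse Gram)·(Gram) = 1, where the Gram matrix is diagonal with zero
derivative, leaves each derivative of the inverse times a nonzero η_j equal to zero. -/
theorem jet_lineGram_inv (i j : Fin n) :
    Jet (fun t => (lineGram g y P v t)⁻¹ i j) (if i = j then ε i else 0) 0 := by
  have hs := hg.smooth_lineGram hy v (P := P)
  have h₀ : (lineGram g y P v 0)⁻¹ = Matrix.diagonal ε := by
    rw [lineGram_zero, hP, diagonal_inv hη]
  have hd := hs.inv (by rw [lineGram_zero, hP]; exact det_diagonal_ne_zero hη)
  have hval : ∀ i j, (lineGram g y P v 0)⁻¹ i j = if i = j then ε i else 0 := by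
    intro i j
    rw [h₀, Matrix.diagonal_apply]
  have hj : ∀ i j, Jet (fun t => (lineGram g y P v t)⁻¹ i j) (if i = j then ε i else 0)
      (deriv (fun t => (lineGram g y P v t)⁻¹ i j) 0) := fun i j =>
    ⟨hval i j, (hd.differentiableAt i j).hasDerivAt⟩
  refine (hj i j).congr_deriv ?_
  have hprod : Jet (fun t => ∑ k, (lineGram g y P v t)⁻¹ i k * lineGram g y P v t k j) _ _ :=
    Jet.sum (s := Finset.univ) fun k _ => (hj i k).mul (hg.jet_lineGram hy hP v k j)
  have hone := hprod.unique (Jet.const ((1 : Matrix (Fin n) (Fin n) ℝ) i j))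
    ((hg.eventually_det_lineGram hy hP hη v).mono fun t ht => by
      rw [← Matrix.mul_apply, Matrix.nonsing_inv_mul _ (isUnit_iff_ne_zero.2 ht)])
  simp only [mul_ite, mul_zero, add_zero, Finset.sum_ite_eq', Finset.mem_univ, if_true] at hone
  rcases mul_eq_zero.1 hone with h | h
  · exact h
  · exact absurd h (right_ne_zero_of_mul_eq_one (hη j))

omit hP hη

/-- The divergence of a current is the trace of the covariant derivative of its covector. -/
theorem divergence_eq_contr {u : Coord n → Fin n → ℝ}
    (hu : ∀ a, DifferentiableAt ℝ (fun z => u z a) y) :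
    divergence g (fun z a => ∑ c, (g z)⁻¹ a c * u z c) y = contr (g y)⁻¹ (covDeriv g u y) := by
  have h₁ : ∀ a, pd a (fun z => ∑ c, (g z)⁻¹ a c * u z c) y
      = ∑ c, (- ∑ e, christoffel g y a a e * (g y)⁻¹ e c
        - ∑ e, (g y)⁻¹ a e * christoffel g y c a e) * u y c
        + ∑ c, (g y)⁻¹ a c * pd a (fun z => u z c) y := by
    intro a
    rw [pd_sum a Finset.univ (F := fun c z => (g z)⁻¹ a c * u z c)
      (fun c _ => ((hg.smooth_inv hy).differentiableAt a c).mul (hu c)), ← Finset.sum_add_distrib]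
    refine Finset.sum_congr rfl fun c _ => ?_
    rw [pd_mul a ((hg.smooth_inv hy).differentiableAt a c) (hu c)]
    congr 2
    have h := congrFun (congrFun (hg.mpd_inv hy a) a) c
    simp only [mpd, Matrix.of_apply, Matrix.sub_apply, Matrix.neg_apply, Matrix.mul_apply,
      Matrix.transpose_apply, conn] at h
    exact h
  simp only [divergence, h₁, contr, covDeriv, mul_sub, sub_mul, Finset.sum_add_distrib,
    Finset.sum_sub_distrib, neg_mul, Finset.sum_neg_distrib, Finset.sum_mul, Finset.mul_sum]
  have e₁ : ∑ a, ∑ c, ∑ e, christoffel g y a a e * (g y)⁻¹ e c * u y c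
      = ∑ a, ∑ e, ∑ c, christoffel g y a a e * ((g y)⁻¹ e c * u y c) := by
    refine Finset.sum_congr rfl fun a _ => ?_
    rw [Finset.sum_comm]
    exact Finset.sum_congr rfl fun e _ => Finset.sum_congr rfl fun c _ => by ring
  have e₂ : ∑ a, ∑ c, ∑ e, (g y)⁻¹ a e * christoffel g y c a e * u y c
      = ∑ a, ∑ e, ∑ c, (g y)⁻¹ a e * (christoffel g y c a e * u y c) := by
    refine Finset.sum_congr rfl fun a _ => ?_
    rw [Finset.sum_comm]
    exact Finset.sum_congr rfl fun e _ => Finset.sum_congr rfl fun c _ => by ring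
  rw [e₁, e₂]
  ring

include hP hη in
theorem divergence_eq_wsum {u : Coord n → Fin n → ℝ}
    (hu : ∀ a, DifferentiableAt ℝ (fun z => u z a) y) :
    divergence g (fun z a => ∑ c, (g z)⁻¹ a c * u z c) y
      = wsum ε fun i => ev2 (covDeriv g u y) (colVec P i) (colVec P i) := by
  rw [hg.divergence_eq_contr hy hu,
    ← contr_diagonal ε (fun i j => ev2 (covDeriv g u y) (colVec P i) (colVec P j)),
    ← contr_stdVec (inv_eq_frame hP hη) (isLinearMap_ev2_left _) (isLinearMap_ev2_right _)]
  simp only [ev2_stdVec]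

end IsMetricOn

end OrthogonalFrame

end SuperEnergy

/-! ### From coordinate components to frame components -/

namespace SuperEnergy

section Transfer

variable {n : ℕ}

theorem ev2_swap (h : Fin n → Fin n → ℝ) (u v : Fin n → ℝ) :
    ev2 h u v = ev2 (fun a b => h b a) v u := by
  simp only [ev2, ev1, Finset.mul_sum]
  rw [Finset.sum_comm]
  exact Finset.sum_congr rfl fun a _ => Finset.sum_congr rfl fun b _ => by ring

theorem ev2_neg (h : Fin n → Fin n → ℝ) (u v : Fin n → ℝ) :
    ev2 (fun a b => - h a b) u v = - ev2 h u v := by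
  simp only [ev2, ev1, mul_neg, Finset.sum_neg_distrib]

theorem ev3_swap_right (T : Fin n → Fin n → Fin n → ℝ) (u v w : Fin n → ℝ) :
    ev3 T u v w = ev3 (fun a b c => T a c b) u w v := by
  simp only [ev3]
  exact Finset.sum_congr rfl fun a _ => by rw [ev2_swap]

theorem ev3_swap_left (T : Fin n → Fin n → Fin n → ℝ) (u v w : Fin n → ℝ) :
    ev3 T u v w = ev3 (fun a b c => T b a c) v u w := by
  simp only [ev3, ev2, Finset.mul_sum]
  rw [Finset.sum_comm]
  exact Finset.sum_congr rfl fun a _ => Finset.sum_congr rfl fun b _ => by ring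

theorem ev4_swap_left (R : Fin n → Fin n → Fin n → Fin n → ℝ) (u v w z : Fin n → ℝ) :
    ev4 R u v w z = ev4 (fun a b c d => R b a c d) v u w z := by
  simp only [ev4, ev3, Finset.mul_sum]
  rw [Finset.sum_comm]
  exact Finset.sum_congr rfl fun a _ => Finset.sum_congr rfl fun b _ => by ring

theorem ev4_swap_middle (R : Fin n → Fin n → Fin n → Fin n → ℝ) (u v w z : Fin n → ℝ) :
    ev4 R u v w z = ev4 (fun a b c d => R a c b d) u w v z := by
  simp only [ev4]
  exact Finset.sum_congr rfl fun a _ => by rw [ev3_swap_left]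

theorem ev4_swap_right (R : Fin n → Fin n → Fin n → Fin n → ℝ) (u v w z : Fin n → ℝ) :
    ev4 R u v w z = ev4 (fun a b c d => R a b d c) u v z w := by
  simp only [ev4]
  exact Finset.sum_congr rfl fun a _ => by rw [ev3_swap_right]

theorem ev4_pair (R : Fin n → Fin n → Fin n → Fin n → ℝ) (u v w z : Fin n → ℝ) :
    ev4 R u v w z = ev4 (fun a b c d => R c d a b) w z u v := by
  rw [ev4_swap_middle, ev4_swap_left, ev4_swap_right, ev4_swap_middle]

theorem ev4_neg (R : Fin n → Fin n → Fin n → Fin n → ℝ) (u v w z : Fin n → ℝ) :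
    ev4 (fun a b c d => - R a b c d) u v w z = - ev4 R u v w z := by
  simp only [ev4, ev3, ev2, ev1, mul_neg, Finset.sum_neg_distrib]

/-- Symmetries of the component array pass to its values on any vectors, so the frame identities
apply to the actual curvature. -/
theorem CurvatureSymm.ev4 {R : Fin n → Fin n → Fin n → Fin n → ℝ} (hR : CurvatureSymm R)
    (b : Fin n → Fin n → ℝ) :
    CurvatureSymm fun i j k l => SuperEnergy.ev4 R (b i) (b j) (b k) (b l) where
  antisymm_left i j k l := by
    rw [ev4_swap_left, ← ev4_neg]
    congr 1
    funext a b c d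
    exact hR.antisymm_left b a c d
  pair i j k l := by
    rw [ev4_pair]
    congr 1
    funext a b c d
    exact hR.pair c d a b

theorem CurvatureSymm.ev5 {T : Fin n → Fin n → Fin n → Fin n → Fin n → ℝ}
    (hT : ∀ m, CurvatureSymm (T m)) (b : Fin n → Fin n → ℝ) (v : Fin n → ℝ) :
    CurvatureSymm fun i j k l => SuperEnergy.ev5 T v (b i) (b j) (b k) (b l) := by
  have h : CurvatureSymm fun i j k l => ∑ m, v m * T m i j k l :=
    ⟨fun i j k l => by
      rw [← Finset.sum_neg_distrib]
      exact Finset.sum_congr rfl fun m _ => by rw [(hT m).antisymm_left, mul_neg],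
      fun i j k l => Finset.sum_congr rfl fun m _ => by rw [(hT m).pair]⟩
  have h' := h.ev4 b
  simp only [← sum_mul_ev4] at h'
  exact h'

theorem ev5_eq_ev3 (T : Fin n → Fin n → Fin n → Fin n → Fin n → ℝ) (x u v w z : Fin n → ℝ) :
    ev5 T x u v w z = ev3 (fun m a b => ev2 (T m a b) w z) x u v := rfl

theorem ev5_cyclic {T : Fin n → Fin n → Fin n → Fin n → Fin n → ℝ}
    (hT : ∀ m a b c d, T m a b c d + T a b m c d + T b m a c d = 0) (x u v w z : Fin n → ℝ) :
    ev5 T x u v w z + ev5 T u v x w z + ev5 T v x u w z = 0 := by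
  rw [ev5_eq_ev3, ev5_eq_ev3, ev5_eq_ev3, ev3_swap_right _ u v x, ev3_swap_left _ u x v,
    ev3_swap_left _ v x u, ev3_swap_right _ x v u]
  simp only [ev3, ev2, ev1, ← Finset.sum_add_distrib, ← mul_add]
  simp only [hT, mul_zero, Finset.sum_const_zero]

theorem eq_ev2 {f : (Fin n → ℝ) → (Fin n → ℝ) → ℝ} (h₁ : ∀ v, IsLinearMap ℝ fun u => f u v)
    (h₂ : ∀ u, IsLinearMap ℝ fun v => f u v) (u v : Fin n → ℝ) :
    f u v = ev2 (fun a b => f (stdVec a) (stdVec b)) u v := by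
  rw [← sum_mul_stdVec (h₁ v) u]
  simp only [ev2, ev1, sum_mul_stdVec (h₂ _)]

theorem eq_ev3 {f : (Fin n → ℝ) → (Fin n → ℝ) → (Fin n → ℝ) → ℝ}
    (h₁ : ∀ v w, IsLinearMap ℝ fun u => f u v w) (h₂ : ∀ u w, IsLinearMap ℝ fun v => f u v w)
    (h₃ : ∀ u v, IsLinearMap ℝ fun w => f u v w) (u v w : Fin n → ℝ) :
    f u v w = ev3 (fun a b c => f (stdVec a) (stdVec b) (stdVec c)) u v w := by
  rw [← sum_mul_stdVec (h₁ v w) u]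
  simp only [ev3, ← eq_ev2 (h₂ _) (h₃ _)]

theorem ev1_mul_ev1 (θ ψ : Fin n → ℝ) (u v : Fin n → ℝ) :
    ev1 θ u * ev1 ψ v = ev2 (fun a b => θ a * ψ b) u v := by
  simp only [ev2, ev1]
  rw [Finset.sum_mul]
  refine Finset.sum_congr rfl fun a _ => ?_
  rw [Finset.mul_sum, Finset.mul_sum]
  exact Finset.sum_congr rfl fun b _ => by ring

/-- The covector dual to a vector field. -/
def lower (g : Coord n → Matrix (Fin n) (Fin n) ℝ) (ξ : Coord n → Fin n → ℝ) (y : Coord n)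
    (c : Fin n) : ℝ := ∑ d, g y c d * ξ y d

namespace IsMetricOn

variable {g : Coord n → Matrix (Fin n) (Fin n) ℝ} {U : Set (Coord n)} {y : Coord n}
variable (hg : IsMetricOn g U) (hy : y ∈ U)
include hg hy

theorem sum_inv_mul_lower (ξ : Coord n → Fin n → ℝ) (j : Fin n) :
    ∑ j', (g y)⁻¹ j j' * lower g ξ y j' = ξ y j := by
  have h : ((g y)⁻¹ * g y).mulVec (ξ y) j = ξ y j := by rw [hg.inv_mul hy, Matrix.one_mulVec]
  rw [← Matrix.mulVec_mulVec] at h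
  exact h

theorem contr_lower (ξ : Coord n → Fin n → ℝ) (f : Fin n → ℝ) :
    contr (g y)⁻¹ (fun j j' => lower g ξ y j' * f j) = ∑ j, ξ y j * f j := by
  simp only [contr]
  refine Finset.sum_congr rfl fun j _ => ?_
  rw [← hg.sum_inv_mul_lower hy ξ j, Finset.sum_mul]
  exact Finset.sum_congr rfl fun j' _ => by ring

theorem smooth_lower {ξ : Coord n → Fin n → ℝ} (hξ : ∀ i, ContDiffAt ℝ ∞ (fun z => ξ z i) y)
    (c : Fin n) : ContDiffAt ℝ ∞ (fun z => lower g ξ z c) y :=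
  ContDiffAt.sum fun d _ => (hg.smooth y hy c d).mul (hξ d)

theorem contr_riemann {P M : Matrix (Fin n) (Fin n) ℝ} (hM : (g y)⁻¹ = P * M * P.transpose)
    (u w : Fin n → ℝ) :
    contr M (fun a a' => ev4 (riemann g y) (colVec P a) u (colVec P a') w)
      = ev2 (ricci g y) u w := by
  rw [← contr_stdVec hM (β := fun p q => ev4 (riemann g y) p u q w)
    (fun _ => isLinearMap_ev4_first _ _ _ _) (fun _ => isLinearMap_ev4_third _ _ _ _),
    eq_ev2 (f := fun u w => contr (g y)⁻¹
      (fun a a' => ev4 (riemann g y) (stdVec a) u (stdVec a') w))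
    (fun _ => isLinearMap_contr _ fun _ _ => isLinearMap_ev4_second _ _ _ _)
    (fun _ => isLinearMap_contr _ fun _ _ => isLinearMap_ev4_fourth _ _ _ _)]
  congr 1
  funext b d
  rw [hg.ricci_eq_sum_riemann hy]
  simp only [ev4_stdVec, contr]

omit hg hy in
theorem contr_ev2 {P M : Matrix (Fin n) (Fin n) ℝ} (hM : (g y)⁻¹ = P * M * P.transpose)
    (h : Fin n → Fin n → ℝ) :
    contr M (fun a a' => ev2 h (colVec P a) (colVec P a')) = contr (g y)⁻¹ h := by
  rw [← contr_stdVec hM (isLinearMap_ev2_left h) (isLinearMap_ev2_right h)]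
  simp only [ev2_stdVec]

/-- Both sides are trilinear in u, v, w, so the coordinate Ricci identity on basis vectors decides;
the raised curvature index becomes a contraction that any frame may compute. -/
theorem covHess_comm_frame {φ : Coord n → ℝ} (hφ : ∀ z ∈ U, ContDiffAt ℝ ∞ φ z)
    {P M : Matrix (Fin n) (Fin n) ℝ} (hM : (g y)⁻¹ = P * M * P.transpose) (u v w : Fin n → ℝ) :
    ev3 (covHess g φ y) u v w - ev3 (covHess g φ y) v u w
      = - contr M fun l l' => ev1 (fun a => pd a φ y) (colVec P l) *
        ev4 (riemann g y) (colVec P l') w u v := by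
  rw [← contr_stdVec hM (β := fun p q => ev1 (fun a => pd a φ y) p * ev4 (riemann g y) q w u v)
    (fun _ => isLinearMap_mul_const (isLinearMap_ev1 _) _)
    (fun _ => isLinearMap_const_mul _ (isLinearMap_ev4_first _ _ _ _)),
    ev3_swap_left _ v u w, ev3_sub,
    eq_ev3 (f := fun u v w => contr (g y)⁻¹ fun r r' => ev1 (fun a => pd a φ y) (stdVec r) *
      ev4 (riemann g y) (stdVec r') w u v)
    (fun _ _ => isLinearMap_contr _ fun _ _ =>
      isLinearMap_const_mul _ (isLinearMap_ev4_third _ _ _ _))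
    (fun _ _ => isLinearMap_contr _ fun _ _ =>
      isLinearMap_const_mul _ (isLinearMap_ev4_fourth _ _ _ _))
    (fun _ _ => isLinearMap_contr _ fun _ _ =>
      isLinearMap_const_mul _ (isLinearMap_ev4_second _ _ _ _))]
  have hneg : ∀ T : Fin n → Fin n → Fin n → ℝ, - ev3 T u v w = ev3 (fun a b c => - T a b c) u v w :=
    fun T => by simp only [ev3, ev2, ev1, mul_neg, Finset.sum_neg_distrib]
  rw [hneg]
  congr 1
  funext k i j
  rw [hg.covHess_comm hy hφ]
  simp only [ev1_stdVec, ev4_stdVec, contr]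
  congr 1
  refine Finset.sum_congr rfl fun l _ => ?_
  have h : ((g y)⁻¹ * (g y * curv g k i y)) l j = curv g k i y l j := by
    rw [← Matrix.mul_assoc, hg.inv_mul hy, Matrix.one_mul]
  rw [riemannUp_eq_curv, ← h, Matrix.mul_apply, Finset.sum_mul]
  exact Finset.sum_congr rfl fun e _ => by rw [riemann_eq_mul_curv]; ring

end IsMetricOn

end Transfer

end SuperEnergy

/-! ### Killing fields annihilate the scalar curvature -/

namespace SuperEnergy

section Killing

variable {n : ℕ}

theorem Jet.congr_of_eventually {F G : ℝ → ℝ} {a a' : ℝ} (hF : Jet F a a')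
    (h : ∀ᶠ t in 𝓝 0, G t = F t) : Jet G a a' :=
  ⟨by rw [h.self_of_nhds, hF.val], hF.deriv.congr_of_eventuallyEq h⟩

theorem wsum_riemann {g : Coord n → Matrix (Fin n) (Fin n) ℝ} {U : Set (Coord n)} {y : Coord n}
    (hg : IsMetricOn g U) (hy : y ∈ U) {P : Matrix (Fin n) (Fin n) ℝ} {η ε : Fin n → ℝ}
    (hP : P.transpose * g y * P = Matrix.diagonal η) (hη : ∀ i, ε i * η i = 1)
    (u w : Fin n → ℝ) :
    wsum ε (fun a => ev4 (riemann g y) (colVec P a) u (colVec P a) w) = ev2 (ricci g y) u w := by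
  rw [← hg.contr_riemann hy (IsMetricOn.inv_eq_frame hP hη), contr_diagonal]

/-- The covariant derivative `∇_a ξ^b` of a vector field, as the matrix with entries `b, a`. -/
noncomputable def covVec (g : Coord n → Matrix (Fin n) (Fin n) ℝ) (ξ : Coord n → Fin n → ℝ)
    (y : Coord n) : Matrix (Fin n) (Fin n) ℝ :=
  Matrix.of fun b a => pd a (fun z => ξ z b) y + ∑ c, christoffel g y b a c * ξ y c

/-- The contracted Christoffel symbols `Γ^b_{bc}`. -/
noncomputable def connTrace (g : Coord n → Matrix (Fin n) (Fin n) ℝ) (c : Fin n) (y : Coord n) :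
    ℝ := ∑ b, christoffel g y b c b

theorem sum_mul_eq_zero_of_symm_antisymm {s w : Fin n → Fin n → ℝ} (hs : ∀ a b, s a b = s b a)
    (hw : ∀ a b, w a b = - w b a) : ∑ a, ∑ b, s a b * w a b = 0 := by
  have h : ∑ a, ∑ b, s a b * w a b = - ∑ a, ∑ b, s a b * w a b := by
    conv_lhs => rw [Finset.sum_comm]
    simp only [← Finset.sum_neg_distrib]
    exact Finset.sum_congr rfl fun a _ => Finset.sum_congr rfl fun b _ => by
      rw [hs b a, hw b a]; ring
  linarith

namespace IsMetricOn

variable {g : Coord n → Matrix (Fin n) (Fin n) ℝ} {U : Set (Coord n)} {y : Coord n}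
variable (hg : IsMetricOn g U) (hy : y ∈ U)
include hg hy

section Jets

variable {P : Matrix (Fin n) (Fin n) ℝ} {η ε : Fin n → ℝ}
  (hP : P.transpose * g y * P = Matrix.diagonal η) (hη : ∀ i, ε i * η i = 1) (v : Fin n → ℝ)
include hP hη

/-- Trace and covariant derivative commute because the inverse Gram matrix is constant to first
order. The covariant derivative of Ricci thus appears directly as a trace of `covRiemann`. -/
theorem jet_ricci (i j : Fin n) :
    Jet (fun t => ev2 (ricci g (line y v t)) (colVec (lineFrame g y P v t) i)
        (colVec (lineFrame g y P v t) j)) (ev2 (ricci g y) (colVec P i) (colVec P j))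
      (wsum ε fun a => ev5 (covRiemann g y) v (colVec P a) (colVec P i) (colVec P a)
        (colVec P j)) := by
  have h := Jet.contr (hg.jet_lineGram_inv hy hP hη v) fun a a' =>
    jet_riemann g y P v (fun a b c d => (hg.smooth_riemann hy a b c d).differentiableAt (by simp))
      a i a' j
  refine (h.congr_val (wsum_riemann hg hy hP hη _ _)).congr_of_eventually ?_
  filter_upwards [hg.eventually_inv_eq hy hP hη v, hg.eventually_line_mem hy v] with t ht hU
  exact (hg.contr_riemann hU ht _ _).symm

theorem sum_mul_pd_scalarCurvature :
    ∑ m, v m * pd m (scalarCurvature g) y = wsum ε fun b => wsum ε fun a =>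
      ev5 (covRiemann g y) v (colVec P a) (colVec P b) (colVec P a) (colVec P b) := by
  have h := Jet.contr (hg.jet_lineGram_inv hy hP hη v) (hg.jet_ricci hy hP hη v)
  refine (Jet.of_line ((hg.smooth_scalarCurvature hy).differentiableAt (by simp)) v).unique h ?_
  filter_upwards [hg.eventually_inv_eq hy hP hη v] with t ht
  exact (contr_ev2 ht _).symm

theorem wsum_lower (ξ : Coord n → Fin n → ℝ) (θ : Fin n → ℝ) :
    wsum ε (fun j => ev1 (lower g ξ y) (colVec P j) * ev1 θ (colVec P j))
      = ∑ j, ξ y j * θ j := by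
  rw [← hg.contr_lower hy,
    contr_congr (Z' := fun j j' => ev1 (lower g ξ y) (stdVec j') * ev1 θ (stdVec j))
      (by simp only [ev1_stdVec, implies_true]),
    contr_stdVec (inv_eq_frame hP hη) (β := fun p q => ev1 (lower g ξ y) q * ev1 θ p)
    (fun _ => isLinearMap_const_mul _ (isLinearMap_ev1 _))
    (fun _ => isLinearMap_mul_const (isLinearMap_ev1 _) _), contr_diagonal]

/-- The contracted second Bianchi identity, for the current built from the Ricci tensor and a
Killing vector field. -/
theorem divergence_ricci {ξ : Coord n → Fin n → ℝ}
    (hξ : ∀ i, ContDiffAt ℝ ∞ (fun z => ξ z i) y) (hK : KillingAt g ξ y) :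
    2 * divergence g (fun z a => ∑ c, (g z)⁻¹ a c * ∑ l, ξ z l * ricci g z c l) y
      = ∑ m, ξ y m * pd m (scalarCurvature g) y := by
  have hu : ∀ c, ContDiffAt ℝ ∞ (fun z => ∑ l, ξ z l * ricci g z c l) y := fun c =>
    ContDiffAt.sum fun l _ => (hξ l).mul (hg.smooth_ricci hy c l)
  rw [hg.divergence_eq_wsum hy hP hη fun c => (hu c).differentiableAt (by simp)]
  set x : Fin n → ℝ := fun j => ev1 (lower g ξ y) (colVec P j) with hx
  set F : Fin n → Fin n → ℝ := fun i j =>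
    ev2 (covDeriv g (lower g ξ) y) (colVec P i) (colVec P j) with hF
  have hFa : ∀ i j, F i j = - F j i := by
    intro i j
    rw [hF]
    simp only
    rw [ev2_swap, ← ev2_neg]
    congr 1
    funext a b
    exact eq_neg_of_add_eq_zero_left (hK b a)
  -- Product rule for ξ^j R_{ij} along the i-th frame direction, with the index raised by the
  -- inverse Gram matrix of the moving frame.
  have key : ∀ i, ev2 (covDeriv g (fun z c => ∑ l, ξ z l * ricci g z c l) y) (colVec P i)
      (colVec P i) = wsum ε fun j => F i j * ev2 (ricci g y) (colVec P i) (colVec P j)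
        + x j * wsum ε fun a => ev5 (covRiemann g y) (colVec P i) (colVec P a) (colVec P i)
          (colVec P a) (colVec P j) := by
    intro i
    have h₁ := jet_covector g y P (colVec P i) (u := fun z c => ∑ l, ξ z l * ricci g z c l)
      (fun c => (hu c).differentiableAt (by simp)) i
    have h₂ := Jet.contr (hg.jet_lineGram_inv hy hP hη (colVec P i)) fun j j' =>
      (jet_covector g y P (colVec P i) (u := lower g ξ)
        (fun c => (hg.smooth_lower hy hξ c).differentiableAt (by simp)) j').mul
      (hg.jet_ricci hy hP hη (colVec P i) i j)
    refine h₁.unique h₂ ?_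
    filter_upwards [hg.eventually_inv_eq hy hP hη (colVec P i),
      hg.eventually_line_mem hy (colVec P i)] with t ht hU
    rw [← contr_stdVec ht (β := fun p q => ev1 (lower g ξ (line y (colVec P i) t)) q *
        ev2 (ricci g (line y (colVec P i) t)) (colVec (lineFrame g y P (colVec P i) t) i) p)
      (fun _ => isLinearMap_const_mul _ (isLinearMap_ev2_right _ _))
      (fun _ => isLinearMap_mul_const (isLinearMap_ev1 _) _)]
    simp only [ev1_stdVec]
    rw [hg.contr_lower hU]
    simp only [ev1, Finset.mul_sum]
    rw [Finset.sum_comm]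
    refine Finset.sum_congr rfl fun l _ => ?_
    simp only [ev2, ev1_stdVec, Finset.mul_sum]
    exact Finset.sum_congr rfl fun c _ => by ring
  simp only [key]
  have hρ : ∀ i j, ev2 (ricci g y) (colVec P i) (colVec P j)
      = ev2 (ricci g y) (colVec P j) (colVec P i) := by
    intro i j
    rw [← wsum_riemann hg hy hP hη, ← wsum_riemann hg hy hP hη]
    refine wsum_congr fun a => ?_
    exact ((hg.curvatureSymm_riemann hy).ev4 (colVec P)).pair a i a j
  -- The derivative of ξ is antisymmetric and Ricci is symmetric, so only the divergence of Ricci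
  -- remains.
  have hz : wsum ε (fun i => wsum ε fun j => F i j * ev2 (ricci g y) (colVec P i) (colVec P j))
      = 0 := wsum_eq_zero_of_antisymm fun i j => by rw [hFa i j, hρ i j]; ring
  simp only [wsum_add]
  rw [hz, zero_add, wsum_comm]
  have hB := fun l => frame_contracted_bianchi (ε := ε)
    (R' := fun m a b c d => ev5 (covRiemann g y) (colVec P m) (colVec P a) (colVec P b)
      (colVec P c) (colVec P d))
    (fun m => CurvatureSymm.ev5 (hg.curvatureSymm_covRiemann hy) (colVec P) (colVec P m))
    (fun m a b c d => ev5_cyclic (hg.covRiemann_cyclic hy) _ _ _ _ _) l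
  simp only [← mul_wsum]
  rw [mul_wsum]
  rw [← hg.wsum_lower hy hP hη]
  refine wsum_congr fun j => ?_
  have h : ev1 (fun m => pd m (scalarCurvature g) y) (colVec P j) = _ :=
    hg.sum_mul_pd_scalarCurvature hy hP hη (colVec P j)
  rw [h, ← hB j, hx]
  ring

end Jets

/-- Lowering an index commutes with the covariant derivative; this ties Killing's equation, stated
for the covector, to the matrix of the derivatives of the vector field. -/
theorem pd_lower {ξ : Coord n → Fin n → ℝ} (hξ : ∀ i, ContDiffAt ℝ ∞ (fun z => ξ z i) y)
    (a b : Fin n) : covDeriv g (lower g ξ) y a b = (g y * covVec g ξ y) b a := by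
  have hd := fun d => (hξ d).differentiableAt (by simp)
  have h₁ : pd a (fun z => lower g ξ z b) y = ∑ d, ((g y * conn g a y) b d
      + ((conn g a y).transpose * g y) b d) * ξ y d + ∑ d, g y b d * pd a (fun z => ξ z d) y := by
    simp only [lower]
    rw [pd_sum a Finset.univ (F := fun d z => g z b d * ξ z d)
      (fun d _ => ((hg.smooth y hy).differentiableAt b d).mul (hd d)), ← Finset.sum_add_distrib]
    refine Finset.sum_congr rfl fun d _ => ?_
    rw [pd_mul a ((hg.smooth y hy).differentiableAt b d) (hd d), ← Matrix.add_apply,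
      ← hg.mpd_metric hy]
    rfl
  rw [covDeriv, h₁]
  simp only [lower, Matrix.mul_apply, covVec, conn, Matrix.of_apply, Matrix.transpose_apply,
    add_mul, mul_add, Finset.sum_add_distrib, Finset.sum_mul, Finset.mul_sum]
  rw [Finset.sum_comm (f := fun d e => christoffel g y e a b * g y e d * ξ y d),
    Finset.sum_comm (f := fun d e => g y b e * christoffel g y e a d * ξ y d)]
  simp only [mul_assoc]
  ring

/-- The trace of M contracts the symmetric inverse metric with the antisymmetric matrix g M. -/
theorem trace_eq_zero {M : Matrix (Fin n) (Fin n) ℝ}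
    (h : (g y * M).transpose = - (g y * M)) : M.trace = 0 := by
  have h₁ : M = (g y)⁻¹ * (g y * M) := by rw [← Matrix.mul_assoc, hg.inv_mul hy, Matrix.one_mul]
  rw [h₁, Matrix.trace]
  simp only [Matrix.diag_apply, Matrix.mul_apply (M := (g y)⁻¹)]
  rw [← sum_mul_eq_zero_of_symm_antisymm (s := fun a b => (g y)⁻¹ a b)
    (w := fun a b => (g y * M) b a) (fun a b => hg.inv_symm_apply hy a b)
    (fun a b => congrFun (congrFun h a) b)]

theorem smooth_connTrace (c : Fin n) : ContDiffAt ℝ ∞ (connTrace g c) y :=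
  ContDiffAt.sum fun b _ => hg.smooth_christoffel hy b c b

/-- The contracted Christoffel symbols form a closed one-form, locally the differential of log √|det
g|. Here closedness comes from tracelessness of the skew-adjoint curvature endomorphisms; the
commutator part of the curvature has zero trace anyway. -/
theorem pd_connTrace (c d : Fin n) : pd c (connTrace g d) y = pd d (connTrace g c) y := by
  have h := hg.trace_eq_zero hy (hg.mul_curv_transpose hy c d)
  simp only [curv, Matrix.trace_add, Matrix.trace_sub] at h
  rw [Matrix.trace_mul_comm, add_sub_cancel_right, sub_eq_zero] at h
  have key : ∀ c d, pd c (connTrace g d) y = (mpd c (conn g d) y).trace := fun c d =>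
    pd_sum c Finset.univ (F := fun b z => christoffel g z b d b)
      (fun b _ => (hg.smooth_christoffel hy b d b).differentiableAt (by simp))
  rw [key, key, h]

theorem smooth_covVec {ξ : Coord n → Fin n → ℝ} (hξ : ∀ i, ContDiffAt ℝ ∞ (fun z => ξ z i) y) :
    SmoothEntries (covVec g ξ) y := fun b a =>
  (contDiffAt_pd a (hξ b)).add (ContDiffAt.sum fun c _ =>
    (hg.smooth_christoffel hy b a c).mul (hξ c))

omit hg hy in
/-- The double divergence of an antisymmetric tensor vanishes. -/
theorem divergence_antisymm (hg : IsMetricOn g U) (hy : y ∈ U)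
    {W : Coord n → Matrix (Fin n) (Fin n) ℝ} (hW : SmoothEntries W y)
    (ha : ∀ᶠ z in 𝓝 y, (W z).transpose = - W z) :
    divergence g (fun z a => ∑ b, (pd b (fun z => W z a b) z + connTrace g b z * W z a b)) y
      = 0 := by
  have d₁ := fun a b => hW.differentiableAt a b
  have d₂ := fun b => (hg.smooth_connTrace hy b).differentiableAt (by simp)
  have d₃ : ∀ a b c, DifferentiableAt ℝ (fun z => pd c (fun z => W z a b) z) y :=
    fun a b c => (contDiffAt_pd c (hW a b)).differentiableAt (by simp)
  have hw : ∀ a b, W y a b = - W y b a := fun a b => congrFun (congrFun ha.self_of_nhds b) a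
  have hpd : ∀ a b c, pd c (fun z => W z a b) y = - pd c (fun z => W z b a) y := by
    intro a b c
    have h : pd c (fun z => W z a b) y = pd c (fun z => - W z b a) y :=
      pd_congr c (ha.mono fun z hz => congrFun (congrFun hz b) a)
    rw [h]
    simp [pd, fderiv_fun_neg]
  have hpd₂ : ∀ a b c d, pd d (fun z => pd c (fun z => W z a b) z) y
      = - pd d (fun z => pd c (fun z => W z b a) z) y := by
    intro a b c d
    have h : pd d (fun z => pd c (fun z => W z a b) z) y
        = pd d (fun z => - pd c (fun z => W z b a) z) y := by
      refine pd_congr d (ha.eventually_nhds.mono fun z hz => ?_)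
      have h' : pd c (fun z => W z a b) z = pd c (fun z => - W z b a) z :=
        pd_congr c (hz.mono fun z hz => congrFun (congrFun hz b) a)
      refine h'.trans ?_
      simp [pd, fderiv_fun_neg]
    rw [h]
    simp [pd, fderiv_fun_neg]
  have e : ∀ a, pd a (fun z => ∑ b, (pd b (fun z => W z a b) z + connTrace g b z * W z a b)) y
      = ∑ b, (pd a (fun z => pd b (fun z => W z a b) z) y + (pd a (connTrace g b) y * W y a b
        + connTrace g b y * pd a (fun z => W z a b) y)) := by
    intro a
    rw [pd_sum a Finset.univ
      (F := fun b z => pd b (fun z => W z a b) z + connTrace g b z * W z a b)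
      (fun b _ => (d₃ a b b).add ((d₂ b).mul (d₁ a b)))]
    refine Finset.sum_congr rfl fun b _ => ?_
    rw [← pd_mul a (d₂ b) (d₁ a b)]
    exact pd_add a (d₃ a b b) ((d₂ b).mul (d₁ a b))
  have e' : ∀ f : Fin n → ℝ, ∑ a, ∑ b, christoffel g y a a b * f b = ∑ b, connTrace g b y * f b := by
    intro f
    rw [Finset.sum_comm]
    refine Finset.sum_congr rfl fun b _ => ?_
    rw [connTrace, Finset.sum_mul]
    exact Finset.sum_congr rfl fun a _ => by rw [hg.christoffel_symm hy]
  rw [divergence]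
  simp only [e, e']
  simp only [Finset.sum_add_distrib, Finset.mul_sum, mul_add]
  -- The expanded divergence consists of symmetric coefficients against W, which vanish, and two
  -- terms with first derivatives of W, which cancel each other. Symmetry of the coefficient in `z₂`
  -- is the closedness of the contracted connection.
  have z₁ : ∑ a, ∑ b, pd a (fun z => pd b (fun z => W z a b) z) y = 0 := by
    have h := sum_mul_eq_zero_of_symm_antisymm (n := n) (s := fun _ _ => 1)
      (w := fun a b => pd a (fun z => pd b (fun z => W z a b) z) y) (fun _ _ => rfl) (fun a b => by
        rw [show pd a (fun z => pd b (fun z => W z a b) z) y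
          = pd b (fun z => pd a (fun z => W z a b) z) y from pd_comm a b (hW a b)]
        exact hpd₂ a b a b)
    simpa only [one_mul] using h
  have z₂ := sum_mul_eq_zero_of_symm_antisymm (s := fun a b => pd a (connTrace g b) y)
    (w := fun a b => W y a b) (fun a b => hg.pd_connTrace hy a b) hw
  have z₃ := sum_mul_eq_zero_of_symm_antisymm (s := fun a b => connTrace g a y * connTrace g b y)
    (w := fun a b => W y a b) (fun a b => mul_comm _ _) hw
  have z₄ : ∑ a, ∑ b, connTrace g b y * pd a (fun z => W z a b) y
      = - ∑ a, ∑ b, connTrace g a y * pd b (fun z => W z a b) y := by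
    rw [Finset.sum_comm]
    simp only [← Finset.sum_neg_distrib]
    exact Finset.sum_congr rfl fun a _ => Finset.sum_congr rfl fun b _ => by
      rw [hpd b a b]; ring
  rw [z₁, z₂, z₄]
  simp only [mul_assoc] at z₃
  rw [z₃]
  ring

-- The contracted Ricci identity: the right side is ∇_b ∇_c ξ^b written out, and its commuted
-- partner ∇_c ∇_b ξ^b is zero because ξ is divergence-free near the point.
omit hy in
theorem sum_mul_ricci {ξ : Coord n → Fin n → ℝ}
    (hξ : ∀ i, ContDiffAt ℝ ∞ (fun z => ξ z i) y)
    (hT : ∀ᶠ z in 𝓝 y, (covVec g ξ z).trace = 0) (hy : y ∈ U) (c : Fin n) :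
    ∑ l, ξ y l * ricci g y l c
      = ∑ b, (pd b (fun z => covVec g ξ z b c) y + connTrace g b y * covVec g ξ y b c
        - ∑ e, christoffel g y e b c * covVec g ξ y b e) := by
  have d₁ : ∀ a b, DifferentiableAt ℝ (fun z => pd a (fun z => ξ z b) z) y :=
    fun a b => (contDiffAt_pd a (hξ b)).differentiableAt (by simp)
  have d₂ : ∀ a b c, DifferentiableAt ℝ (fun z => christoffel g z a b c) y :=
    fun a b c => (hg.smooth_christoffel hy a b c).differentiableAt (by simp)
  have d₃ := fun a => (hξ a).differentiableAt (by simp)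
  have e₁ : ∀ d b a, pd d (fun z => covVec g ξ z b a) y = pd d (fun z => pd a (fun z => ξ z b) z) y
      + ∑ l, (pd d (fun z => christoffel g z b a l) y * ξ y l
        + christoffel g y b a l * pd d (fun z => ξ z l) y) := by
    intro d b a
    simp only [← pd_mul d (d₂ _ _ _) (d₃ _)]
    rw [← pd_sum d Finset.univ (F := fun l z => christoffel g z b a l * ξ z l)
      (fun l _ => (d₂ b a l).mul (d₃ l))]
    exact pd_add d (d₁ a b) (DifferentiableAt.fun_sum fun l _ => (d₂ b a l).mul (d₃ l))
  -- The divergence of ξ vanishes near y, so its derivative vanishes as well; this supplies the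
  -- missing half of the commutator.
  have htr : ∑ b, pd c (fun z => covVec g ξ z b b) y = 0 := by
    rw [← pd_sum c Finset.univ (F := fun b z => covVec g ξ z b b) (fun b _ =>
      (hg.smooth_covVec hy hξ).differentiableAt b b), ← pd_const (y := y) c 0]
    exact pd_congr c hT
  simp only [e₁, Finset.sum_add_distrib] at htr
  have hcomm : ∀ b, pd b (fun z => pd c (fun z => ξ z b) z) y
      = pd c (fun z => pd b (fun z => ξ z b) z) y := fun b => pd_comm b c (hξ b)
  have t₃ : ∑ b, ∑ l, christoffel g y b b l * pd c (fun z => ξ z l) y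
      = ∑ b, connTrace g b y * pd c (fun z => ξ z b) y := by
    rw [Finset.sum_comm]
    refine Finset.sum_congr rfl fun l _ => ?_
    rw [connTrace, Finset.sum_mul]
    exact Finset.sum_congr rfl fun b _ => by rw [hg.christoffel_symm hy]
  have t₂ : ∑ b, ∑ l, christoffel g y b c l * pd b (fun z => ξ z l) y
      = ∑ b, ∑ e, christoffel g y e b c * pd e (fun z => ξ z b) y := by
    rw [Finset.sum_comm]
    exact Finset.sum_congr rfl fun l _ => Finset.sum_congr rfl fun b _ => by
      rw [hg.christoffel_symm hy]
  have t₁ : ∀ f : Fin n → Fin n → ℝ, ∑ l, ∑ b, ξ y l * f b l = ∑ b, ∑ l, f b l * ξ y l := by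
    intro f
    rw [Finset.sum_comm]
    exact Finset.sum_congr rfl fun l _ => Finset.sum_congr rfl fun b _ => mul_comm _ _
  have t₄ : ∑ b, ∑ l, (∑ e, christoffel g y b b e * christoffel g y e c l) * ξ y l
      = ∑ b, ∑ l, connTrace g b y * (christoffel g y b c l * ξ y l) := by
    simp only [Finset.sum_mul]
    rw [Finset.sum_congr rfl fun b _ => Finset.sum_comm, Finset.sum_comm]
    refine Finset.sum_congr rfl fun e _ => ?_
    rw [Finset.sum_comm]
    refine Finset.sum_congr rfl fun l _ => ?_
    rw [connTrace, Finset.sum_mul]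
    exact Finset.sum_congr rfl fun b _ => by rw [hg.christoffel_symm hy b b e]; ring
  have t₆ : ∑ b, ∑ l, (∑ e, christoffel g y b c e * christoffel g y e b l) * ξ y l
      = ∑ b, ∑ e, ∑ l, christoffel g y e b c * (christoffel g y b e l * ξ y l) := by
    simp only [Finset.sum_mul]
    rw [Finset.sum_congr rfl fun b _ => Finset.sum_comm, Finset.sum_comm]
    exact Finset.sum_congr rfl fun e _ => Finset.sum_congr rfl fun b _ =>
      Finset.sum_congr rfl fun l _ => by rw [hg.christoffel_symm hy b c e]; ring
  simp only [ricci, Finset.mul_sum]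
  rw [t₁]
  simp only [riemannUp, Finset.sum_sub_distrib, add_mul, sub_mul, Finset.sum_add_distrib]
  rw [t₄, t₆]
  simp only [e₁, hcomm]
  simp only [Finset.sum_add_distrib, covVec, Matrix.of_apply, mul_add, Finset.mul_sum]
  rw [t₂]
  rw [t₃] at htr
  linear_combination -htr

omit hy in
theorem ricci_symm (hy : y ∈ U) (a b : Fin n) : ricci g y a b = ricci g y b a := by
  rw [hg.ricci_eq_sum_riemann hy, hg.ricci_eq_sum_riemann hy, Finset.sum_comm]
  exact Finset.sum_congr rfl fun i _ => Finset.sum_congr rfl fun j _ => by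
    rw [hg.inv_symm_apply hy, (hg.curvatureSymm_riemann hy).pair]

omit hy in
theorem mul_covVec_transpose {ξ : Coord n → Fin n → ℝ}
    (hξ : ∀ i, ContDiffAt ℝ ∞ (fun z => ξ z i) y) (hK : KillingAt g ξ y) (hy : y ∈ U) :
    (g y * covVec g ξ y).transpose = - (g y * covVec g ξ y) := by
  ext a b
  rw [Matrix.transpose_apply, Matrix.neg_apply, ← hg.pd_lower hy hξ, ← hg.pd_lower hy hξ]
  exact eq_neg_of_add_eq_zero_left (hK a b)

omit hy in
theorem inv_mul_covVec_transpose {ξ : Coord n → Fin n → ℝ}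
    (hξ : ∀ i, ContDiffAt ℝ ∞ (fun z => ξ z i) y) (hK : KillingAt g ξ y) (hy : y ∈ U) :
    ((g y)⁻¹ * (covVec g ξ y).transpose).transpose = - ((g y)⁻¹ * (covVec g ξ y).transpose) := by
  have h := hg.mul_covVec_transpose hξ hK hy
  rw [Matrix.transpose_mul, hg.symm y hy] at h
  rw [Matrix.transpose_mul, Matrix.transpose_transpose, hg.inv_symm hy]
  have h' := congrArg (fun M => (g y)⁻¹ * M * (g y)⁻¹) h
  simp only [Matrix.mul_neg, Matrix.neg_mul, Matrix.mul_assoc, hg.mul_inv hy, Matrix.mul_one] at h'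
  rw [← Matrix.mul_assoc, ← Matrix.mul_assoc, hg.inv_mul hy, Matrix.one_mul] at h'
  rw [h', neg_neg]

omit hy in
/-- The Ricci tensor applied to a Killing vector field, as a divergence. -/
theorem sum_ricci_eq {ξ : Coord n → Fin n → ℝ}
    (hξ : ∀ z ∈ U, ∀ i, ContDiffAt ℝ ∞ (fun z => ξ z i) z) (hK : ∀ z ∈ U, KillingAt g ξ z)
    (hy : y ∈ U) (a : Fin n) :
    ∑ c, (g y)⁻¹ a c * ∑ l, ξ y l * ricci g y c l
      = ∑ b, (pd b (fun z => ((g z)⁻¹ * (covVec g ξ z).transpose) a b) y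
        + connTrace g b y * ((g y)⁻¹ * (covVec g ξ y).transpose) a b) := by
  have hT : ∀ᶠ z in 𝓝 y, (covVec g ξ z).trace = 0 := (hg.eventually_mem hy).mono fun z hz =>
    hg.trace_eq_zero hz (hg.mul_covVec_transpose (hξ z hz) (hK z hz) hz)
  have hW := hg.inv_mul_covVec_transpose (hξ y hy) (hK y hy) hy
  have hM := (hg.smooth_covVec hy (hξ y hy)).transpose
  have e₁ : ∀ b, pd b (fun z => ((g z)⁻¹ * (covVec g ξ z).transpose) a b) y
      = ∑ c, (g y)⁻¹ a c * pd b (fun z => covVec g ξ z b c) y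
        - ∑ c, christoffel g y a b c * ((g y)⁻¹ * (covVec g ξ y).transpose) c b
        - ∑ c, (g y)⁻¹ a c * ∑ e, christoffel g y e b c * covVec g ξ y b e := by
    intro b
    have h := congrFun (congrFun (mpd_mul b (hg.smooth_inv hy) hM) a) b
    rw [hg.mpd_inv hy, Matrix.sub_mul, Matrix.neg_mul, Matrix.mul_assoc, Matrix.mul_assoc] at h
    refine h.trans ?_
    rw [Matrix.add_apply, Matrix.sub_apply, Matrix.neg_apply, Matrix.mul_apply,
      Matrix.mul_apply (M := (g y)⁻¹), Matrix.mul_apply (M := (g y)⁻¹)]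
    simp only [Matrix.mul_apply (M := (conn g b y).transpose)]
    simp only [mpd, conn, Matrix.of_apply, Matrix.transpose_apply]
    ring
  -- The connection term acting on the free upper index pairs the symmetric Christoffel symbols with
  -- the antisymmetric tensor ∇ξ.
  have z := sum_mul_eq_zero_of_symm_antisymm (s := fun b c => christoffel g y a b c)
    (w := fun b c => ((g y)⁻¹ * (covVec g ξ y).transpose) c b)
    (fun b c => hg.christoffel_symm hy a b c) (fun b c => congrFun (congrFun hW b) c)
  have e₂ : ∀ c, ∑ l, ξ y l * ricci g y c l = ∑ l, ξ y l * ricci g y l c := fun c =>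
    Finset.sum_congr rfl fun l _ => by rw [hg.ricci_symm hy]
  simp only [e₂, hg.sum_mul_ricci (hξ y hy) hT hy, e₁, Finset.sum_add_distrib,
    Finset.sum_sub_distrib, z, mul_add, mul_sub]
  simp only [Matrix.mul_apply, Matrix.transpose_apply, Finset.mul_sum]
  rw [Finset.sum_comm (f := fun c b => (g y)⁻¹ a c * pd b (fun z => covVec g ξ z b c) y),
    Finset.sum_comm (f := fun c b => (g y)⁻¹ a c * (connTrace g b y * covVec g ξ y b c)),
    Finset.sum_comm (f := fun c b => ∑ e, (g y)⁻¹ a c * (christoffel g y e b c * covVec g ξ y b e))]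
  have e₃ : ∀ b c, (g y)⁻¹ a c * (connTrace g b y * covVec g ξ y b c)
    = connTrace g b y * ((g y)⁻¹ a c * covVec g ξ y b c) := fun b c => by ring
  simp only [e₃]
  ring

omit hy in
/-- A Killing vector field annihilates the scalar curvature. -/
theorem sum_killing_pd_scalarCurvature {ξ : Coord n → Fin n → ℝ}
    (hξ : ∀ z ∈ U, ∀ i, ContDiffAt ℝ ∞ (fun z => ξ z i) z) (hK : ∀ z ∈ U, KillingAt g ξ z)
    (hy : y ∈ U) : ∑ m, ξ y m * pd m (scalarCurvature g) y = 0 := by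
  obtain ⟨P, η, ε, hP, hη⟩ := exists_orthogonal_frame (hg.symm y hy) (hg.det_ne y hy)
  rw [← hg.divergence_ricci hy hP hη (hξ y hy) (hK y hy)]
  -- The Ricci current was shown to be the divergence of the antisymmetric tensor g⁻¹(∇ξ)ᵀ, so its
  -- own divergence, which is half of ξ(R), is zero.
  have h := divergence_antisymm hg hy ((hg.smooth_inv hy).mul (hg.smooth_covVec hy (hξ y hy)).transpose)
    ((hg.eventually_mem hy).mono fun z hz => hg.inv_mul_covVec_transpose (hξ z hz) (hK z hz) hz)
  have hc : ∀ᶠ z in 𝓝 y, ∀ a, ∑ c, (g z)⁻¹ a c * ∑ l, ξ z l * ricci g z c l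
      = ∑ b, (pd b (fun z => ((g z)⁻¹ * (covVec g ξ z).transpose) a b) z
        + connTrace g b z * ((g z)⁻¹ * (covVec g ξ z).transpose) a b) :=
    (hg.eventually_mem hy).mono fun z hz a => hg.sum_ricci_eq hξ hK hz a
  have hd : ∀ {J J' : Coord n → Fin n → ℝ}, (∀ᶠ z in 𝓝 y, ∀ a, J z a = J' z a) →
      divergence g J y = divergence g J' y := by
    intro J J' hJ
    simp only [divergence, pd_congr _ (hJ.mono fun z hz => hz _), hJ.self_of_nhds]
  rw [hd hc, h, mul_zero]

end IsMetricOn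

end Killing

end SuperEnergy

/-! ### The mixed current in an orthogonal frame -/

namespace SuperEnergy

section MixedCurrent

variable {n : ℕ}

/-! ### Smoothness of the superenergy tensors -/

theorem contDiffAt_contr {M : Coord n → Matrix (Fin n) (Fin n) ℝ} {y : Coord n}
    {Z : Coord n → Fin n → Fin n → ℝ} (hM : SmoothEntries M y)
    (hZ : ∀ i j, ContDiffAt ℝ ∞ (fun z => Z z i j) y) :
    ContDiffAt ℝ ∞ (fun z => contr (M z) (Z z)) y :=
  ContDiffAt.sum fun i _ => ContDiffAt.sum fun j _ => (hM i j).mul (hZ i j)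

theorem IsMetricOn.smooth_bel {g : Coord n → Matrix (Fin n) (Fin n) ℝ} {U : Set (Coord n)}
    {y : Coord n} (hg : IsMetricOn g U) (hy : y ∈ U) (a b l m : Fin n) :
    ContDiffAt ℝ ∞ (fun z => bel g z a b l m) y := by
  have hi := hg.smooth_inv hy
  have hR := hg.smooth_riemann hy
  have hs := hg.smooth y hy
  simp only [bel_eq_belForm, belForm, ev4_stdVec, ev2_stdVec]
  refine ((((contDiffAt_contr hi fun _ _ => contDiffAt_contr hi fun _ _ =>
    (hR _ _ _ _).mul (hR _ _ _ _)).add (contDiffAt_contr hi fun _ _ => contDiffAt_contr hi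
    fun _ _ => (hR _ _ _ _).mul (hR _ _ _ _))).sub ((contDiffAt_const.mul (hs _ _)).mul
    (contDiffAt_contr hi fun _ _ => contDiffAt_contr hi fun _ _ => contDiffAt_contr hi fun _ _ =>
    (hR _ _ _ _).mul (hR _ _ _ _)))).sub ((contDiffAt_const.mul (hs _ _)).mul
    (contDiffAt_contr hi fun _ _ => contDiffAt_contr hi fun _ _ => contDiffAt_contr hi fun _ _ =>
    (hR _ _ _ _).mul (hR _ _ _ _)))).add (((contDiffAt_const.mul (hs _ _)).mul (hs _ _)).mul
    (contDiffAt_contr hi fun _ _ => contDiffAt_contr hi fun _ _ => contDiffAt_contr hi fun _ _ =>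
    contDiffAt_contr hi fun _ _ => (hR _ _ _ _).mul (hR _ _ _ _)))

theorem IsMetricOn.smooth_scalarSuperEnergy {g : Coord n → Matrix (Fin n) (Fin n) ℝ}
    {U : Set (Coord n)} {y : Coord n} (hg : IsMetricOn g U) (hy : y ∈ U) {φ : Coord n → ℝ}
    (hφ : ∀ z ∈ U, ContDiffAt ℝ ∞ φ z) (a b l m : Fin n) :
    ContDiffAt ℝ ∞ (fun z => scalarSuperEnergy g φ z a b l m) y := by
  have hi := hg.smooth_inv hy
  have hh := hg.smooth_hess hy hφ
  have hs := hg.smooth y hy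
  simp only [scalarSuperEnergy_eq_scalarForm, scalarForm, ev2_stdVec]
  exact ((((hh _ _).mul (hh _ _)).add ((hh _ _).mul (hh _ _))).sub ((hs _ _).mul
    (contDiffAt_contr hi fun _ _ => (hh _ _).mul (hh _ _)))).sub ((hs _ _).mul
    (contDiffAt_contr hi fun _ _ => (hh _ _).mul (hh _ _))) |>.add
    (((contDiffAt_const.mul (hs _ _)).mul (hs _ _)).mul
    (contDiffAt_contr hi fun _ _ => contDiffAt_contr hi fun _ _ => (hh _ _).mul (hh _ _)))

/-! ### The superenergy tensors along a line -/

section Jets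

variable {η ε : Fin n → ℝ} {Θ : ℝ → Matrix (Fin n) (Fin n) ℝ} {b : ℝ → Fin n → Fin n → ℝ}
  {γ : ℝ → (Fin n → ℝ) → (Fin n → ℝ) → ℝ}

/-- Product rule: metric and inverse metric are constant to first order in the moving frame, so the
derivative hits one curvature factor at a time. This is what the polarized `frameBel` records. -/
theorem jet_belForm (hΘ : ∀ i j, Jet (fun t => Θ t i j) (if i = j then ε i else 0) 0)
    (hγ : ∀ i j, Jet (fun t => γ t (b t i) (b t j)) (if i = j then η i else 0) 0)
    {Q : ℝ → (Fin n → ℝ) → (Fin n → ℝ) → (Fin n → ℝ) → (Fin n → ℝ) → ℝ}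
    {R R' : Fin n → Fin n → Fin n → Fin n → ℝ}
    (hQ : ∀ i j k l, Jet (fun t => Q t (b t i) (b t j) (b t k) (b t l)) (R i j k l) (R' i j k l))
    (i j k l : Fin n) :
    Jet (fun t => belForm (γ t) (Θ t) (b t) (Q t) (b t i) (b t j) (b t k) (b t l))
      (frameBel ε η R R i j k l) (frameBel ε η R' R i j k l + frameBel ε η R R' i j k l) := by
  have h := ((((Jet.contr hΘ fun r r' => Jet.contr hΘ fun s s' =>
      (hQ i r k s).mul (hQ j r' l s')).add (Jet.contr hΘ fun r r' => Jet.contr hΘ fun s s' =>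
      (hQ i r l s).mul (hQ j r' k s'))).sub (((Jet.const (1 / 2)).mul (hγ i j)).mul
      (Jet.contr hΘ fun r r' => Jet.contr hΘ fun t t' => Jet.contr hΘ fun s s' =>
      (hQ r t k s).mul (hQ r' t' l s')))).sub (((Jet.const (1 / 2)).mul (hγ k l)).mul
      (Jet.contr hΘ fun r r' => Jet.contr hΘ fun s s' => Jet.contr hΘ fun t t' =>
      (hQ i r s t).mul (hQ j r' s' t')))).add
      ((((Jet.const (1 / 8)).mul (hγ i j)).mul (hγ k l)).mul
      (Jet.contr hΘ fun r r' => Jet.contr hΘ fun t t' => Jet.contr hΘ fun s s' =>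
      Jet.contr hΘ fun q q' => (hQ r t s q).mul (hQ r' t' s' q')))
  refine h.congr_deriv ?_
  simp only [frameBel, wsum_add]
  ring

theorem jet_scalarForm (hΘ : ∀ i j, Jet (fun t => Θ t i j) (if i = j then ε i else 0) 0)
    (hγ : ∀ i j, Jet (fun t => γ t (b t i) (b t j)) (if i = j then η i else 0) 0)
    {q : ℝ → (Fin n → ℝ) → (Fin n → ℝ) → ℝ} {h h' : Fin n → Fin n → ℝ}
    (hq : ∀ i j, Jet (fun t => q t (b t i) (b t j)) (h i j) (h' i j)) (i j k l : Fin n) :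
    Jet (fun t => scalarForm (γ t) (Θ t) (b t) (q t) (b t i) (b t j) (b t k) (b t l))
      (frameScalar ε η h h i j k l)
      (frameScalar ε η h' h i j k l + frameScalar ε η h h' i j k l) := by
  have H := (((((hq i k).mul (hq l j)).add ((hq i l).mul (hq k j))).sub ((hγ i j).mul
      (Jet.contr hΘ fun r r' => (hq k r).mul (hq l r')))).sub ((hγ k l).mul
      (Jet.contr hΘ fun r r' => (hq i r).mul (hq j r')))).add
      ((((Jet.const (1 / 2)).mul (hγ i j)).mul (hγ k l)).mul
      (Jet.contr hΘ fun s s' => Jet.contr hΘ fun r r' => (hq s r).mul (hq s' r')))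
  refine H.congr_deriv ?_
  simp only [frameScalar, wsum_add]
  ring

/-- Product rule for a tensor contracted with three copies of a covector; the terms with F are the
ones that antisymmetry of ∇ξ will remove. -/
theorem jet_cubicContr (hΘ : ∀ i j, Jet (fun t => Θ t i j) (if i = j then ε i else 0) 0)
    {ψ : ℝ → (Fin n → ℝ) → ℝ} {x F : Fin n → ℝ}
    (hψ : ∀ i, Jet (fun t => ψ t (b t i)) (x i) (F i))
    {Q : ℝ → (Fin n → ℝ) → (Fin n → ℝ) → (Fin n → ℝ) → (Fin n → ℝ) → ℝ} {u : ℝ → Fin n → ℝ}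
    {T T' : Fin n → Fin n → Fin n → ℝ}
    (hQ : ∀ j k l, Jet (fun t => Q t (u t) (b t j) (b t k) (b t l)) (T j k l) (T' j k l)) :
    Jet (fun t => cubicContr (Θ t) (b t) (ψ t) (Q t) (u t))
      (wsum ε fun j => wsum ε fun k => wsum ε fun l => T j k l * x j * x k * x l)
      (wsum ε fun j => wsum ε fun k => wsum ε fun l => T' j k l * x j * x k * x l
        + T j k l * (F j * x k * x l + x j * F k * x l + x j * x k * F l)) := by
  have h := Jet.contr hΘ fun j j' => (hψ j').mul (Jet.contr hΘ fun k k' => (hψ k').mul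
    (Jet.contr hΘ fun l l' => (hψ l').mul (hQ j k l)))
  refine (h.congr_val ?_).congr_deriv ?_
  · simp only [mul_wsum]
    exact wsum_congr fun j => wsum_congr fun k => wsum_congr fun l => by ring
  · simp only [mul_wsum, ← wsum_add]
    exact wsum_congr fun j => wsum_congr fun k => wsum_congr fun l => by ring

end Jets

namespace IsMetricOn

variable {g : Coord n → Matrix (Fin n) (Fin n) ℝ} {U : Set (Coord n)} {y : Coord n}
variable (hg : IsMetricOn g U)
include hg

/-- The contraction of the last three indices of a tensor with `ξ`, in an arbitrary frame. -/
theorem ev1_cubic (hy : y ∈ U) {P M : Matrix (Fin n) (Fin n) ℝ}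
    (hM : (g y)⁻¹ = P * M * P.transpose) (ξ : Coord n → Fin n → ℝ)
    {Q : (Fin n → ℝ) → (Fin n → ℝ) → (Fin n → ℝ) → (Fin n → ℝ) → ℝ} (hQ : IsQuadrilinear Q)
    (u : Fin n → ℝ) :
    ev1 (fun c => ∑ b, ∑ l, ∑ m, Q (stdVec c) (stdVec b) (stdVec l) (stdVec m)
        * ξ y b * ξ y l * ξ y m) u
      = cubicContr M (colVec P) (ev1 (lower g ξ y)) Q u := by
  have h : ∀ w, cubicContr M (colVec P) (ev1 (lower g ξ y)) Q w
      = ∑ b, ξ y b * ∑ l, ξ y l * ∑ m, ξ y m * Q w (stdVec b) (stdVec l) (stdVec m) := by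
    intro w
    rw [← cubicContr_stdVec hM (isLinearMap_ev1 _) hQ, cubicContr]
    simp only [ev1_stdVec, hg.contr_lower hy]
  have hl : IsLinearMap ℝ (cubicContr M (colVec P) (ev1 (lower g ξ y)) Q) :=
    isLinearMap_contr _ fun _ _ => isLinearMap_const_mul _ (isLinearMap_contr _ fun _ _ =>
      isLinearMap_const_mul _ (isLinearMap_contr _ fun _ _ => isLinearMap_const_mul _
      (hQ.first _ _ _)))
  rw [← sum_mul_stdVec hl u, ev1]
  refine Finset.sum_congr rfl fun c _ => ?_
  rw [h]
  simp only [Finset.mul_sum]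
  exact Finset.sum_congr rfl fun b _ => Finset.sum_congr rfl fun l _ =>
    Finset.sum_congr rfl fun m _ => by ring

omit hg in
theorem current_eq (T : Coord n → Fin n → Fin n → Fin n → Fin n → ℝ) (ξ : Coord n → Fin n → ℝ) :
    current g T ξ = fun z a => ∑ c, (g z)⁻¹ a c *
      ∑ b, ∑ l, ∑ m, T z c b l m * ξ z b * ξ z l * ξ z m := by
  funext z a
  simp only [current, Finset.mul_sum, mul_assoc]

omit hg in
theorem smooth_cubic {T : Coord n → Fin n → Fin n → Fin n → Fin n → ℝ} {ξ : Coord n → Fin n → ℝ}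
    (hT : ∀ a b l m, ContDiffAt ℝ ∞ (fun z => T z a b l m) y)
    (hξ : ∀ i, ContDiffAt ℝ ∞ (fun z => ξ z i) y) (c : Fin n) :
    ContDiffAt ℝ ∞ (fun z => ∑ b, ∑ l, ∑ m, T z c b l m * ξ z b * ξ z l * ξ z m) y :=
  ContDiffAt.sum fun b _ => ContDiffAt.sum fun l _ => ContDiffAt.sum fun m _ =>
    (((hT c b l m).mul (hξ b)).mul (hξ l)).mul (hξ m)

section Frame

variable {P : Matrix (Fin n) (Fin n) ℝ} {η ε : Fin n → ℝ} (hy : y ∈ U)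
  (hP : P.transpose * g y * P = Matrix.diagonal η) (hη : ∀ i, ε i * η i = 1)
  {φ : Coord n → ℝ} (hφ : ∀ z ∈ U, ContDiffAt ℝ ∞ φ z)
include hP hη hφ hy

omit hg hP hη in
theorem jet_gradient (P : Matrix (Fin n) (Fin n) ℝ) (v : Fin n → ℝ) (i : Fin n) :
    Jet (fun t => ev1 (fun a => pd a φ (line y v t)) (colVec (lineFrame g y P v t) i))
      (ev1 (fun a => pd a φ y) (colVec P i)) (ev2 (hess g φ y) v (colVec P i)) :=
  jet_covector g y P v (u := fun z a => pd a φ z)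
    (fun a => (contDiffAt_pd a (hφ y hy)).differentiableAt (by simp)) i

omit hP hη in
theorem jet_hess (P : Matrix (Fin n) (Fin n) ℝ) (v : Fin n → ℝ) (i j : Fin n) :
    Jet (fun t => ev2 (hess g φ (line y v t)) (colVec (lineFrame g y P v t) i)
        (colVec (lineFrame g y P v t) j)) (ev2 (hess g φ y) (colVec P i) (colVec P j))
      (ev3 (covHess g φ y) v (colVec P i) (colVec P j)) :=
  jet_bilinear g y P v (h := fun z => hess g φ z)
    (fun a b => (hg.smooth_hess hy hφ a b).differentiableAt (by simp)) i j

/-- The divergence of the mixed current, in an orthogonal frame. -/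
theorem divergence_mixed_eq {ξ : Coord n → Fin n → ℝ}
    (hξ : ∀ i, ContDiffAt ℝ ∞ (fun z => ξ z i) y)
    {R : Fin n → Fin n → Fin n → Fin n → ℝ} (hR : R = fun i j k l =>
      ev4 (riemann g y) (colVec P i) (colVec P j) (colVec P k) (colVec P l))
    {R' : Fin n → Fin n → Fin n → Fin n → Fin n → ℝ} (hR' : R' = fun m i j k l =>
      ev5 (covRiemann g y) (colVec P m) (colVec P i) (colVec P j) (colVec P k) (colVec P l))
    {h : Fin n → Fin n → ℝ} (hh : h = fun i j => ev2 (hess g φ y) (colVec P i) (colVec P j))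
    {h' : Fin n → Fin n → Fin n → ℝ} (hh' : h' = fun m i j =>
      ev3 (covHess g φ y) (colVec P m) (colVec P i) (colVec P j))
    {x : Fin n → ℝ} (hx : x = fun i => ev1 (lower g ξ y) (colVec P i))
    {F : Fin n → Fin n → ℝ} (hF : F = fun i j =>
      ev2 (covDeriv g (lower g ξ) y) (colVec P i) (colVec P j)) :
    divergence g (current g (fun z a b l m => bel g z a b l m + scalarSuperEnergy g φ z a b l m) ξ)
      y = wsum ε (fun i => wsum ε fun j => wsum ε fun k => wsum ε fun l =>
      (frameBel ε η (R' i) R i j k l + frameBel ε η R (R' i) i j k l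
        + (frameScalar ε η (h' i) h i j k l + frameScalar ε η h (h' i) i j k l)) * x j * x k * x l
      + (frameBel ε η R R i j k l + frameScalar ε η h h i j k l) *
        (F i j * x k * x l + x j * F i k * x l + x j * x k * F i l)) := by
  subst hR hR' hh hh' hx hF
  have hT : ∀ a b l m, ContDiffAt ℝ ∞
      (fun z => bel g z a b l m + scalarSuperEnergy g φ z a b l m) y := fun a b l m =>
    (hg.smooth_bel hy a b l m).add (hg.smooth_scalarSuperEnergy hy hφ a b l m)
  have hK := fun c => (smooth_cubic hT hξ c).differentiableAt (by simp)
  rw [current_eq, hg.divergence_eq_wsum hy hP hη hK]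
  refine wsum_congr fun i => ?_
  -- The i-th summand of the divergence is the derivative of the i-th component along the i-th frame
  -- vector, so the line is taken in that direction.
  set v := colVec P i with hv
  have hΘ := hg.jet_lineGram_inv hy hP hη v
  have hγ : ∀ i j, Jet (fun t => ev2 (fun a b => g (line y v t) a b)
      (colVec (lineFrame g y P v t) i) (colVec (lineFrame g y P v t) j))
      (if i = j then η i else 0) 0 := by
    intro i j
    simp only [ev2_colVec]
    exact hg.jet_lineGram hy hP v i j
  have hB := jet_belForm hΘ hγ (Q := fun t => ev4 (riemann g (line y v t)))
    (jet_riemann g y P v (fun a b c d => (hg.smooth_riemann hy a b c d).differentiableAt (by simp)))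
    i
  have hS := jet_scalarForm hΘ hγ (q := fun t => ev2 (hess g φ (line y v t)))
    (hg.jet_hess hy hφ P v) i
  have hψ := jet_covector g y P v (u := lower g ξ)
    (fun c => (hg.smooth_lower hy hξ c).differentiableAt (by simp))
  have hJ := jet_cubicContr hΘ (ψ := fun t => ev1 (lower g ξ (line y v t))) hψ
    (u := fun t => colVec (lineFrame g y P v t) i)
    (Q := fun t p q r s =>
      belForm (ev2 fun a b => g (line y v t) a b) (lineGram g y P v t)⁻¹
        (colVec (lineFrame g y P v t)) (ev4 (riemann g (line y v t))) p q r s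
      + scalarForm (ev2 fun a b => g (line y v t) a b) (lineGram g y P v t)⁻¹
        (colVec (lineFrame g y P v t)) (ev2 (hess g φ (line y v t))) p q r s)
    fun j k l => (hB j k l).add (hS j k l)
  -- The coordinate expression of the current and its expression in the moving frame agree at every
  -- nearby point of the line by frame independence of the superenergy tensors; hence their
  -- derivatives agree.
  refine (jet_covector g y P v hK i).unique hJ ?_
  filter_upwards [hg.eventually_inv_eq hy hP hη v, hg.eventually_line_mem hy v] with t ht hU
  have hquad := (isQuadrilinear_belForm (γ := ev2 fun a b => g (line y v t) a b)
    (M := (g (line y v t))⁻¹) (b := stdVec) (isLinearMap_ev2_left _) (isLinearMap_ev2_right _)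
    (isQuadrilinear_ev4 (riemann g (line y v t)))).add
    (isQuadrilinear_scalarForm (γ := ev2 fun a b => g (line y v t) a b)
    (M := (g (line y v t))⁻¹) (b := stdVec) (isLinearMap_ev2_left _) (isLinearMap_ev2_right _)
    (isLinearMap_ev2_left (hess g φ (line y v t))) (isLinearMap_ev2_right _))
  have h₁ := hg.ev1_cubic hU ht ξ hquad (colVec (lineFrame g y P v t) i)
  rw [belForm_stdVec ht (isQuadrilinear_ev4 _),
    scalarForm_stdVec ht (isLinearMap_ev2_left _) (isLinearMap_ev2_right _)] at h₁
  rw [← h₁, ← belForm_stdVec ht (isQuadrilinear_ev4 _),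
    ← scalarForm_stdVec ht (isLinearMap_ev2_left _) (isLinearMap_ev2_right _)]
  simp only [← bel_eq_belForm, ← scalarSuperEnergy_eq_scalarForm]

end Frame

end IsMetricOn

end MixedCurrent

end SuperEnergy

/-! ### The local conservation law -/

namespace SuperEnergy

section LocalTheorem

variable {n : ℕ} {g : Coord n → Matrix (Fin n) (Fin n) ℝ} {U : Set (Coord n)} {y : Coord n}
  {φ : Coord n → ℝ}

/-- The square `∇_c φ ∇^c φ` of the gradient. -/
noncomputable def gradSq (g : Coord n → Matrix (Fin n) (Fin n) ℝ) (φ : Coord n → ℝ)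
    (y : Coord n) : ℝ := ∑ c, ∑ d, (g y)⁻¹ c d * (pd c φ y * pd d φ y)

/-- The function `f` in `R_{ab} = ∇_a φ ∇_b φ + f g_{ab}`. -/
noncomputable def ricciDefect (g : Coord n → Matrix (Fin n) (Fin n) ℝ) (φ : Coord n → ℝ)
    (y : Coord n) : ℝ := (1 / 2) * (scalarCurvature g y - gradSq g φ y)

theorem EinsteinKleinGordonAt.ricci_eq (h : EinsteinKleinGordonAt g φ y) (a b : Fin n) :
    ricci g y a b = pd a φ y * pd b φ y + ricciDefect g φ y * g y a b := by
  have h := h.1 a b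
  rw [energyMomentum] at h
  rw [ricciDefect, gradSq]
  linear_combination h

namespace IsMetricOn

variable (hg : IsMetricOn g U)
include hg

theorem smooth_gradSq (hy : y ∈ U) (hφ : ContDiffAt ℝ ∞ φ y) :
    ContDiffAt ℝ ∞ (gradSq g φ) y :=
  contDiffAt_contr (Z := fun z c d => pd c φ z * pd d φ z) (hg.smooth_inv hy)
    fun c d => (contDiffAt_pd c hφ).mul (contDiffAt_pd d hφ)

theorem smooth_ricciDefect (hy : y ∈ U) (hφ : ContDiffAt ℝ ∞ φ y) :
    ContDiffAt ℝ ∞ (ricciDefect g φ) y :=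
  contDiffAt_const.mul ((hg.smooth_scalarCurvature hy).sub (hg.smooth_gradSq hy hφ))

/-- The trace of R_{ab} = φ_a φ_b + f g_{ab} gives R = |∇φ|² + n f, while 2f = R − |∇φ|² by
definition; hence (n − 2) f = 0. -/
theorem ricciDefect_eq_zero (hn : n ≠ 2) (hy : y ∈ U) (h : EinsteinKleinGordonAt g φ y) :
    ricciDefect g φ y = 0 := by
  have h₁ : scalarCurvature g y = gradSq g φ y + ricciDefect g φ y * n := by
    have ht : ∑ a, ∑ b, (g y)⁻¹ a b * g y a b = n := by
      have h := congrArg Matrix.trace (hg.inv_mul hy)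
      rw [Matrix.trace_one, Fintype.card_fin, Matrix.trace] at h
      rw [← h]
      simp only [Matrix.diag_apply, Matrix.mul_apply]
      exact Finset.sum_congr rfl fun a _ => Finset.sum_congr rfl fun b _ => by
        rw [hg.symm_apply hy]
    rw [← ht]
    simp only [scalarCurvature, gradSq, h.ricci_eq, mul_add, Finset.sum_add_distrib,
      Finset.mul_sum]
    congr 1
    exact Finset.sum_congr rfl fun a _ => Finset.sum_congr rfl fun b _ => by ring
  have h₂ : ricciDefect g φ y * ((n : ℝ) - 2) = 0 := by
    have h₃ : 2 * ricciDefect g φ y = scalarCurvature g y - gradSq g φ y := by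
      rw [ricciDefect]; ring
    linear_combination - h₁ - h₃
  refine (mul_eq_zero.1 h₂).resolve_right fun h => hn ?_
  exact_mod_cast sub_eq_zero.1 h

section Frame

variable {P : Matrix (Fin n) (Fin n) ℝ} {η ε : Fin n → ℝ} (hy : y ∈ U)
  (hP : P.transpose * g y * P = Matrix.diagonal η) (hη : ∀ i, ε i * η i = 1)
  (hφ : ∀ z ∈ U, ContDiffAt ℝ ∞ φ z)

omit hg in
theorem ev2_ricci {z : Coord n} (h : EinsteinKleinGordonAt g φ z) (u w : Fin n → ℝ) :
    ev2 (ricci g z) u w = ev1 (fun a => pd a φ z) u * ev1 (fun a => pd a φ z) w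
      + ricciDefect g φ z * ev2 (fun a b => g z a b) u w := by
  rw [ev1_mul_ev1]
  simp only [ev2, ev1, h.ricci_eq, mul_add, Finset.sum_add_distrib, Finset.mul_sum]
  congr 1
  exact Finset.sum_congr rfl fun a _ => Finset.sum_congr rfl fun b _ => by ring

include hy hP hη hφ

theorem sum_mul_pd_gradSq (v : Fin n → ℝ) :
    ∑ m, v m * pd m (gradSq g φ) y = 2 * wsum ε fun r =>
      ev1 (fun a => pd a φ y) (colVec P r) * ev2 (hess g φ y) v (colVec P r) := by
  have h := Jet.contr (hg.jet_lineGram_inv hy hP hη v) fun r r' =>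
    (jet_gradient (g := g) hy hφ P v r).mul (jet_gradient (g := g) hy hφ P v r')
  have h' := (Jet.of_line ((hg.smooth_gradSq hy (hφ y hy)).differentiableAt (by simp)) v).unique h
    (by
      filter_upwards [hg.eventually_inv_eq hy hP hη v] with t ht
      rw [← contr_stdVec ht (β := fun p q => ev1 (fun a => pd a φ (line y v t)) p *
        ev1 (fun a => pd a φ (line y v t)) q) (fun _ => isLinearMap_mul_const (isLinearMap_ev1 _) _)
        (fun _ => isLinearMap_const_mul _ (isLinearMap_ev1 _))]
      simp only [ev1_stdVec]
      rfl)
  rw [h', mul_wsum]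
  exact wsum_congr fun r => by ring

/-- The Einstein equations hold along the whole line, so they may be differentiated; the left side
is the trace of ∇Riem by `jet_ricci`. -/
theorem wsum_covRiemann (hE : ∀ z ∈ U, EinsteinKleinGordonAt g φ z) (v : Fin n → ℝ)
    (i j : Fin n) :
    wsum ε (fun a => ev5 (covRiemann g y) v (colVec P a) (colVec P i) (colVec P a) (colVec P j))
      = ev2 (hess g φ y) v (colVec P i) * ev1 (fun a => pd a φ y) (colVec P j)
        + ev1 (fun a => pd a φ y) (colVec P i) * ev2 (hess g φ y) v (colVec P j)
        + (∑ m, v m * pd m (ricciDefect g φ) y) * if i = j then η i else 0 := by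
  have h := ((jet_gradient (g := g) hy hφ P v i).mul (jet_gradient (g := g) hy hφ P v j)).add
    ((Jet.of_line ((hg.smooth_ricciDefect hy (hφ y hy)).differentiableAt (by simp)) v).mul
    (hg.jet_lineGram hy hP v i j))
  rw [(hg.jet_ricci hy hP hη v i j).unique h ?_]
  · ring
  · filter_upwards [hg.eventually_line_mem hy v] with t ht
    rw [ev2_ricci (hE _ ht), ev2_colVec]
    rfl

/-- The wave equation, differentiated along the line. -/
theorem wsum_covHess (hE : ∀ z ∈ U, EinsteinKleinGordonAt g φ z) (v : Fin n → ℝ) :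
    wsum ε (fun i => ev3 (covHess g φ y) v (colVec P i) (colVec P i)) = 0 := by
  have h := Jet.contr (hg.jet_lineGram_inv hy hP hη v) (hg.jet_hess hy hφ P v)
  refine h.unique (Jet.const 0) ?_
  filter_upwards [hg.eventually_inv_eq hy hP hη v, hg.eventually_line_mem hy v] with t ht hU
  rw [contr_ev2 ht]
  exact (hE _ hU).2

end Frame

/-- The mixed current of the Bel tensor and the scalar superenergy tensor is divergence-free. -/
theorem divergence_mixed (hφ : ∀ z ∈ U, ContDiffAt ℝ ∞ φ z)
    (hE : ∀ z ∈ U, EinsteinKleinGordonAt g φ z) {ξ : Coord n → Fin n → ℝ}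
    (hξ : ∀ z ∈ U, ∀ i, ContDiffAt ℝ ∞ (fun z => ξ z i) z) (hK : ∀ z ∈ U, KillingAt g ξ z)
    (hy : y ∈ U) (hξφ : ∑ i, ξ y i * pd i φ y = 0) :
    divergence g (current g (fun z a b l m => bel g z a b l m + scalarSuperEnergy g φ z a b l m) ξ)
      y = 0 := by
  obtain ⟨P, η, ε, hP, hη⟩ := exists_orthogonal_frame (hg.symm y hy) (hg.det_ne y hy)
  rw [hg.divergence_mixed_eq hy hP hη hφ (hξ y hy) rfl rfl rfl rfl rfl rfl]
  have hric : ∀ b d, wsum ε (fun a => ev4 (riemann g y) (colVec P a) (colVec P b) (colVec P a)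
      (colVec P d)) = ev1 (fun a => pd a φ y) (colVec P b) * ev1 (fun a => pd a φ y) (colVec P d)
      + ricciDefect g φ y * if b = d then η b else 0 := by
    intro b d
    rw [wsum_riemann hg hy hP hη, ev2_ricci (hE y hy), ev2_colVec, hP, Matrix.diagonal_apply]
  have hsym : ∀ u v, ev2 (hess g φ y) u v = ev2 (hess g φ y) v u := by
    intro u v
    rw [ev2_swap]
    congr 1
    funext a b
    exact hg.hess_symm hy hφ b a
  have hgrad : ∑ m, ξ y m * pd m (gradSq g φ) y = 2 * wsum ε fun r =>
      ev1 (fun a => pd a φ y) (colVec P r) * wsum ε fun l =>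
        ev1 (lower g ξ y) (colVec P l) * ev2 (hess g φ y) (colVec P l) (colVec P r) := by
    rw [hg.sum_mul_pd_gradSq hy hP hη hφ]
    congr 1
    refine wsum_congr fun r => ?_
    congr 1
    rw [ev2_swap]
    simp only [ev2_swap (hess g φ y) (colVec P _) (colVec P r)]
    have h := hg.wsum_lower hy hP hη ξ fun a => ev1 (fun b => hess g φ y a b) (colVec P r)
    rw [← ev2_swap]
    simp only [← ev2_swap]
    exact h.symm
  -- Since ξ annihilates R, the derivatives along ξ of f and of |∇φ|² are proportional.
  have hdef : ∑ m, ξ y m * pd m (ricciDefect g φ) y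
      = - (1 / 2) * ∑ m, ξ y m * pd m (gradSq g φ) y := by
    have h₀ := hg.sum_killing_pd_scalarCurvature hξ hK hy
    have h₁ : ∀ m, pd m (ricciDefect g φ) y
        = (1 / 2) * (pd m (scalarCurvature g) y - pd m (gradSq g φ) y) := by
      intro m
      have ds := (hg.smooth_scalarCurvature hy).differentiableAt (by simp)
      have dg := (hg.smooth_gradSq hy (hφ y hy)).differentiableAt (by simp)
      have h := pd_mul (f := fun _ => (1 / 2 : ℝ)) m (differentiableAt_const _) (ds.sub dg)
      rw [pd_const, zero_mul, zero_add] at h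
      refine h.trans ?_
      congr 1
      exact pd_sub m ds dg
    simp only [h₁, mul_sub, Finset.sum_sub_distrib, mul_left_comm _ (1 / 2 : ℝ),
      ← Finset.mul_sum, h₀]
    ring
  -- One of the two derivatives suffices. For n = 2 the gradient vanishes at y, which handles |∇φ|²;
  -- otherwise f vanishes near y. In this way invariance of φ is required only at the point itself.
  have hboth : ∑ m, ξ y m * pd m (ricciDefect g φ) y = 0
      ∧ ∑ m, ξ y m * pd m (gradSq g φ) y = 0 := by
    by_cases hn : n = 2
    · subst hn
      have h := frame_gradient_eq_zero_of_two hη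
        ((hg.curvatureSymm_riemann hy).ev4 (colVec P)) hric
      have h' : ∑ m, ξ y m * pd m (gradSq g φ) y = 0 := by
        rw [hgrad]
        simp only [fun r => congrFun h r, Pi.zero_apply, zero_mul, wsum_zero, mul_zero]
      exact ⟨by rw [hdef, h', mul_zero], h'⟩
    · have h : ∑ m, ξ y m * pd m (ricciDefect g φ) y = 0 :=
        Finset.sum_eq_zero fun m _ => by
          have h : pd m (ricciDefect g φ) y = pd m (fun _ => 0) y :=
            pd_congr m ((hg.eventually_mem hy).mono fun z hz =>
              hg.ricciDefect_eq_zero hn hz (hE z hz))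
          rw [h, pd_const, mul_zero]
      exact ⟨h, by rw [hdef] at h; linarith⟩
  refine frame_divergence_mixed hη ((hg.curvatureSymm_riemann hy).ev4 (colVec P))
    (fun m => CurvatureSymm.ev5 (hg.curvatureSymm_covRiemann hy) (colVec P) (colVec P m))
    (fun m a b c d => ev5_cyclic (hg.covRiemann_cyclic hy) _ _ _ _ _)
    (φ := fun i => ev1 (fun a => pd a φ y) (colVec P i)) (f := ricciDefect g φ y)
    (f' := fun i => ev1 (fun m => pd m (ricciDefect g φ) y) (colVec P i))
    (fun i j => hsym _ _) (fun m i j => ?_) (fun k i j => ?_)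
    (fun m => hg.wsum_covHess hy hP hη hφ hE _) hric
    (fun m b d => hg.wsum_covRiemann hy hP hη hφ hE _ b d) ?_ ?_ ?_ (fun i j => ?_)
  · rw [ev3_swap_right]
    congr 1
    funext a b c
    exact hg.covHess_symm hy hφ a c b
  · rw [hg.covHess_comm_frame hy hφ (inv_eq_frame hP hη), contr_diagonal]
  · exact (hg.wsum_lower hy hP hη ξ _).trans hξφ
  · exact (hg.wsum_lower hy hP hη ξ _).trans hboth.1
  · have h := hboth.2
    rw [hgrad] at h
    linarith
  · rw [ev2_swap, ← ev2_neg]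
    congr 1
    funext a b
    exact eq_neg_of_add_eq_zero_left (hK y hy b a)

end IsMetricOn

end LocalTheorem

end SuperEnergy

namespace SuperEnergy

/-! ### Manifolds in charts -/

section Chart

variable {n : ℕ} {M : Type*} [TopologicalSpace M] [ChartedSpace (Coord n) M]
  [IsManifold (𝓡 n) ∞ M] {e : OpenPartialHomeomorph M (Coord n)} (he : e ∈ atlas (Coord n) M)
include he

theorem contMDiffOn_chart : ContMDiffOn (𝓡 n) (𝓡 n) ∞ e e.source :=
  contMDiffOn_of_mem_maximalAtlas (IsManifold.subset_maximalAtlas he)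

theorem contMDiffOn_chart_symm : ContMDiffOn (𝓡 n) (𝓡 n) ∞ e.symm e.target :=
  contMDiffOn_symm_of_mem_maximalAtlas (IsManifold.subset_maximalAtlas he)

theorem contMDiffOn_coordVector (i : Fin n) :
    ContMDiffOn (𝓡 n) (𝓡 n).tangent ∞
      (fun y => (⟨e.symm y, coordVector e y i⟩ : TangentBundle (𝓡 n) M)) e.target := by
  have h := (contMDiffOn_chart_symm he).contMDiffOn_tangentMapWithin (m := ∞) (by simp)
    e.open_target.uniqueMDiffOn
  have hs : ContMDiff (𝓡 n) (𝓡 n).tangent ∞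
      (fun y : Coord n => (⟨y, (EuclideanSpace.single i (1 : ℝ) : Coord n)⟩ :
        TangentBundle (𝓡 n) (Coord n))) :=
    contMDiff_vectorSpace_iff_contDiff.2 contDiff_const
  refine (h.comp hs.contMDiffOn (fun y hy => hy)).congr fun y hy => ?_
  simp only [Function.comp, tangentMapWithin, coordVector]
  rw [mfderivWithin_of_isOpen e.open_target hy]

theorem mfderiv_symm_comp {y : Coord n} (hy : y ∈ e.target) (v : TangentSpace (𝓡 n) (e.symm y)) :
    mfderiv (𝓡 n) (𝓡 n) e.symm y (mfderiv (𝓡 n) (𝓡 n) e (e.symm y) v) = v := by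
  have h := (mdifferentiable_of_mem_atlas (I := 𝓡 n) he).symm_comp_deriv (e.map_target hy)
  rw [e.right_inv hy] at h
  exact congrArg (fun L => L v) h

theorem mfderiv_comp_symm {y : Coord n} (hy : y ∈ e.target) (v : TangentSpace (𝓡 n) y) :
    mfderiv (𝓡 n) (𝓡 n) e (e.symm y) (mfderiv (𝓡 n) (𝓡 n) e.symm y v) = v :=
  congrArg (fun L => L v) ((mdifferentiable_of_mem_atlas (I := 𝓡 n) he).comp_symm_deriv hy)

omit he [IsManifold (𝓡 n) ∞ M] in
theorem mfderiv_symm_eq_sum (y : Coord n) (v : Coord n) :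
    mfderiv (𝓡 n) (𝓡 n) e.symm y v = ∑ i, v i • coordVector e y i := by
  have hv : v = ∑ i, v i • (EuclideanSpace.single i (1 : ℝ) : Coord n) := by
    ext b
    simp [Finset.sum_apply, Pi.single_apply]
  conv_lhs => rw [hv]
  have h := map_sum (mfderiv (𝓡 n) (𝓡 n) e.symm y)
    (fun i => v i • (EuclideanSpace.single i (1 : ℝ) : Coord n)) Finset.univ
  refine h.trans (Finset.sum_congr rfl fun i _ => ?_)
  exact map_smul (mfderiv (𝓡 n) (𝓡 n) e.symm y) (v i) _

theorem eq_sum_coordVector {y : Coord n} (hy : y ∈ e.target) (v : TangentSpace (𝓡 n) (e.symm y)) :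
    v = ∑ i, (show Coord n from mfderiv (𝓡 n) (𝓡 n) e (e.symm y) v).ofLp i • coordVector e y i :=
  (mfderiv_symm_comp he hy v).symm.trans (mfderiv_symm_eq_sum y _)

/-- An entry is the metric section evaluated on two smooth coordinate fields along the inverse
chart, that is, a smooth section of a trivial line bundle, whose fibre part is read off. -/
theorem smoothEntries_inChart (g : LorentzMetric n M) {y : Coord n} (hy : y ∈ e.target) :
    SmoothEntries (g.inChart e) y := fun i j => by
  have hb : ContMDiffAt (𝓡 n) (𝓡 n) ∞ e.symm y :=
    (contMDiffOn_chart_symm he).contMDiffAt (e.open_target.mem_nhds hy)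
  have hv := fun i => (contMDiffOn_coordVector he i).contMDiffAt (e.open_target.mem_nhds hy)
  have h : ContMDiffAt (𝓡 n) ((𝓡 n).prod 𝓘(ℝ)) ∞
      (fun z => Bundle.TotalSpace.mk' ℝ (E := Bundle.Trivial M ℝ) (e.symm z)
        (g.val (e.symm z) (coordVector e z i) (coordVector e z j))) y := by
    apply ContMDiffAt.clm_bundle_apply₂ (F₁ := Coord n) (F₂ := Coord n)
    · exact g.contMDiff.contMDiffAt.comp y hb
    · exact hv i
    · exact hv j
  simp only [Bundle.contMDiffAt_totalSpace] at h
  exact h.2.contDiffAt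

theorem isMetricOn_inChart (g : LorentzMetric n M) : IsMetricOn (g.inChart e) e.target where
  isOpen := e.open_target
  smooth _ hy := smoothEntries_inChart he g hy
  symm y _ := by
    ext i j
    exact g.symm _ _ _
  det_ne y hy := by
    intro hdet
    obtain ⟨w, hw, hG⟩ := Matrix.exists_mulVec_eq_zero_iff.2 hdet
    set v : TangentSpace (𝓡 n) (e.symm y) :=
      mfderiv (𝓡 n) (𝓡 n) e.symm y (WithLp.toLp 2 w : Coord n) with hv
    have hv₀ : v ≠ 0 := by
      intro h₀
      have h := mfderiv_comp_symm he hy (WithLp.toLp 2 w : Coord n)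
      rw [← hv, h₀, map_zero] at h
      exact hw (congrArg (fun u : Coord n => u.ofLp) h.symm)
    have hcoord : ∀ i, g.val (e.symm y) (coordVector e y i) v = 0 := by
      intro i
      rw [hv, mfderiv_symm_eq_sum, map_sum]
      refine Eq.trans (Finset.sum_congr rfl fun j _ => ?_) (congrFun hG i)
      rw [map_smul, smul_eq_mul, mul_comm]
      rfl
    have hall : ∀ u, g.val (e.symm y) u v = 0 := by
      intro u
      rw [eq_sum_coordVector he hy u, map_sum, _root_.sum_apply]
      exact Finset.sum_eq_zero fun i _ => by
        rw [map_smul, _root_.smul_apply, hcoord, smul_zero]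
    -- A vector in the radical is orthogonal to the timelike u, so it would have positive square,
    -- and also to itself.
    obtain ⟨u, -, hu⟩ := g.lorentzian (e.symm y)
    exact (hu v (hall u) hv₀).ne' (hall v)

theorem smooth_funInChart {φ : M → ℝ} (hφ : ContMDiff (𝓡 n) 𝓘(ℝ, ℝ) ∞ φ) {y : Coord n}
    (hy : y ∈ e.target) : ContDiffAt ℝ ∞ (funInChart φ e) y :=
  (hφ.contMDiffAt.comp y
    ((contMDiffOn_chart_symm he).contMDiffAt (e.open_target.mem_nhds hy))).contDiffAt

theorem smooth_vecInChart {ξ : ∀ p : M, TangentSpace (𝓡 n) p} (hξ : SmoothVectorField ξ)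
    {y : Coord n} (hy : y ∈ e.target) (i : Fin n) :
    ContDiffAt ℝ ∞ (fun z => vecInChart ξ e z i) y := by
  have h := (contMDiffOn_chart he).contMDiffOn_tangentMapWithin (m := ∞) (by simp)
    e.open_source.uniqueMDiffOn
  have h₁ := (hξ.comp_contMDiffOn (contMDiffOn_chart_symm he))
  have h₂ := (contMDiff_snd_tangentBundle_modelSpace (Coord n) (𝓡 n)).comp_contMDiffOn
    (h.comp h₁ fun z hz => e.map_target hz)
  have h₃ : ContMDiffOn (𝓡 n) 𝓘(ℝ, Coord n) ∞
      (fun z => (mfderiv (𝓡 n) (𝓡 n) e (e.symm z) (ξ (e.symm z)) : Coord n)) e.target := by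
    refine h₂.congr fun z hz => ?_
    simp only [Function.comp, tangentMapWithin]
    rw [mfderivWithin_of_isOpen e.open_source (e.map_target hz)]
  have h₄ := (h₃.contMDiffAt (e.open_target.mem_nhds hy)).contDiffAt
  exact (EuclideanSpace.proj (𝕜 := ℝ) i).contDiff.contDiffAt.comp y h₄

/-- The chain rule: the coordinate derivative along ξ is the invariant one, which links the
hypothesis on the manifold to the local theorem. -/
theorem sum_vecInChart_pd {φ : M → ℝ} (hφ : ContMDiff (𝓡 n) 𝓘(ℝ, ℝ) ∞ φ)
    (ξ : ∀ p : M, TangentSpace (𝓡 n) p) {y : Coord n} (hy : y ∈ e.target) :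
    ∑ i, vecInChart ξ e y i * pd i (funInChart φ e) y
      = mfderiv (𝓡 n) 𝓘(ℝ, ℝ) φ (e.symm y) (ξ (e.symm y)) := by
  have h₁ := mfderiv_comp (I := 𝓡 n) (I' := 𝓡 n) (I'' := 𝓘(ℝ, ℝ)) y
    (hφ.mdifferentiable (by simp) (e.symm y))
    (((contMDiffOn_chart_symm he).contMDiffAt (e.open_target.mem_nhds hy)).mdifferentiableAt
      (by simp))
  have h₂ : ∀ i, pd i (funInChart φ e) y
      = mfderiv (𝓡 n) 𝓘(ℝ, ℝ) φ (e.symm y) (coordVector e y i) := by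
    intro i
    rw [pd, ← mfderiv_eq_fderiv]
    exact congrArg (fun L => L (EuclideanSpace.single i (1 : ℝ) : Coord n)) h₁
  conv_rhs => rw [eq_sum_coordVector he hy (ξ (e.symm y)), map_sum]
  refine Finset.sum_congr rfl fun i _ => ?_
  rw [map_smul, h₂]
  rfl

/-- The mixed current of a massless scalar field is divergence-free where `ξ` leaves the field
invariant. -/
theorem divMixedCurrent_eq_zero {g : LorentzMetric n M} {φ : M → ℝ}
    {ξ : ∀ p : M, TangentSpace (𝓡 n) p} (hφ : ContMDiff (𝓡 n) 𝓘(ℝ, ℝ) ∞ φ)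
    (hξ : SmoothVectorField ξ) (hE : EinsteinKleinGordon g φ) (hK : IsKilling g ξ) {p : M}
    (hp : mfderiv (𝓡 n) 𝓘(ℝ, ℝ) φ p (ξ p) = 0) (hpe : p ∈ e.source) :
    divMixedCurrent g φ ξ e p = 0 := by
  refine (isMetricOn_inChart he g).divergence_mixed (fun z hz => smooth_funInChart he hφ hz)
    (hE e he) (fun z hz i => smooth_vecInChart he hξ hz i) (hK e he) (e.map_source hpe) ?_
  rw [sum_vecInChart_pd he hφ ξ (e.map_source hpe), e.left_inv hpe]
  exact hp

end Chart

end SuperEnergy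

namespace SuperEnergy

/-! ### A solution for which neither current is conserved -/

section Coordinates

theorem pd_coord {n : ℕ} (i j : Fin n) (y : Coord n) :
    pd i (fun z => z j) y = if j = i then 1 else 0 := by
  have h : pd i (fun z : Coord n => z j) y
      = (EuclideanSpace.proj (𝕜 := ℝ) j : Coord n →L[ℝ] ℝ) (EuclideanSpace.single i 1) := by
    rw [pd]
    congr 1
    exact (EuclideanSpace.proj (𝕜 := ℝ) j : Coord n →L[ℝ] ℝ).fderiv
  rw [h]
  simp

theorem pd_comp {n : ℕ} {f : ℝ → ℝ} {f' : ℝ} {h : Coord n → ℝ} {y : Coord n} (i : Fin n)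
    (hf : HasDerivAt f f' (h y)) (hh : DifferentiableAt ℝ h y) :
    pd i (fun z => f (h z)) y = f' * pd i h y := by
  have h : fderiv ℝ (fun z => f (h z)) y = f' • fderiv ℝ h y :=
    (hf.comp_hasFDerivAt y hh.hasFDerivAt).fderiv
  rw [pd, h]
  rfl

variable {m : ℕ}

/-- A family indexed by four special indices and `m` further ones. -/
def fourAnd {α : Type*} (x₀ x₁ x₂ x₃ : α) (f : Fin m → α) : Fin (m + 4) → α :=
  Fin.cons x₀ (Fin.cons x₁ (Fin.cons x₂ (Fin.cons x₃ f : Fin (m + 1) → α) : Fin (m + 2) → α) :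
    Fin (m + 3) → α)

section FourAnd

variable {α : Type*} (x₀ x₁ x₂ x₃ : α) (f : Fin m → α)

theorem fourAnd_zero : fourAnd x₀ x₁ x₂ x₃ f 0 = x₀ := rfl

theorem fourAnd_one : fourAnd x₀ x₁ x₂ x₃ f 1 = x₁ := rfl

theorem fourAnd_two : fourAnd x₀ x₁ x₂ x₃ f 2 = x₂ := rfl

theorem fourAnd_three : fourAnd x₀ x₁ x₂ x₃ f 3 = x₃ := rfl

theorem fourAnd_addNat (k : Fin m) : fourAnd x₀ x₁ x₂ x₃ f (k.addNat 4) = f k := rfl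

end FourAnd

theorem sum_fourAnd (f : Fin (m + 4) → ℝ) :
    ∑ a, f a = f 0 + (f 1 + (f 2 + (f 3 + ∑ k : Fin m, f (k.addNat 4)))) := by
  rw [Fin.sum_univ_succ, Fin.sum_univ_succ, Fin.sum_univ_succ, Fin.sum_univ_succ]
  rfl

theorem fourAnd_cases {p : Fin (m + 4) → Prop} (h₀ : p 0) (h₁ : p 1) (h₂ : p 2) (h₃ : p 3)
    (h : ∀ k : Fin m, p (k.addNat 4)) (a : Fin (m + 4)) : p a := by
  refine Fin.cases h₀ (fun a => ?_) a
  refine Fin.cases h₁ (fun a => ?_) a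
  refine Fin.cases h₂ (fun a => ?_) a
  refine Fin.cases h₃ (fun a => ?_) a
  exact h a

theorem one_eq_fourAnd : (1 : Matrix (Fin (m + 4)) (Fin (m + 4)) ℝ) = Matrix.of (fourAnd
    (fourAnd 1 0 0 0 fun _ => 0) (fourAnd 0 1 0 0 fun _ => 0) (fourAnd 0 0 1 0 fun _ => 0)
    (fourAnd 0 0 0 1 fun _ => 0) fun k => fourAnd 0 0 0 0 fun l => if k = l then 1 else 0) := by
  ext a b
  rw [Matrix.one_apply]
  revert a b
  refine fourAnd_cases ?_ ?_ ?_ ?_ fun k => ?_ <;> refine fourAnd_cases ?_ ?_ ?_ ?_ fun l => ?_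
  all_goals first
    | rfl
    | simp [fourAnd_addNat]

variable (y : Coord (m + 4)) (i : Fin (m + 4))

theorem pd_coord_zero : pd i (fun z => z 0) y = fourAnd 1 0 0 0 (fun _ => 0) i := by
  rw [pd_coord]
  revert i
  refine fourAnd_cases ?_ ?_ ?_ ?_ fun k => ?_ <;> simp only [fourAnd_zero, fourAnd_one, fourAnd_two,
    fourAnd_three, fourAnd_addNat] <;> rfl

theorem pd_coord_one : pd i (fun z => z 1) y = fourAnd 0 1 0 0 (fun _ => 0) i := by
  rw [pd_coord]
  revert i
  refine fourAnd_cases ?_ ?_ ?_ ?_ fun k => ?_ <;> simp only [fourAnd_zero, fourAnd_one, fourAnd_two,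
    fourAnd_three, fourAnd_addNat] <;> rfl

theorem pd_coord_three : pd i (fun z => z 3) y = fourAnd 0 0 0 1 (fun _ => 0) i := by
  rw [pd_coord]
  revert i
  refine fourAnd_cases ?_ ?_ ?_ ?_ fun k => ?_ <;> simp only [fourAnd_zero, fourAnd_one, fourAnd_two,
    fourAnd_three, fourAnd_addNat] <;> rfl

theorem pd_exp : pd i (fun z => Real.exp (z 0)) y
    = Real.exp (y 0) * fourAnd 1 0 0 0 (fun _ => 0) i := by
  rw [pd_comp i (Real.hasDerivAt_exp _) (by fun_prop), pd_coord_zero]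

theorem pd_exp_neg : pd i (fun z => Real.exp (-z 0)) y
    = - Real.exp (-y 0) * fourAnd 1 0 0 0 (fun _ => 0) i := by
  rw [pd_comp (f := fun t => Real.exp (-t)) (f' := - Real.exp (-y 0)) i
    (by simpa using (hasDerivAt_neg (y 0)).exp) (by fun_prop), pd_coord_zero]

end Coordinates

/-- The metric `e^{2w} dw² + e^w (2 du dv + w (y - u) du²) + dy² + dz²`. -/
noncomputable def waveMetric (m : ℕ) (y : Coord (m + 4)) :
    Matrix (Fin (m + 4)) (Fin (m + 4)) ℝ :=
  Matrix.of <| fourAnd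
    (fourAnd (Real.exp (y 0) * Real.exp (y 0)) 0 0 0 fun _ => 0)
    (fourAnd 0 (Real.exp (y 0) * (y 0 * (y 3 - y 1))) (Real.exp (y 0)) 0 fun _ => 0)
    (fourAnd 0 (Real.exp (y 0)) 0 0 fun _ => 0)
    (fourAnd 0 0 0 1 fun _ => 0)
    fun k => fourAnd 0 0 0 0 fun l => if k = l then 1 else 0

/-- The inverse of the metric `waveMetric`. -/
noncomputable def waveInverse (m : ℕ) (y : Coord (m + 4)) :
    Matrix (Fin (m + 4)) (Fin (m + 4)) ℝ :=
  Matrix.of <| fourAnd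
    (fourAnd (Real.exp (-y 0) * Real.exp (-y 0)) 0 0 0 fun _ => 0)
    (fourAnd 0 0 (Real.exp (-y 0)) 0 fun _ => 0)
    (fourAnd 0 (Real.exp (-y 0)) (- (Real.exp (-y 0) * (y 0 * (y 3 - y 1)))) 0 fun _ => 0)
    (fourAnd 0 0 0 1 fun _ => 0)
    fun k => fourAnd 0 0 0 0 fun l => if k = l then 1 else 0

/-- The Christoffel symbols of the metric `waveMetric`. -/
noncomputable def waveChristoffel (m : ℕ) (y : Coord (m + 4)) (a b c : Fin (m + 4)) : ℝ :=
  fourAnd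
    (fourAnd
      (fourAnd 1 0 0 0 fun _ => 0)
      (fourAnd 0 (- (1 / 2) * (Real.exp (-y 0) * ((y 0 + 1) * (y 3 - y 1))))
        (- (1 / 2) * Real.exp (-y 0)) 0 fun _ => 0)
      (fourAnd 0 (- (1 / 2) * Real.exp (-y 0)) 0 0 fun _ => 0)
      (fun _ => 0) fun _ _ => 0)
    (fourAnd (fourAnd 0 (1 / 2) 0 0 fun _ => 0) (fourAnd (1 / 2) 0 0 0 fun _ => 0)
      (fun _ => 0) (fun _ => 0) fun _ _ => 0)
    (fourAnd
      (fourAnd 0 ((1 / 2) * (y 3 - y 1)) (1 / 2) 0 fun _ => 0)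
      (fourAnd ((1 / 2) * (y 3 - y 1)) (- (1 / 2) * y 0) 0 ((1 / 2) * y 0) fun _ => 0)
      (fourAnd (1 / 2) 0 0 0 fun _ => 0)
      (fourAnd 0 ((1 / 2) * y 0) 0 0 fun _ => 0) fun _ _ => 0)
    (fourAnd (fun _ => 0) (fourAnd 0 (- (1 / 2) * (Real.exp (y 0) * y 0)) 0 0 fun _ => 0)
      (fun _ => 0) (fun _ => 0) fun _ _ => 0)
    (fun _ _ _ => 0) a b c

section Wave

variable {m : ℕ} (y : Coord (m + 4))

theorem waveMetric_mul_inverse : waveMetric m y * waveInverse m y = 1 := by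
  have hE : Real.exp (y 0) * Real.exp (-y 0) = 1 := by rw [← Real.exp_add]; simp
  rw [one_eq_fourAnd]
  ext a b
  rw [Matrix.mul_apply]
  revert a b
  refine fourAnd_cases ?_ ?_ ?_ ?_ fun k => ?_ <;> refine fourAnd_cases ?_ ?_ ?_ ?_ fun l => ?_ <;>
    simp [sum_fourAnd, waveMetric, waveInverse, fourAnd_zero, fourAnd_one, fourAnd_two,
      fourAnd_three, fourAnd_addNat]
  all_goals first
    | ring1
    | linear_combination hE
    | linear_combination (Real.exp (y 0) * Real.exp (-y 0) + 1) * hE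

theorem inv_waveMetric : (waveMetric m y)⁻¹ = waveInverse m y :=
  Matrix.inv_eq_right_inv (waveMetric_mul_inverse y)

/-- It is enough to compare the symbols with lowered index, where no inverse metric enters and each
entry is an identity in w, y − u and the exponentials; multiplying by the inverse metric restores
the upper index. -/
theorem christoffel_waveMetric (a b c : Fin (m + 4)) :
    christoffel (waveMetric m) y a b c = waveChristoffel m y a b c := by
  have hE : Real.exp (y 0) * Real.exp (-y 0) = 1 := by rw [← Real.exp_add]; simp
  have key : ∀ d, pd b (fun z => waveMetric m z d c) y + pd c (fun z => waveMetric m z d b) y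
      - pd d (fun z => waveMetric m z b c) y
      = 2 * ∑ e, waveMetric m y d e * waveChristoffel m y e b c := by
    revert b c
    refine fourAnd_cases ?_ ?_ ?_ ?_ fun k => ?_ <;> refine fourAnd_cases ?_ ?_ ?_ ?_ fun l => ?_ <;>
    refine fourAnd_cases ?_ ?_ ?_ ?_ fun p => ?_ <;>
    simp (disch := fun_prop) only [sum_fourAnd, waveMetric, waveChristoffel, fourAnd_zero,
      fourAnd_one, fourAnd_two, fourAnd_three, fourAnd_addNat, Matrix.of_apply, pd_const, pd_mul,
      pd_sub, pd_exp, pd_coord_zero, pd_coord_one, pd_coord_three, mul_zero, zero_mul, add_zero,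
      zero_add, sub_zero, Finset.sum_const_zero, mul_one, one_mul]
    all_goals first
      | ring1
      | linear_combination Real.exp (y 0) * hE
      | linear_combination Real.exp (y 0) * ((y 0 + 1) * (y 3 - y 1)) * hE
  have hi : (waveMetric m y)⁻¹ * waveMetric m y = 1 := by
    rw [inv_waveMetric]
    exact mul_eq_one_comm.1 (waveMetric_mul_inverse y)
  have hv := congrFun (congrArg (fun M => M.mulVec fun e => waveChristoffel m y e b c) hi) a
  simp only [← Matrix.mulVec_mulVec, Matrix.one_mulVec] at hv
  rw [← hv, christoffel]
  simp only [key, Matrix.mulVec, dotProduct, Finset.mul_sum]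
  exact Finset.sum_congr rfl fun d _ => Finset.sum_congr rfl fun e _ => by ring

end Wave

end SuperEnergy

/-! ### Field equations and symmetry of the wave solution -/

namespace SuperEnergy

section WaveCurvature

variable {m : ℕ} (y : Coord (m + 4))

/-- The profile H = w(y − u) could only enter the uu component, through −(1/2) e^{−w}(H_{ww} +
e^{2w} H_{yy}), and it is affine in w and in y. Thus the Ricci tensor is that of the background. -/
theorem ricci_waveMetric (b d : Fin (m + 4)) : ricci (waveMetric m) y b d
    = (1 / 2) * (fourAnd 1 0 0 0 (fun _ => 0) b * fourAnd 1 0 0 0 (fun _ => 0) d) := by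
  simp only [ricci, riemannUp, christoffel_waveMetric]
  revert b d
  refine fourAnd_cases ?_ ?_ ?_ ?_ fun k => ?_ <;> refine fourAnd_cases ?_ ?_ ?_ ?_ fun l => ?_ <;>
  simp (disch := fun_prop) only [sum_fourAnd, waveChristoffel, fourAnd_zero,
    fourAnd_one, fourAnd_two, fourAnd_three, fourAnd_addNat, pd_const, pd_mul, pd_add,
    pd_sub, pd_exp, pd_exp_neg, pd_coord_zero, pd_coord_one, pd_coord_three, mul_zero, zero_mul,
    add_zero, zero_add, sub_zero, sub_self, Finset.sum_const_zero, mul_one, one_mul]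
  all_goals ring1

/-- The scalar field of the solution. -/
noncomputable def waveField (m : ℕ) (y : Coord (m + 4)) : ℝ := Real.sqrt (1 / 2) * y 0

theorem pd_waveField (i : Fin (m + 4)) :
    pd i (waveField m) y = Real.sqrt (1 / 2) * fourAnd 1 0 0 0 (fun _ => 0) i := by
  have h : waveField m = fun z => Real.sqrt (1 / 2) * z 0 := rfl
  rw [h, pd_mul i (by fun_prop) (by fun_prop), pd_const, pd_coord_zero]
  ring

theorem hess_waveField (a b : Fin (m + 4)) : hess (waveMetric m) (waveField m) y a b
    = - Real.sqrt (1 / 2) * waveChristoffel m y 0 a b := by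
  simp only [hess, pd_waveField, pd_const, christoffel_waveMetric, sum_fourAnd, fourAnd_zero,
    fourAnd_one, fourAnd_two, fourAnd_three, fourAnd_addNat]
  simp
  ring

theorem einsteinKleinGordonAt_wave : EinsteinKleinGordonAt (waveMetric m) (waveField m) y := by
  have hs : Real.sqrt (1 / 2) * Real.sqrt (1 / 2) = 1 / 2 := Real.mul_self_sqrt (by norm_num)
  have hr : ∀ a b, ricci (waveMetric m) y a b = pd a (waveField m) y * pd b (waveField m) y := by
    intro a b
    rw [ricci_waveMetric, pd_waveField, pd_waveField]
    linear_combination -(fourAnd 1 0 0 0 (fun _ => 0) a * fourAnd 1 0 0 0 (fun _ => 0) b) * hs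
  refine ⟨fun a b => ?_, ?_⟩
  -- Once R_{ab} = φ_a φ_b, the scalar curvature equals |∇φ|² and the trace parts of both sides
  -- coincide.
  · simp only [scalarCurvature, energyMomentum, hr]
  · simp only [hess_waveField, inv_waveMetric]
    simp only [sum_fourAnd, waveInverse, waveChristoffel, Matrix.of_apply, fourAnd_zero,
      fourAnd_one, fourAnd_two, fourAnd_three, fourAnd_addNat, mul_zero, zero_mul, add_zero,
      zero_add, Finset.sum_const_zero]
    ring

/-- The components of the Killing vector field `∂_u + ∂_y`. -/
def waveVector (m : ℕ) : Fin (m + 4) → ℝ := fourAnd 0 1 0 1 fun _ => 0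

/-- The coefficients depend on u and y only through y − u, so they are invariant under the
simultaneous translation. -/
theorem killingAt_wave : KillingAt (waveMetric m) (fun _ => waveVector m) y := by
  intro a b
  simp only [covDeriv, christoffel_waveMetric]
  revert a b
  refine fourAnd_cases ?_ ?_ ?_ ?_ fun k => ?_ <;> refine fourAnd_cases ?_ ?_ ?_ ?_ fun l => ?_ <;>
  simp (disch := fun_prop) only [sum_fourAnd, waveMetric, waveVector, waveChristoffel, fourAnd_zero,
    fourAnd_one, fourAnd_two, fourAnd_three, fourAnd_addNat, pd_const, pd_mul,
    pd_sub, pd_exp, pd_coord_zero, pd_coord_one, pd_coord_three, mul_zero, zero_mul,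
    add_zero, zero_add, sub_zero, sub_self, Finset.sum_const_zero, mul_one, one_mul,
    Matrix.of_apply]
  all_goals ring1

end WaveCurvature

end SuperEnergy

/-! ### The scalar current of the wave solution -/

namespace SuperEnergy

section CubicCurrent

variable {n : ℕ}

/-- Linearity in each slot turns the triple sum over basis vectors into one evaluation, which keeps
the explicit computation small. -/
theorem sum_cubic {Q : (Fin n → ℝ) → (Fin n → ℝ) → (Fin n → ℝ) → (Fin n → ℝ) → ℝ}
    (hQ : IsQuadrilinear Q) (u x : Fin n → ℝ) :
    ∑ b, ∑ l, ∑ m, Q u (stdVec b) (stdVec l) (stdVec m) * x b * x l * x m = Q u x x x := by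
  rw [← sum_mul_stdVec (hQ.second u x x) x]
  refine Finset.sum_congr rfl fun b _ => ?_
  rw [← sum_mul_stdVec (hQ.third u _ x) x, Finset.mul_sum]
  refine Finset.sum_congr rfl fun l _ => ?_
  rw [← sum_mul_stdVec (hQ.fourth u _ _) x, Finset.mul_sum, Finset.mul_sum]
  exact Finset.sum_congr rfl fun m _ => by ring

theorem current_scalarSuperEnergy (g : Coord n → Matrix (Fin n) (Fin n) ℝ) (φ : Coord n → ℝ)
    (ξ : Coord n → Fin n → ℝ) (y : Coord n) (a : Fin n) :
    current g (scalarSuperEnergy g φ) ξ y a = ∑ c, (g y)⁻¹ a c *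
      scalarForm (ev2 fun i j => g y i j) (g y)⁻¹ stdVec (ev2 (hess g φ y)) (stdVec c)
        (ξ y) (ξ y) (ξ y) := by
  rw [IsMetricOn.current_eq]
  refine Finset.sum_congr rfl fun c _ => ?_
  simp only [scalarSuperEnergy_eq_scalarForm]
  rw [sum_cubic (isQuadrilinear_scalarForm (isLinearMap_ev2_left _) (isLinearMap_ev2_right _)
    (isLinearMap_ev2_left _) (isLinearMap_ev2_right _))]

theorem ev2_stdVec_left (h : Fin n → Fin n → ℝ) (a : Fin n) (v : Fin n → ℝ) :
    ev2 h (stdVec a) v = ev1 (h a) v := by rw [ev2, sum_stdVec]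

theorem ev2_stdVec_right (h : Fin n → Fin n → ℝ) (a : Fin n) (u : Fin n → ℝ) :
    ev2 h u (stdVec a) = ev1 (fun b => h b a) u := by
  rw [ev2_swap, ev2_stdVec_left]

end CubicCurrent

section WaveCurrent

variable {m : ℕ} (y : Coord (m + 4))

theorem ev1_waveVector (θ : Fin (m + 4) → ℝ) : ev1 θ (waveVector m) = θ 1 + θ 3 := by
  simp [ev1, waveVector, sum_fourAnd, fourAnd_zero, fourAnd_one, fourAnd_two, fourAnd_three,
    fourAnd_addNat]

/-- The square of the Hessian of the coordinate `w`. -/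
noncomputable def waveSquare (m : ℕ) (y : Coord (m + 4)) : Fin (m + 4) → Fin (m + 4) → ℝ :=
  fourAnd
    (fourAnd (Real.exp (-y 0) ^ 2) 0 0 0 fun _ => 0)
    (fourAnd 0 ((1 / 4) * Real.exp (-y 0) ^ 3 * ((y 3 - y 1) * (y 0 + 2)))
      ((1 / 4) * Real.exp (-y 0) ^ 3) 0 fun _ => 0)
    (fourAnd 0 ((1 / 4) * Real.exp (-y 0) ^ 3) 0 0 fun _ => 0)
    (fun _ => 0) fun _ _ => 0

theorem contr_waveChristoffel (a b : Fin (m + 4)) :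
    contr (waveInverse m y) (fun r r' => waveChristoffel m y 0 a r * waveChristoffel m y 0 b r')
      = waveSquare m y a b := by
  rw [contr]
  revert a b
  refine fourAnd_cases ?_ ?_ ?_ ?_ fun k => ?_ <;> refine fourAnd_cases ?_ ?_ ?_ ?_ fun l => ?_ <;>
  simp only [sum_fourAnd, waveInverse, waveChristoffel, waveSquare, fourAnd_zero,
    fourAnd_one, fourAnd_two, fourAnd_three, fourAnd_addNat, Matrix.of_apply, mul_zero, zero_mul,
    add_zero, zero_add, Finset.sum_const_zero]
  all_goals ring1

theorem contr_waveSquare :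
    contr (waveInverse m y) (waveSquare m y) = (3 / 2) * Real.exp (-y 0) ^ 4 := by
  rw [contr]
  simp only [sum_fourAnd, waveInverse, waveSquare, fourAnd_zero,
    fourAnd_one, fourAnd_two, fourAnd_three, fourAnd_addNat, Matrix.of_apply, mul_zero, zero_mul,
    add_zero, zero_add, Finset.sum_const_zero]
  ring

/-- The Hessian of w annihilates ∂_y, so in Hessian contractions only the ∂_u part of the Killing
field counts. -/
theorem waveChristoffel_three_left (b : Fin (m + 4)) : waveChristoffel m y 0 3 b = 0 := rfl

theorem waveChristoffel_three_right (a : Fin (m + 4)) : waveChristoffel m y 0 a 3 = 0 := by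
  revert a
  exact fourAnd_cases rfl rfl rfl rfl fun _ => rfl

/-- Everything is quadratic in the Hessian of φ = √(1/2) w, which accounts for the overall 1/2. The
sums over indices 1 and 3 are evaluations on ∂_u + ∂_y. -/
theorem scalarForm_wave (c : Fin (m + 4)) :
    scalarForm (ev2 fun i j => waveMetric m y i j) (waveMetric m y)⁻¹ stdVec
      (ev2 (hess (waveMetric m) (waveField m) y)) (stdVec c) (waveVector m) (waveVector m)
      (waveVector m)
    = (1 / 2) * (2 * (waveChristoffel m y 0 c 1 * waveChristoffel m y 0 1 1)
      - (waveMetric m y c 1 + waveMetric m y c 3) * waveSquare m y 1 1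
      - (waveMetric m y 1 1 + waveMetric m y 3 1 + (waveMetric m y 1 3 + waveMetric m y 3 3))
        * waveSquare m y c 1
      + (1 / 2) * (waveMetric m y c 1 + waveMetric m y c 3)
        * (waveMetric m y 1 1 + waveMetric m y 3 1 + (waveMetric m y 1 3 + waveMetric m y 3 3))
        * ((3 / 2) * Real.exp (-y 0) ^ 4)) := by
  have hs : Real.sqrt (1 / 2) * Real.sqrt (1 / 2) = 1 / 2 := Real.mul_self_sqrt (by norm_num)
  have hsq : ∀ a b, contr (waveInverse m y) (fun r r' =>
      (- Real.sqrt (1 / 2) * waveChristoffel m y 0 a r) *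
        (- Real.sqrt (1 / 2) * waveChristoffel m y 0 b r')) = (1 / 2) * waveSquare m y a b := by
    intro a b
    rw [← contr_waveChristoffel]
    simp only [contr, Finset.mul_sum]
    exact Finset.sum_congr rfl fun r _ => Finset.sum_congr rfl fun r' _ => by
      linear_combination (waveInverse m y r r' * (waveChristoffel m y 0 a r *
        waveChristoffel m y 0 b r')) * hs
  have hsq' : contr (waveInverse m y) (fun r r' => (1 / 2) * waveSquare m y r r')
      = (1 / 2) * ((3 / 2) * Real.exp (-y 0) ^ 4) := by
    rw [← contr_waveSquare]
    simp only [contr, Finset.mul_sum]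
    exact Finset.sum_congr rfl fun r _ => Finset.sum_congr rfl fun r' _ => by ring
  have hww : ∀ h : Fin (m + 4) → Fin (m + 4) → ℝ, ev2 h (waveVector m) (waveVector m)
      = h 1 1 + h 3 1 + (h 1 3 + h 3 3) := by
    intro h
    rw [ev2_swap, ev2]
    simp only [ev1_waveVector]
    exact ev1_waveVector _
  simp only [scalarForm, inv_waveMetric, ev2_stdVec_left, ev2_stdVec_right, ev1_stdVec,
    ev1_waveVector, hww, hess_waveField, waveChristoffel_three_left, waveChristoffel_three_right,
    mul_zero, add_zero, hsq, hsq']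
  linear_combination (2 * (waveChristoffel m y 0 c 1 * waveChristoffel m y 0 1 1)) * hs

/-- The scalar current of the solution. -/
theorem current_wave (a : Fin (m + 4)) :
    current (waveMetric m) (scalarSuperEnergy (waveMetric m) (waveField m))
      (fun _ => waveVector m) y a
    = (1 / 2) * fourAnd 0
      ((1 / 2) * Real.exp (-y 0) ^ 4 + (3 / 4) * Real.exp (-y 0) ^ 3 * (y 0 * (y 3 - y 1)))
      ((1 / 2) * Real.exp (-y 0) ^ 3 * (y 3 - y 1) ^ 2
        - (1 / 2) * Real.exp (-y 0) ^ 4 * (y 3 - y 1))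
      ((1 / 2) * Real.exp (-y 0) ^ 3 * ((y 0 - 1) * (y 3 - y 1)) + (3 / 4) * Real.exp (-y 0) ^ 4)
      (fun _ => 0) a := by
  rw [current_scalarSuperEnergy, Finset.sum_congr rfl fun c _ => by
    rw [scalarForm_wave, inv_waveMetric]]
  -- Writing e^w as the inverse of F = e^{−w} makes every component a rational identity in F.
  have hE : Real.exp (y 0) = (Real.exp (-y 0))⁻¹ := by rw [Real.exp_neg, inv_inv]
  have h₀ : Real.exp (-y 0) ≠ 0 := Real.exp_ne_zero _
  revert a
  refine fourAnd_cases ?_ ?_ ?_ ?_ fun k => ?_ <;>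
  simp only [sum_fourAnd, waveInverse, waveMetric, waveChristoffel, waveSquare, fourAnd_zero,
    fourAnd_one, fourAnd_two, fourAnd_three, fourAnd_addNat, Matrix.of_apply, mul_zero, zero_mul,
    add_zero, zero_add, Finset.sum_const_zero, hE, sub_zero, sub_self, mul_one]
  all_goals
    generalize Real.exp (-y 0) = F at h₀
    field_simp
    ring

/-- The current has no ∂_w component and the volume density depends on w alone, so the divergence is
the sum of ∂_a J^a. At the origin only ∂_y J^y contributes, through the factor (w − 1)(y − u). -/
theorem divergence_wave : divergence (waveMetric m) (current (waveMetric m)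
    (scalarSuperEnergy (waveMetric m) (waveField m)) (fun _ => waveVector m)) 0 = -(1 / 4) := by
  rw [divergence]
  simp only [current_wave, christoffel_waveMetric]
  simp (disch := fun_prop) only [sum_fourAnd, waveChristoffel, fourAnd_zero,
    fourAnd_one, fourAnd_two, fourAnd_three, fourAnd_addNat, pd_const, pd_mul, pd_add, pow_succ,
    pow_zero,
    pd_sub, pd_exp_neg, pd_coord_zero, pd_coord_one, pd_coord_three, mul_zero, zero_mul,
    add_zero, zero_add, sub_zero, sub_self, Finset.sum_const_zero, mul_one, one_mul]
  simp
  norm_num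

end WaveCurrent

end SuperEnergy

/-! ### The wave solution as a Lorentzian manifold -/

namespace SuperEnergy

section MatrixForm

variable {n : ℕ}

/-- The bilinear form with the given matrix. -/
noncomputable def matrixForm (G : Matrix (Fin n) (Fin n) ℝ) : Coord n →L[ℝ] Coord n →L[ℝ] ℝ :=
  ∑ a, ∑ b, G a b • (EuclideanSpace.proj (𝕜 := ℝ) a : Coord n →L[ℝ] ℝ).smulRight
    (EuclideanSpace.proj (𝕜 := ℝ) b : Coord n →L[ℝ] ℝ)

theorem matrixForm_apply (G : Matrix (Fin n) (Fin n) ℝ) (v w : Coord n) :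
    matrixForm G v w = ∑ a, ∑ b, G a b * (v a * w b) := by
  simp [matrixForm]

theorem contDiff_matrixForm {G : Coord n → Matrix (Fin n) (Fin n) ℝ}
    (hG : ∀ a b, ContDiff ℝ ∞ fun y => G y a b) : ContDiff ℝ ∞ fun y => matrixForm (G y) := by
  refine contDiff_clm_apply_iff.2 fun v => contDiff_clm_apply_iff.2 fun w => ?_
  simp only [matrixForm_apply]
  exact ContDiff.sum fun a _ => ContDiff.sum fun b _ => (hG a b).mul contDiff_const

/-- On the model space the trivializations of the tangent bundle, and therefore of the bundle of
bilinear forms, are the identity. Smoothness of the section is smoothness of the map into the fixed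
space of forms. -/
theorem contMDiff_bilinear
    {B : ∀ p : Coord n, TangentSpace (𝓡 n) p →L[ℝ] TangentSpace (𝓡 n) p →L[ℝ] ℝ}
    (hB : ContDiff ℝ ∞ (show Coord n → Coord n →L[ℝ] Coord n →L[ℝ] ℝ from B)) :
    ContMDiff (𝓡 n) ((𝓡 n).prod 𝓘(ℝ, Coord n →L[ℝ] Coord n →L[ℝ] ℝ)) ∞
    (fun p : Coord n => Bundle.TotalSpace.mk' (Coord n →L[ℝ] Coord n →L[ℝ] ℝ)
      (E := fun p : Coord n => TangentSpace (𝓡 n) p →L[ℝ] TangentSpace (𝓡 n) p →L[ℝ] ℝ) p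
      (B p)) := by
  intro p
  refine Bundle.contMDiffAt_totalSpace.2 ⟨contMDiffAt_id, ?_⟩
  refine hB.contDiffAt.contMDiffAt.congr_of_eventuallyEq (.of_forall fun y => ?_)
  refine (congrArg Prod.snd (hom_trivializationAt_apply (RingHom.id ℝ) p
    (⟨y, B y⟩ : Bundle.TotalSpace (Coord n →L[ℝ] Coord n →L[ℝ] ℝ) 
     (fun p : Coord n => TangentSpace (𝓡 n) p →L[ℝ] TangentSpace (𝓡 n) p →L[ℝ] ℝ)))).trans ?_
  simp only
  rw [ContinuousLinearMap.inCoordinates]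
  have hs (v : Coord n) : (trivializationAt (Coord n) (TangentSpace (𝓡 n)) p).symmL ℝ y v = v :=
    congrArg (fun L => L v) (TangentBundle.symmL_model_space (𝕜 := ℝ) p y)
  have hmem : y ∈ (trivializationAt (Coord n →L[ℝ] ℝ)
      (fun p : Coord n => TangentSpace (𝓡 n) p →L[ℝ] ℝ) p).baseSet := by
    rw [hom_trivializationAt_baseSet]
    simp [chartAt_self_eq]
  have hc (f : TangentSpace (𝓡 n) y →L[ℝ] ℝ) (w : Coord n) :
     (trivializationAt (Coord n →L[ℝ] ℝ)
      (fun p : Coord n => TangentSpace (𝓡 n) p →L[ℝ] ℝ) p).continuousLinearMapAt ℝ y f w = f w := by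
    rw [Bundle.Trivialization.continuousLinearMapAt_apply, 
      Bundle.Trivialization.coe_linearMapAt_of_mem _ hmem]
    dsimp only
    have := hom_trivializationAt_apply (RingHom.id ℝ) p
     (⟨y, f⟩ : Bundle.TotalSpace (Coord n →L[ℝ] ℝ) 
     (fun p : Coord n => TangentSpace (𝓡 n) p →L[ℝ] ℝ))
    refine (congrArg (fun q => (q.2 : Coord n →L[ℝ] ℝ) w) this).trans ?_
    simp only [ContinuousLinearMap.inCoordinates]
    refine (congrArg (fun L : ℝ →L[ℝ] ℝ => L (f _))
      (Bundle.Trivial.continuousLinearMapAt_trivialization ℝ (Coord n) ℝ y)).trans ?_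
    exact congrArg (f : Coord n →L[ℝ] ℝ) (hs w)
  ext v w
  refine (hc _ w).trans ?_
  exact congrArg (fun u => (show Coord n →L[ℝ] Coord n →L[ℝ] ℝ from B y) u w) (hs v)

theorem coordVector_refl (y : Coord n) (i : Fin n) :
    coordVector (OpenPartialHomeomorph.refl (Coord n)) y i
      = (EuclideanSpace.single i (1 : ℝ) : Coord n) := by
  simp only [coordVector]
  exact congrArg (fun L => L (EuclideanSpace.single i (1 : ℝ) : Coord n))
    (mfderiv_id (I := 𝓡 n) (M := Coord n) (x := y))

theorem vecInChart_refl (ξ : ∀ p : Coord n, TangentSpace (𝓡 n) p) (y : Coord n) (i : Fin n) :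
    vecInChart ξ (OpenPartialHomeomorph.refl (Coord n)) y i = (show Coord n from ξ y).ofLp i := by
  have h : mfderiv (𝓡 n) (𝓡 n) (OpenPartialHomeomorph.refl (Coord n)) y (ξ y) = ξ y :=
    congrArg (fun L => L (ξ y)) (mfderiv_id (I := 𝓡 n) (M := Coord n) (x := y))
  exact congrArg (fun v : Coord n => v i) h

end MatrixForm

section WaveManifold

variable {m : ℕ}

theorem smooth_waveMetric (a b : Fin (m + 4)) : ContDiff ℝ ∞ fun y => waveMetric m y a b := by
  revert a b
  refine fourAnd_cases ?_ ?_ ?_ ?_ fun k => ?_ <;> refine fourAnd_cases ?_ ?_ ?_ ?_ fun l => ?_ <;>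
  simp only [waveMetric, fourAnd_zero, fourAnd_one, fourAnd_two, fourAnd_three, fourAnd_addNat,
    Matrix.of_apply] <;> fun_prop

theorem waveMetric_symm (y : Coord (m + 4)) (a b : Fin (m + 4)) :
    waveMetric m y a b = waveMetric m y b a := by
  revert a b
  refine fourAnd_cases ?_ ?_ ?_ ?_ fun k => ?_ <;> refine fourAnd_cases ?_ ?_ ?_ ?_ fun l => ?_ <;>
  simp only [waveMetric, fourAnd_zero, fourAnd_one, fourAnd_two, fourAnd_three, fourAnd_addNat,
    Matrix.of_apply, eq_comm]

theorem matrixForm_wave (y v w : Coord (m + 4)) : matrixForm (waveMetric m y) v w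
    = Real.exp (y 0) ^ 2 * (v 0 * w 0) + Real.exp (y 0) * (y 0 * (y 3 - y 1) * (v 1 * w 1)
      + v 1 * w 2 + v 2 * w 1) + v 3 * w 3 + ∑ k : Fin m, v (k.addNat 4) * w (k.addNat 4) := by
  rw [matrixForm_apply]
  simp only [sum_fourAnd, waveMetric, fourAnd_zero, fourAnd_one, fourAnd_two, fourAnd_three,
    fourAnd_addNat, Matrix.of_apply, zero_mul, add_zero, zero_add, Finset.sum_const_zero, one_mul,
    ite_mul, Finset.sum_ite_eq, Finset.mem_univ, if_true]
  ring

theorem exists_timelike (y : Coord (m + 4)) : ∃ u : Coord (m + 4),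
    matrixForm (waveMetric m y) u u < 0 ∧
      ∀ w : Coord (m + 4), matrixForm (waveMetric m y) u w = 0 → w ≠ 0 →
        0 < matrixForm (waveMetric m y) w w := by
  have hE := Real.exp_pos (y 0)
  -- With H = w(y − u), the vector ∂_u − ((H + 1)/2) ∂_v has square −e^w. Orthogonality to it forces
  -- the v-component to be (1 − H)/2 times the u-component, after which the du, dv block contributes
  -- e^w times the square of the u-component.
  refine ⟨WithLp.toLp 2 (fourAnd 0 1 (-(y 0 * (y 3 - y 1) + 1) / 2) 0 fun _ => 0), ?_, ?_⟩
  · simp only [matrixForm_wave, fourAnd_zero, fourAnd_one, fourAnd_two, fourAnd_three,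
      fourAnd_addNat]
    simp only [mul_zero, Finset.sum_const_zero]
    linarith
  · intro w hw hw₀
    simp only [matrixForm_wave, fourAnd_zero, fourAnd_one, fourAnd_two, fourAnd_three,
      fourAnd_addNat, zero_mul, Finset.sum_const_zero] at hw
    have h₂ : w 2 = -(y 0 * (y 3 - y 1) - 1) / 2 * w 1 := by
      have h : Real.exp (y 0) * (w 2 + (y 0 * (y 3 - y 1) - 1) / 2 * w 1) = 0 := by linarith
      have := (mul_eq_zero.1 h).resolve_left hE.ne'
      linarith
    rw [matrixForm_wave, h₂]
    have hr : Real.exp (y 0) ^ 2 * (w 0 * w 0) + Real.exp (y 0) * (y 0 * (y 3 - y 1) * (w 1 * w 1)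
        + w 1 * (-(y 0 * (y 3 - y 1) - 1) / 2 * w 1) + -(y 0 * (y 3 - y 1) - 1) / 2 * w 1 * w 1)
        + w 3 * w 3 + ∑ k : Fin m, w (k.addNat 4) * w (k.addNat 4)
        = Real.exp (y 0) ^ 2 * (w 0 * w 0) + (Real.exp (y 0) * (w 1 * w 1)
        + (w 3 * w 3 + ∑ k : Fin m, w (k.addNat 4) * w (k.addNat 4))) := by ring
    rw [hr]
    have n₀ : 0 ≤ Real.exp (y 0) ^ 2 * (w 0 * w 0) :=
      mul_nonneg (pow_pos hE 2).le (mul_self_nonneg _)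
    have n₁ : 0 ≤ Real.exp (y 0) * (w 1 * w 1) := mul_nonneg hE.le (mul_self_nonneg _)
    have n₃ := mul_self_nonneg (w 3)
    have n₄ : 0 ≤ ∑ k : Fin m, w (k.addNat 4) * w (k.addNat 4) :=
      Finset.sum_nonneg fun k _ => mul_self_nonneg _
    by_contra hneg
    apply hw₀
    have z₀ : w 0 = 0 := by
      have h : Real.exp (y 0) ^ 2 * (w 0 * w 0) = 0 := by linarith
      exact mul_self_eq_zero.1 ((mul_eq_zero.1 h).resolve_left (pow_pos hE 2).ne')
    have z₁ : w 1 = 0 := by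
      have h : Real.exp (y 0) * (w 1 * w 1) = 0 := by linarith
      exact mul_self_eq_zero.1 ((mul_eq_zero.1 h).resolve_left hE.ne')
    have z₃ : w 3 = 0 := mul_self_eq_zero.1 (by linarith)
    have z₄ : ∀ k : Fin m, w (k.addNat 4) = 0 := fun k => mul_self_eq_zero.1
      ((Finset.sum_eq_zero_iff_of_nonneg fun k _ => mul_self_nonneg _).1
        (le_antisymm (by linarith) n₄) k (Finset.mem_univ k))
    ext a
    revert a
    exact fourAnd_cases z₀ z₁ (by rw [h₂, z₁, mul_zero]; rfl) z₃ z₄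

/-- The metric `waveMetric` as a Lorentzian metric. -/
noncomputable def waveLorentz (m : ℕ) : LorentzMetric (m + 4) (Coord (m + 4)) where
  val p := matrixForm (waveMetric m p)
  symm p v w := by
    refine (matrixForm_apply _ _ _).trans (Eq.trans ?_ (matrixForm_apply _ _ _).symm)
    rw [Finset.sum_comm]
    exact Finset.sum_congr rfl fun a _ => Finset.sum_congr rfl fun b _ => by
      rw [waveMetric_symm, mul_comm (v.ofLp b)]
  lorentzian p := exists_timelike p
  contMDiff := contMDiff_bilinear (contDiff_matrixForm smooth_waveMetric)

theorem waveLorentz_inChart :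
    (waveLorentz m).inChart (OpenPartialHomeomorph.refl (Coord (m + 4))) = waveMetric m := by
  funext y
  ext i j
  simp only [LorentzMetric.inChart, Matrix.of_apply, coordVector_refl]
  refine (matrixForm_apply _ _ _).trans ?_
  simp

/-- The Killing vector field `∂_u + ∂_y`. -/
def waveKilling (m : ℕ) (p : Coord (m + 4)) : TangentSpace (𝓡 (m + 4)) p :=
  (WithLp.toLp 2 (waveVector m) : Coord (m + 4))

theorem waveKilling_inChart :
    vecInChart (waveKilling m) (OpenPartialHomeomorph.refl (Coord (m + 4)))
      = fun _ => waveVector m := by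
  funext y i
  exact vecInChart_refl _ _ _

theorem funInChart_refl {n : ℕ} (φ : Coord n → ℝ) :
    funInChart φ (OpenPartialHomeomorph.refl (Coord n)) = φ := rfl

end WaveManifold

end SuperEnergy

/-! ### Separate non-conservation of the two currents -/

namespace SuperEnergy

section Additivity

variable {n : ℕ} {g : Coord n → Matrix (Fin n) (Fin n) ℝ} {U : Set (Coord n)} {y : Coord n}

theorem current_add (S T : Coord n → Fin n → Fin n → Fin n → Fin n → ℝ) (ξ : Coord n → Fin n → ℝ) :
    current g (fun z a b l m => S z a b l m + T z a b l m) ξ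
      = fun z a => current g S ξ z a + current g T ξ z a := by
  funext z a
  simp only [current, ← Finset.sum_add_distrib, mul_add, add_mul]

theorem divergence_add {J K : Coord n → Fin n → ℝ}
    (hJ : ∀ a, DifferentiableAt ℝ (fun z => J z a) y)
    (hK : ∀ a, DifferentiableAt ℝ (fun z => K z a) y) :
    divergence g (fun z a => J z a + K z a) y = divergence g J y + divergence g K y := by
  simp only [divergence, fun a => pd_add a (hJ a) (hK a), mul_add, Finset.sum_add_distrib]
  ring

theorem IsMetricOn.differentiableAt_current (hg : IsMetricOn g U) (hy : y ∈ U)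
    {T : Coord n → Fin n → Fin n → Fin n → Fin n → ℝ} {ξ : Coord n → Fin n → ℝ}
    (hT : ∀ a b l m, ContDiffAt ℝ ∞ (fun z => T z a b l m) y)
    (hξ : ∀ i, ContDiffAt ℝ ∞ (fun z => ξ z i) y) (a : Fin n) :
    DifferentiableAt ℝ (fun z => current g T ξ z a) y := by
  rw [current_eq]
  exact (ContDiffAt.sum fun c _ => (hg.smooth_inv hy a c).mul
    (smooth_cubic hT hξ c)).differentiableAt (by simp)

end Additivity

section Chart

variable {n : ℕ} {M : Type*} [TopologicalSpace M] [ChartedSpace (Coord n) M]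
  [IsManifold (𝓡 n) ∞ M]

theorem divMixedCurrent_eq_add {e : OpenPartialHomeomorph M (Coord n)} (he : e ∈ atlas (Coord n) M)
    {g : LorentzMetric n M} {φ : M → ℝ} {ξ : ∀ p : M, TangentSpace (𝓡 n) p}
    (hφ : ContMDiff (𝓡 n) 𝓘(ℝ, ℝ) ∞ φ) (hξ : SmoothVectorField ξ) {p : M} (hpe : p ∈ e.source) :
    divMixedCurrent g φ ξ e p = divBelCurrent g ξ e p + divScalarCurrent g φ ξ e p := by
  have hg := isMetricOn_inChart he g
  have hy := e.map_source hpe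
  have hv := smooth_vecInChart he hξ hy
  rw [divMixedCurrent, current_add]
  exact divergence_add (hg.differentiableAt_current hy (hg.smooth_bel hy) hv)
    (hg.differentiableAt_current hy
      (hg.smooth_scalarSuperEnergy hy fun z hz => smooth_funInChart he hφ hz) hv)

end Chart

section WaveManifold

variable {m : ℕ}

theorem contMDiff_waveField : ContMDiff (𝓡 (m + 4)) 𝓘(ℝ, ℝ) ∞ (waveField m) := by
  have h : ContDiff ℝ ∞ fun y : Coord (m + 4) => Real.sqrt (1 / 2) * y 0 := by fun_prop
  exact h.contMDiff

theorem smoothVectorField_waveKilling : SmoothVectorField (waveKilling m) :=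
  contMDiff_vectorSpace_iff_contDiff.2 contDiff_const

theorem refl_mem_atlas (n : ℕ) : OpenPartialHomeomorph.refl (Coord n) ∈ atlas (Coord n) (Coord n) :=
  chartedSpaceSelf_atlas.2 rfl

theorem einsteinKleinGordon_wave : EinsteinKleinGordon (waveLorentz m) (waveField m) := by
  intro e he y _
  obtain rfl := chartedSpaceSelf_atlas.1 he
  rw [waveLorentz_inChart, funInChart_refl]
  exact einsteinKleinGordonAt_wave y

theorem isKilling_wave : IsKilling (waveLorentz m) (waveKilling m) := by
  intro e he y _
  obtain rfl := chartedSpaceSelf_atlas.1 he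
  rw [waveLorentz_inChart, waveKilling_inChart]
  exact killingAt_wave y

theorem waveKilling_waveField (p : Coord (m + 4)) :
    mfderiv (𝓡 (m + 4)) 𝓘(ℝ, ℝ) (waveField m) p (waveKilling m p) = 0 := by
  have h : ∑ i, waveVector m i * pd i (waveField m) p = 0 := by
    simp [pd_waveField, sum_fourAnd, waveVector, fourAnd_zero, fourAnd_one, fourAnd_two,
      fourAnd_three, fourAnd_addNat]
  refine Eq.trans ?_ h
  have hs := sum_vecInChart_pd (refl_mem_atlas (m + 4)) contMDiff_waveField (waveKilling m)
    (y := p) (Set.mem_univ _)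
  rw [waveKilling_inChart, funInChart_refl] at hs
  exact hs.symm

theorem divScalarCurrent_wave :
    divScalarCurrent (waveLorentz m) (waveField m) (waveKilling m)
      (OpenPartialHomeomorph.refl (Coord (m + 4))) 0 = -(1 / 4) := by
  rw [divScalarCurrent, waveLorentz_inChart, waveKilling_inChart, funInChart_refl]
  exact divergence_wave

/-- The sum of the two divergences vanishes by the conservation law, so the scalar value determines
this one; the Bel tensor is never evaluated. -/
theorem divBelCurrent_wave :
    divBelCurrent (waveLorentz m) (waveKilling m)
      (OpenPartialHomeomorph.refl (Coord (m + 4))) 0 = 1 / 4 := by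
  have h := divMixedCurrent_eq_zero (refl_mem_atlas (m + 4)) contMDiff_waveField
    smoothVectorField_waveKilling einsteinKleinGordon_wave isKilling_wave
    (waveKilling_waveField 0) (Set.mem_univ _)
  rw [divMixedCurrent_eq_add (refl_mem_atlas (m + 4)) contMDiff_waveField
    smoothVectorField_waveKilling (Set.mem_univ _), divScalarCurrent_wave] at h
  linarith

end WaveManifold

end SuperEnergy
theorem mainTheorem9 :
    -- the mixed current is divergence-free
    (∀ (n : ℕ) (M : Type*) [TopologicalSpace M] [ChartedSpace (SuperEnergy.Coord n) M]
      [IsManifold (𝓡 n) ∞ M] (g : SuperEnergy.LorentzMetric n M) (φ : M → ℝ)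
      (ξ : ∀ p : M, TangentSpace (𝓡 n) p),
      ContMDiff (𝓡 n) 𝓘(ℝ, ℝ) ∞ φ →
      SuperEnergy.SmoothVectorField ξ →
      SuperEnergy.EinsteinKleinGordon g φ →
      SuperEnergy.IsKilling g ξ →
      ∀ p : M, mfderiv (𝓡 n) 𝓘(ℝ, ℝ) φ p (ξ p) = 0 →
        ∀ e ∈ atlas (SuperEnergy.Coord n) M, p ∈ e.source →
          SuperEnergy.divMixedCurrent g φ ξ e p = 0) ∧
    -- neither of its two pieces is conserved separately
    (∀ n : ℕ, 4 ≤ n →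
      ∃ (g : SuperEnergy.LorentzMetric n (SuperEnergy.Coord n)) (φ : SuperEnergy.Coord n → ℝ)
        (ξ : ∀ p : SuperEnergy.Coord n, TangentSpace (𝓡 n) p),
        ContMDiff (𝓡 n) 𝓘(ℝ, ℝ) ∞ φ ∧
        SuperEnergy.SmoothVectorField ξ ∧
        SuperEnergy.EinsteinKleinGordon g φ ∧
        SuperEnergy.IsKilling g ξ ∧
        (∀ p : SuperEnergy.Coord n, mfderiv (𝓡 n) 𝓘(ℝ, ℝ) φ p (ξ p) = 0) ∧
        ∃ p : SuperEnergy.Coord n,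
          SuperEnergy.divBelCurrent g ξ (chartAt (SuperEnergy.Coord n) p) p ≠ 0 ∧
          SuperEnergy.divScalarCurrent g φ ξ (chartAt (SuperEnergy.Coord n) p) p ≠ 0) := by
  refine ⟨fun n M _ _ _ g φ ξ hφ hξ hE hK p hp e he hpe =>
    SuperEnergy.divMixedCurrent_eq_zero he hφ hξ hE hK hp hpe, fun n hn => ?_⟩
  -- The m extra coordinates are flat directions, on which neither the remaining metric components
  -- nor the field depend.
  obtain ⟨m, rfl⟩ := Nat.exists_eq_add_of_le' hn
  refine ⟨SuperEnergy.waveLorentz m, SuperEnergy.waveField m, SuperEnergy.waveKilling m,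
    SuperEnergy.contMDiff_waveField, SuperEnergy.smoothVectorField_waveKilling,
    SuperEnergy.einsteinKleinGordon_wave, SuperEnergy.isKilling_wave,
    SuperEnergy.waveKilling_waveField, 0, ?_⟩
  rw [chartAt_self_eq, SuperEnergy.divBelCurrent_wave, SuperEnergy.divScalarCurrent_wave]
  norm_num
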